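/- Let $G=(V,E)$ be a finite simple graph. A set $F\subseteq V$ is a \emph{vertex cover $P_3$ set} ($VCP_3$ set) of $G$ if every path of $G$ on three vertices contains a vertex of $F$. A \emph{tree decomposition} of $G$ is a rooted tree $T$ with a bag $X_i\subseteq V$ for each node $i$ such that the bags cover $V$, every edge of $G$ has both its ends in a common bag, and $X_i\cap X_k\subseteq X_j$ whenever $j$ lies on the path from $i$ to $k$ in $T$; its width is $\max_i|X_i|-1$, and its size is $\|T\|=\sum_i(|X_i|+1)$, the sum ranging over all nodes $i$ of $T$. Theorem. There is a deterministic algorithm that, given an $n$-vertex graph $G$ together with a tree decomposition $T$ of $G$ of width at most $p$, where $p\ge 1$, computes a minimum-cardinality $VCP_3$ set of $G$ in time $O(3^{p}\cdot p\,n^{6}+\|T\|)$, where the constant is absolute and the second term only accounts for reading the given decomposition. In particular, the time is $O(3^{p}\cdot p\,n^{6})$ whenever $\|T\|=O(3^{p}\cdot p\,n^{6})$, for instance if $n\ge 1$ and $T$ has $O(pn)$ nodes. Here time is the number of steps of a random access machine with words of $O(p+\log(n+m))$ bits, where $m$ is the number of nodes of $T$, whose unit-cost operations include addition, truncated subtraction,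 multiplication, and division with remainder. The graph is given by its adjacency matrix, and the decomposition by its root, the parent of each node, and a list of each bag. -/

import Mathlib

/-! ### Vertex cover `P_t` sets -/

/-- `F` is a vertex cover `P_t` set of `G`: every path of `G` on `t` vertices contains
a vertex of `F`. -/
def IsVCP {V : Type*} (t : ℕ) (G : SimpleGraph V) (F : Finset V) : Prop :=
  ∀ (u v : V) (q : G.Walk u v), q.IsPath → q.support.length = t → ∃ x ∈ q.support, x ∈ F

/-- `F` is a vertex cover `P_t` set of `G` of minimum cardinality. -/
def IsMinimumVCP {V : Type*} (t : ℕ) (G : SimpleGraph V) (F : Finset V) : Prop :=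
  IsVCP t G F ∧ ∀ F' : Finset V, IsVCP t G F' → F.card ≤ F'.card

/-! ### Tree decompositions -/

/-- A tree decomposition of `G`: a rooted tree on the node set `I`, with a bag for each node. -/
structure TreeDecomposition {V : Type*} (G : SimpleGraph V) (I : Type*) where
  /-- the underlying tree -/
  tree : SimpleGraph I
  isTree : tree.IsTree
  /-- the root of the tree -/
  root : I
  /-- the bag of a node -/
  bag : I → Finset V
  /-- the bags cover all vertices -/
  exists_mem_bag : ∀ v : V, ∃ i : I, v ∈ bag i
  /-- every edge lies in some bag -/
  exists_edge_bag : ∀ u v : V, G.Adj u v → ∃ i : I, u ∈ bag i ∧ v ∈ bag i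
  /-- if `j` lies on the path from `i` to `k`, then `bag i ∩ bag k ⊆ bag j` -/
  mem_bag_of_path : ∀ (i k : I) (q : tree.Walk i k), q.IsPath → ∀ j ∈ q.support,
    ∀ v : V, v ∈ bag i → v ∈ bag k → v ∈ bag j

namespace TreeDecomposition

/-- The width: the maximum cardinality of a bag, minus one (an integer, as all bags may be empty
when the graph has no vertices). -/
def width {V I : Type*} [Fintype I] {G : SimpleGraph V} (D : TreeDecomposition G I) : ℤ :=
  ((Finset.univ.sup fun i => (D.bag i).card : ℕ) : ℤ) - 1

/-- The size of the decomposition: the number of nodes plus the sum of the bag cardinalities. -/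
def size {V I : Type*} [Fintype I] {G : SimpleGraph V} (D : TreeDecomposition G I) : ℕ :=
  ∑ i, ((D.bag i).card + 1)

/-- The parent of a node: the second vertex of the path from the node to the root.
The root is its own parent. -/
noncomputable def parent {V I : Type*} {G : SimpleGraph V} (D : TreeDecomposition G I)
    (i : I) : I :=
  (D.isTree.existsUnique_path i D.root).choose.snd

end TreeDecomposition

/-! ### A word random access machine with a step count -/

namespace RAM

/-- The binary arithmetic operations of the machine. -/
inductive Op where
  | add | sub | mul | div | mod

/-- Subtraction is truncated at `0`; division by `0` yields `0`, and `a mod 0 = a`. -/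
def Op.eval : Op → ℕ → ℕ → ℕ
  | .add, a, b => a + b
  | .sub, a, b => a - b
  | .mul, a, b => a * b
  | .div, a, b => a / b
  | .mod, a, b => a % b

/-- Structured programs for the machine. Registers are named by natural numbers; a program
mentions only finitely many of them. -/
inductive Cmd where
  /-- do nothing -/
  | skip : Cmd
  /-- `r := k` -/
  | const (r k : ℕ) : Cmd
  /-- `r := a ∘ b` for registers `a`, `b` and an arithmetic operation `∘` -/
  | op (o : Op) (r a b : ℕ) : Cmd
  /-- `r := mem[a]`, with the address taken from register `a` -/
  | load (r a : ℕ) : Cmd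
  /-- `mem[a] := r`, with the address taken from register `a` -/
  | store (a r : ℕ) : Cmd
  /-- run the first program, then the second one -/
  | seq (P Q : Cmd) : Cmd
  /-- run the first program if register `r` is nonzero, and the second one otherwise -/
  | ite (r : ℕ) (P Q : Cmd) : Cmd
  /-- run the program as long as register `r` is nonzero -/
  | loop (r : ℕ) (P : Cmd) : Cmd

/-- A state of the machine: the contents of the registers and of the memory cells. -/
structure State where
  reg : ℕ → ℕ
  mem : ℕ → ℕ

/-- The initial state: all registers are `0`, and the memory holds the input in its first cells
and `0` in all others. -/
def init (input : List ℕ) : State where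
  reg := fun _ => 0
  mem := fun a => input.getD a 0

/-- `Exec w P s t s'`: on the machine with word length `w`, the program `P`, started in state `s`,
halts after exactly `t` steps in state `s'`. Each instruction and each evaluation of the test of
a branch or of a loop is one step. A register can receive only numbers of at most `w` bits: a run
that would produce a larger number is aborted, that is, it has no final state. -/
inductive Exec (w : ℕ) : Cmd → State → ℕ → State → Prop where
  | skip (s : State) : Exec w .skip s 1 s
  | const (s : State) (r k : ℕ) (hk : k < 2 ^ w) :
      Exec w (.const r k) s 1 { s with reg := Function.update s.reg r k }
  | op (s : State) (o : Op) (r a b : ℕ) (h : o.eval (s.reg a) (s.reg b) < 2 ^ w) :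
      Exec w (.op o r a b) s 1
        { s with reg := Function.update s.reg r (o.eval (s.reg a) (s.reg b)) }
  | load (s : State) (r a : ℕ) (h : s.mem (s.reg a) < 2 ^ w) :
      Exec w (.load r a) s 1 { s with reg := Function.update s.reg r (s.mem (s.reg a)) }
  | store (s : State) (a r : ℕ) :
      Exec w (.store a r) s 1 { s with mem := Function.update s.mem (s.reg a) (s.reg r) }
  | seq {P Q : Cmd} {s s' s'' : State} {t t' : ℕ} (h : Exec w P s t s')
      (h' : Exec w Q s' t' s'') : Exec w (.seq P Q) s (t + t') s''
  | ite_true {P Q : Cmd} {s s' : State} {t r : ℕ} (hr : s.reg r ≠ 0) (h : Exec w P s t s') :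
      Exec w (.ite r P Q) s (t + 1) s'
  | ite_false {P Q : Cmd} {s s' : State} {t r : ℕ} (hr : s.reg r = 0) (h : Exec w Q s t s') :
      Exec w (.ite r P Q) s (t + 1) s'
  | loop_done {P : Cmd} {s : State} {r : ℕ} (hr : s.reg r = 0) : Exec w (.loop r P) s 1 s
  | loop_step {P : Cmd} {s s' s'' : State} {t t' r : ℕ} (hr : s.reg r ≠ 0)
      (h : Exec w P s t s') (h' : Exec w (.loop r P) s' t' s'') :
      Exec w (.loop r P) s (t + t' + 1) s''

end RAM

/-! ### The input of the algorithm -/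

open Classical in
/-- The input word for a graph on `n` vertices with a tree decomposition on `m` nodes: the numbers
`n` and `m`, the root, the adjacency matrix row by row, the parents of the nodes, and then, for
each node, the cardinality of its bag followed by the elements of its bag in increasing order. -/
noncomputable def encodeInput {n m : ℕ} (G : SimpleGraph (Fin n))
    (D : TreeDecomposition G (Fin m)) : List ℕ :=
  [n, m, (D.root : ℕ)]
    ++ (List.ofFn fun u : Fin n => List.ofFn fun v : Fin n =>
        if G.Adj u v then 1 else 0).flatten
    ++ (List.ofFn fun i : Fin m => (D.parent i : ℕ))
    ++ (List.ofFn fun i : Fin m =>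
        (D.bag i).card :: ((D.bag i).sort (· ≤ ·)).map (fun v : Fin n => (v : ℕ))).flatten

/-! A set F is a VCP_3 set exactly when every vertex outside F has at most one neighbour outside F
(`isVCP_three_iff`). The task is therefore to find a largest set S of kept vertices that induces
maximum degree at most one.

The decomposition serves only to produce an elimination order. Each vertex v has a unique top node,
the node closest to the root whose bag contains v; call u a relative of v if u lies in the bag of
the top node of v. Two vertices of a common bag are relatives in at least one direction
(`mem_bag_top_or`), and among any remaining vertices one with deepest top can be eliminated next
(`exists_simplicial`). In the resulting order each vertex has at most p later relatives, and of any
two of these the earlier has the later as a relative (`elimOrder_ord`). Colouring greedily from the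
end thus takes b ≤ p + 1 colours (`colors_le`), and a vertex and its later relatives always get
distinct colours.

The dynamic program keeps one table per vertex v, for the set D of vertices merged into v so far.
The vertices outside D with a neighbour in D lie among v and its later relatives (`desc_boundary`),
so a colour names at most one of them. A boundary condition is a number in base three with one digit
per colour: two for a deleted vertex, otherwise the number, zero or one, of kept neighbours in D.
Eliminating i is a local recurrence (`val_insert`). The new table is then merged into that of the
first later relative of i, where digits two must agree and the other digits add without exceeding
one (`val_union`).

Merging by enumeration of compatible pairs would take 4^b steps. Instead, the tables are summed over
all ways of lowering digits one to zero, multiplied pointwise, and transformed back; this yields the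
pairs whose ones have the prescribed union. Recording the number of ones singles out the disjoint
pairs (`unionProd_ranked`). Cost and number of ones are packed into one exponent, so the pointwise
product is a single convolution of length O(nb). There are b + 1 layers of 3^b codes, which gives
O(3^b (b + 1) n^4) per elimination when b ≤ n. There are n eliminations in a sweep, and n + 1
sweeps: the first computes the optimum, and the others force the vertices one at a time whenever
this preserves it (`search_spec`). The total is O(3^p p n^6), plus linear time for reading the bags.

The program is written in a language of bounded loops whose semantics is a function and whose cost
is a number. `Hl.compile_spec` turns safety and cost in this language into a run of the machine,
with a bound on its steps and on the word length. -/

/-! ### A small language of bounded loops -/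

namespace RAM

set_option linter.unusedSectionVars false

/-- Expressions over scalar variables `ν` and arrays `α`. `sum r x e` is the sum of `e` over
all values of `r` below `x`. -/
inductive Ex (ν α : Type) where
  | var (r : ν) : Ex ν α
  | lit (k : ℕ) : Ex ν α
  | op (o : Op) (a b : Ex ν α) : Ex ν α
  | get (a : α) (i : Ex ν α) : Ex ν α
  | sum (r x : ν) (e : Ex ν α) : Ex ν α

/-- Programs: `inp` reads a cell of the input area into a variable, `out` writes one, and
`rep r x P` runs `P` for all values of `r` below `x` and restores `r` afterwards. -/
inductive Hl (ν α : Type) where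
  | set (r : ν) (e : Ex ν α) : Hl ν α
  | put (a : α) (i e : Ex ν α) : Hl ν α
  | inp (r : ν) (i : Ex ν α) : Hl ν α
  | out (i e : Ex ν α) : Hl ν α
  | seq (P Q : Hl ν α) : Hl ν α
  | rep (r x : ν) (P : Hl ν α) : Hl ν α

/-- The values of the variables, of the arrays, and of the cells of the input area. -/
structure St (ν α : Type) where
  v : ν → ℕ
  a : α → ℕ → ℕ
  io : ℕ → ℕ

variable {ν α : Type} [DecidableEq ν] [DecidableEq α]

def St.setv (σ : St ν α) (r : ν) (k : ℕ) : St ν α := { σ with v := Function.update σ.v r k }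

def St.seta (σ : St ν α) (a : α) (A : ℕ → ℕ) : St ν α :=
  { σ with a := Function.update σ.a a A }

def St.setio (σ : St ν α) (i k : ℕ) : St ν α := { σ with io := Function.update σ.io i k }

@[simp] theorem St.setv_v (σ : St ν α) (r : ν) (k : ℕ) :
    (σ.setv r k).v = Function.update σ.v r k := rfl
@[simp] theorem St.setv_a (σ : St ν α) (r : ν) (k : ℕ) : (σ.setv r k).a = σ.a := rfl
@[simp] theorem St.setv_io (σ : St ν α) (r : ν) (k : ℕ) : (σ.setv r k).io = σ.io := rfl
@[simp] theorem St.seta_v (σ : St ν α) (a : α) (A : ℕ → ℕ) : (σ.seta a A).v = σ.v := rfl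
@[simp] theorem St.seta_a (σ : St ν α) (a : α) (A : ℕ → ℕ) :
    (σ.seta a A).a = Function.update σ.a a A := rfl
@[simp] theorem St.seta_io (σ : St ν α) (a : α) (A : ℕ → ℕ) : (σ.seta a A).io = σ.io := rfl
@[simp] theorem St.setio_v (σ : St ν α) (i k : ℕ) : (σ.setio i k).v = σ.v := rfl
@[simp] theorem St.setio_a (σ : St ν α) (i k : ℕ) : (σ.setio i k).a = σ.a := rfl
@[simp] theorem St.setio_io (σ : St ν α) (i k : ℕ) :
    (σ.setio i k).io = Function.update σ.io i k := rfl

def Ex.eval : Ex ν α → St ν α → ℕ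
  | var r, σ => σ.v r
  | lit k, _ => k
  | op o a b, σ => o.eval (a.eval σ) (b.eval σ)
  | get a i, σ => σ.a a (i.eval σ)
  | sum r x e, σ => ∑ i ∈ Finset.range (σ.v x), e.eval (σ.setv r i)

/-- The number of summands evaluated. -/
def Ex.cost : Ex ν α → St ν α → ℕ
  | var _, _ => 0
  | lit _, _ => 0
  | op _ a b, σ => a.cost σ + b.cost σ
  | get _ i, σ => i.cost σ
  | sum r x e, σ => 1 + ∑ i ∈ Finset.range (σ.v x), (1 + e.cost (σ.setv r i))

/-- The bound of a loop is read once on entry, the loop variable is set anew in every round, and it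
is restored on exit. A body may therefore change either variable without affecting the number of
rounds. -/
def Hl.run : Hl ν α → St ν α → St ν α
  | set r e, σ => σ.setv r (e.eval σ)
  | put a i e, σ => σ.seta a (Function.update (σ.a a) (i.eval σ) (e.eval σ))
  | inp r i, σ => σ.setv r (σ.io (i.eval σ))
  | out i e, σ => σ.setio (i.eval σ) (e.eval σ)
  | seq P Q, σ => Q.run (P.run σ)
  | rep r x P, σ =>
      (Nat.rec σ (fun i τ => P.run (τ.setv r i)) (σ.v x) : St ν α).setv r (σ.v r)

/-- The state after `i` rounds of the loop `rep r x P`. -/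
def Hl.iter (r : ν) (P : Hl ν α) (σ : St ν α) (i : ℕ) : St ν α :=
  Nat.rec σ (fun i τ => P.run (τ.setv r i)) i

def Hl.cost : Hl ν α → St ν α → ℕ
  | set _ e, σ => 1 + e.cost σ
  | put _ i e, σ => 1 + i.cost σ + e.cost σ
  | inp _ i, σ => 1 + i.cost σ
  | out i e, σ => 1 + i.cost σ + e.cost σ
  | seq P Q, σ => P.cost σ + Q.cost (P.run σ)
  | rep r x P, σ =>
      1 + ∑ i ∈ Finset.range (σ.v x), (1 + P.cost ((P.iter r σ i).setv r i))

/-- All values assigned are at most `B`, and all accesses to the input area are to its first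
`N` cells. -/
def Hl.Safe (B N : ℕ) : Hl ν α → St ν α → Prop
  | set _ e, σ => e.eval σ ≤ B
  | put _ _ e, σ => e.eval σ ≤ B
  | inp _ i, σ => i.eval σ < N
  | out i e, σ => i.eval σ < N ∧ e.eval σ ≤ B
  | seq P Q, σ => P.Safe B N σ ∧ Q.Safe B N (P.run σ)
  | rep r x P, σ => ∀ i < σ.v x, P.Safe B N ((P.iter r σ i).setv r i)

/-- All values are at most `B`. -/
def St.Bd (B : ℕ) (σ : St ν α) : Prop :=
  (∀ r, σ.v r ≤ B) ∧ (∀ a i, σ.a a i ≤ B) ∧ ∀ i, σ.io i ≤ B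

theorem St.Bd.setv {B : ℕ} {σ : St ν α} (h : σ.Bd B) (r : ν) {k : ℕ} (hk : k ≤ B) :
    (σ.setv r k).Bd B := by
  refine ⟨fun q => ?_, h.2⟩
  by_cases hq : q = r
  · subst hq; simpa using hk
  · simpa [hq] using h.1 q

/-- The claim for the body is a hypothesis, so that this can be used inside the induction for
`Hl.bd_run` and again in `Hl.compile_spec`, where the intermediate states of a loop are needed. -/
theorem Hl.bd_iter {B N : ℕ} {P : Hl ν α} {r x : ν} {σ : St ν α} (h : σ.Bd B)
    (hP : ∀ τ : St ν α, τ.Bd B → P.Safe B N τ → (P.run τ).Bd B)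
    (hs : (Hl.rep r x P).Safe B N σ) :
    ∀ i ≤ σ.v x, (P.iter r σ i).Bd B := by
  intro i hi
  induction i with
  | zero => exact h
  | succ i ih =>
    exact hP _ ((ih (by omega)).setv r ((le_of_lt hi).trans (h.1 x))) (hs i (by omega))

theorem Hl.bd_run {B N : ℕ} (P : Hl ν α) :
    ∀ {σ : St ν α}, σ.Bd B → P.Safe B N σ → (P.run σ).Bd B := by
  induction P with
  | set r e => intro σ h hs; exact h.setv r hs
  | put a i e =>
    intro σ h hs
    refine ⟨h.1, fun b j => ?_, h.2.2⟩
    by_cases hb : b = a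
    · subst hb
      by_cases hj : j = i.eval σ
      · subst hj; simpa [Hl.run, Hl.Safe] using hs
      · simpa [Hl.run, hj] using h.2.1 b j
    · simpa [Hl.run, hb] using h.2.1 b j
  | inp r i => intro σ h hs; exact h.setv r (h.2.2 _)
  | out i e =>
    intro σ h hs
    refine ⟨h.1, h.2.1, fun j => ?_⟩
    by_cases hj : j = i.eval σ
    · subst hj; simpa [Hl.run] using hs.2
    · simpa [Hl.run, hj] using h.2.2 j
  | seq P Q ihP ihQ => intro σ h hs; exact ihQ (ihP h hs.1) hs.2
  | rep r x P ih =>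
    intro σ h hs
    exact (Hl.bd_iter h (fun τ h1 h2 => ih h1 h2) hs _ le_rfl).setv r (h.1 r)

/-- An exponent: evaluating the expression on values of at most `B` produces only numbers of at
most `B ^ e.deg`, if `K` is the number of arrays. -/
def Ex.deg (K : ℕ) : Ex ν α → ℕ
  | var _ => 1
  | lit k => k + 1
  | op _ a b => a.deg K + b.deg K
  | get _ i => i.deg K + K + 3
  | sum _ _ e => e.deg K + 2

theorem Ex.deg_pos (K : ℕ) (e : Ex ν α) : 1 ≤ e.deg K := by
  induction e with
  | _ => simp only [Ex.deg]; omega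

def Hl.deg (K : ℕ) : Hl ν α → ℕ
  | set _ e => e.deg K
  | put _ i e => i.deg K + e.deg K + K + 3
  | inp _ i => i.deg K
  | out i e => i.deg K + e.deg K
  | seq P Q => P.deg K + Q.deg K
  | rep _ _ P => P.deg K + 2

theorem Hl.deg_pos (K : ℕ) (P : Hl ν α) : 1 ≤ P.deg K := by
  induction P with
  | set r e => exact e.deg_pos K
  | inp r i => exact i.deg_pos K
  | out i e => have := i.deg_pos K; simp only [Hl.deg]; omega
  | _ => simp only [Hl.deg]; omega

/-- Both powers are at least two, so their sum is at most their product. Adding exponents is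
therefore enough for every operation, not only for multiplication. -/
theorem Op.eval_le_pow {B x y i j : ℕ} (hB : 2 ≤ B) (o : Op) (hx : x ≤ B ^ i) (hy : y ≤ B ^ j)
    (hi : 1 ≤ i) (hj : 1 ≤ j) : o.eval x y ≤ B ^ (i + j) := by
  have h1 : 2 ≤ B ^ i := hB.trans (Nat.le_self_pow (by omega) B)
  have h2 : 2 ≤ B ^ j := hB.trans (Nat.le_self_pow (by omega) B)
  have hle : B ^ i + B ^ j ≤ B ^ (i + j) := by rw [pow_add]; nlinarith
  cases o with
  | add => exact (Nat.add_le_add hx hy).trans hle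
  | sub => exact ((Nat.sub_le x y).trans hx).trans (by omega)
  | mul => exact (Nat.mul_le_mul hx hy).trans (by rw [pow_add])
  | div => exact ((Nat.div_le_self x y).trans hx).trans (by omega)
  | mod => exact ((Nat.mod_le x y).trans hx).trans (by omega)

theorem Ex.eval_le {B : ℕ} (hB : 2 ≤ B) (K : ℕ) (e : Ex ν α) :
    ∀ {σ : St ν α}, σ.Bd B → e.eval σ ≤ B ^ e.deg K := by
  induction e with
  | var r => intro σ h; simpa [Ex.eval, Ex.deg] using h.1 r
  | lit k =>
    intro σ h
    calc k ≤ 2 ^ k := Nat.lt_two_pow_self.le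
      _ ≤ B ^ k := Nat.pow_le_pow_left hB k
      _ ≤ B ^ (k + 1) := Nat.pow_le_pow_right (by omega) (by omega)
  | op o a b iha ihb =>
    intro σ h
    exact o.eval_le_pow hB (iha h) (ihb h) (a.deg_pos K) (b.deg_pos K)
  | get a i ih =>
    intro σ h
    exact (h.2.1 a _).trans (Nat.le_self_pow (by simp [Ex.deg]) B)
  | sum r x e ih =>
    intro σ h
    simp only [Ex.eval, Ex.deg]
    calc ∑ i ∈ Finset.range (σ.v x), e.eval (σ.setv r i)
        ≤ ∑ i ∈ Finset.range (σ.v x), B ^ e.deg K := Finset.sum_le_sum fun i hi =>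
          ih (h.setv r ((Finset.mem_range.1 hi).le.trans (h.1 x)))
      _ = σ.v x * B ^ e.deg K := by simp
      _ ≤ B * B ^ e.deg K := Nat.mul_le_mul_right _ (h.1 x)
      _ = B ^ (e.deg K + 1) := by ring
      _ ≤ B ^ (e.deg K + 2) := Nat.pow_le_pow_right (by omega) (by omega)

/-! ### Compilation -/

/-- Run `P` from `s`; the step count and the final state satisfy `Q`. -/
def W (w : ℕ) (P : Cmd) (s : State) (Q : ℕ → State → Prop) : Prop :=
  ∃ t s', Exec w P s t s' ∧ Q t s'

theorem W.mono {w : ℕ} {P : Cmd} {s : State} {Q R : ℕ → State → Prop} (h : W w P s Q)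
    (hQ : ∀ t s', Q t s' → R t s') : W w P s R := by
  obtain ⟨t, s', h1, h2⟩ := h
  exact ⟨t, s', h1, hQ _ _ h2⟩

theorem W.seq {w : ℕ} {P P' : Cmd} {s : State} {R : ℕ → State → Prop}
    (h : W w P s fun t s' => W w P' s' fun t' s'' => R (t + t') s'') : W w (.seq P P') s R := by
  obtain ⟨t, s', h1, t', s'', h2, h3⟩ := h
  exact ⟨_, _, .seq h1 h2, h3⟩

theorem W.const {w : ℕ} {s : State} {r k : ℕ} {R : ℕ → State → Prop} (hk : k < 2 ^ w)
    (h : R 1 { s with reg := Function.update s.reg r k }) : W w (.const r k) s R :=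
  ⟨_, _, .const s r k hk, h⟩

theorem W.op {w : ℕ} {s : State} {o : Op} {r a b : ℕ} {R : ℕ → State → Prop}
    (hk : o.eval (s.reg a) (s.reg b) < 2 ^ w)
    (h : R 1 { s with reg := Function.update s.reg r (o.eval (s.reg a) (s.reg b)) }) :
    W w (.op o r a b) s R :=
  ⟨_, _, .op s o r a b hk, h⟩

theorem W.load {w : ℕ} {s : State} {r a : ℕ} {R : ℕ → State → Prop}
    (hk : s.mem (s.reg a) < 2 ^ w)
    (h : R 1 { s with reg := Function.update s.reg r (s.mem (s.reg a)) }) :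
    W w (.load r a) s R :=
  ⟨_, _, .load s r a hk, h⟩

theorem W.store {w : ℕ} {s : State} {a r : ℕ} {R : ℕ → State → Prop}
    (h : R 1 { s with mem := Function.update s.mem (s.reg a) (s.reg r) }) :
    W w (.store a r) s R :=
  ⟨_, _, .store s a r, h⟩

/-- A loop that makes `N - i` more rounds, with a bound on the time of each round. -/
theorem W.loop {w : ℕ} {P : Cmd} {r N : ℕ} (Inv : ℕ → State → Prop) (T : ℕ → ℕ)
    (hreg : ∀ i ≤ N, ∀ s, Inv i s → s.reg r = N - i)
    (hstep : ∀ i < N, ∀ s, Inv i s → W w P s fun t s' => t ≤ T i ∧ Inv (i + 1) s')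
    {s : State} (h0 : Inv 0 s) :
    W w (.loop r P) s fun t s' => t ≤ 1 + ∑ i ∈ Finset.range N, (1 + T i) ∧ Inv N s' := by
  -- Induction on the number j of remaining rounds, with the time bounds shifted to the current
  -- round.
  have key : ∀ j i, i + j = N → ∀ s, Inv i s →
      W w (.loop r P) s fun t s' => t ≤ 1 + ∑ l ∈ Finset.range j, (1 + T (i + l)) ∧ Inv N s' := by
    intro j
    induction j with
    | zero =>
      intro i hi s hs
      obtain rfl : i = N := by omega
      exact ⟨_, _, .loop_done (by simpa using hreg i le_rfl s hs), by simp, hs⟩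
    | succ j ih =>
      intro i hi s hs
      obtain ⟨t, s', h1, h2, h3⟩ := hstep i (by omega) s hs
      obtain ⟨t', s'', h4, h5, h6⟩ := ih (i + 1) (by omega) s' h3
      refine ⟨_, _, .loop_step (by rw [hreg i (by omega) s hs]; omega) h1 h4, ?_, h6⟩
      rw [Finset.sum_range_succ']
      have : ∀ l, i + 1 + l = i + (l + 1) := by intro l; omega
      simp only [this] at h5
      simp only [add_zero]
      omega
  simpa using key N 0 (by omega) s h0

/-- The register of a temporary value. Register `0` holds the start of the array area. -/
def tmp (k : ℕ) : ℕ := 2 * k + 2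

/-- The register of a variable. -/
noncomputable def rg [Fintype ν] (r : ν) : ℕ := 2 * (Fintype.equivFin ν r : ℕ) + 1

noncomputable def ix [Fintype α] (a : α) : ℕ := Fintype.equivFin α a

theorem ix_lt [Fintype α] (a : α) : ix a < Fintype.card α := (Fintype.equivFin α a).2

theorem ix_inj [Fintype α] {a b : α} : ix a = ix b ↔ a = b := by
  simp [ix, Fin.val_inj]

@[simp] theorem rg_inj [Fintype ν] {a b : ν} : rg a = rg b ↔ a = b := by
  simp [rg, Fin.val_inj]

@[simp] theorem tmp_inj {j k : ℕ} : tmp j = tmp k ↔ j = k := by simp [tmp]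

@[simp] theorem tmp_ne_rg [Fintype ν] (k : ℕ) (r : ν) : tmp k ≠ rg r := by
  unfold tmp rg; omega

@[simp] theorem rg_ne_tmp [Fintype ν] (k : ℕ) (r : ν) : rg r ≠ tmp k := (tmp_ne_rg k r).symm

@[simp] theorem zero_ne_rg [Fintype ν] (r : ν) : 0 ≠ rg r := by unfold rg; omega

@[simp] theorem zero_ne_tmp (k : ℕ) : 0 ≠ tmp k := by unfold tmp; omega

variable [Fintype ν] [Fintype α]

/-- `d := s` for different registers. -/
def mov (d s : ℕ) : Cmd := .seq (.const d 0) (.op .add d s d)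

/-- Turn the index in `tmp k` into the address of the cell of the array `a`. -/
noncomputable def addr (k k' : ℕ) (a : α) : Cmd :=
  .seq (.const (tmp k') (Fintype.card α)) <| .seq (.op .mul (tmp k) (tmp k) (tmp k')) <|
  .seq (.op .add (tmp k) (tmp k) 0) <| .seq (.const (tmp k') (ix a)) <|
  .op .add (tmp k) (tmp k) (tmp k')

/-- The argument is the first free temporary: the value is left there, and smaller temporaries
survive. In a sum the range is copied before the bound variable is reset, so the two may coincide;
the tested register holds the number of remaining rounds. -/
noncomputable def Ex.compile : ℕ → Ex ν α → Cmd
  | k, var r => mov (tmp k) (rg r)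
  | k, lit c => .const (tmp k) c
  | k, op o a b => .seq (a.compile k) <| .seq (b.compile (k + 1)) <|
      .op o (tmp k) (tmp k) (tmp (k + 1))
  | k, get a i => .seq (i.compile k) <| .seq (addr k (k + 1) a) <| .load (tmp k) (tmp k)
  | k, sum r x e => .seq (mov (tmp (k + 1)) (rg r)) <| .seq (mov (tmp (k + 2)) (rg x)) <|
      .seq (.const (tmp k) 0) <| .seq (.const (rg r) 0) <|
      .seq (.op .sub (tmp (k + 3)) (tmp (k + 2)) (rg r)) <|
      .seq (.loop (tmp (k + 3)) <|
        .seq (e.compile (k + 4)) <| .seq (.op .add (tmp k) (tmp k) (tmp (k + 4))) <|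
        .seq (.const (tmp (k + 3)) 1) <| .seq (.op .add (rg r) (rg r) (tmp (k + 3))) <|
        .op .sub (tmp (k + 3)) (tmp (k + 2)) (rg r)) <|
      mov (rg r) (tmp (k + 1))

/-- The time of the compiled expression is at most this constant times one plus its cost. -/
def Ex.factor : Ex ν α → ℕ
  | var _ => 2
  | lit _ => 1
  | op _ a b => a.factor + b.factor + 1
  | get _ i => i.factor + 6
  | sum _ _ e => e.factor + 10

/-- The machine state represents `σ`, with the arrays interleaved from address `N` on. -/
structure Sim (N : ℕ) (s : State) (σ : St ν α) : Prop where
  base : s.reg 0 = N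
  v : ∀ r, s.reg (rg r) = σ.v r
  io : ∀ i < N, s.mem i = σ.io i
  a : ∀ a i, s.mem (i * Fintype.card α + N + ix a) = σ.a a i

theorem Sim.update_tmp {N : ℕ} {s : State} {σ : St ν α} (h : Sim N s σ) (k x : ℕ) :
    Sim N { s with reg := Function.update s.reg (tmp k) x } σ :=
  ⟨by simpa using h.base, fun r => by simpa using h.v r, h.io, h.a⟩

theorem Sim.update_rg {N : ℕ} {s : State} {σ : St ν α} (h : Sim N s σ) (r : ν) (x : ℕ) :
    Sim N { s with reg := Function.update s.reg (rg r) x } (σ.setv r x) := by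
  refine ⟨by simpa using h.base, fun q => ?_, h.io, h.a⟩
  by_cases hq : q = r
  · subst hq; simp
  · simpa [hq] using h.v q

theorem W.mov {w : ℕ} {s : State} {d r : ℕ} {R : ℕ → State → Prop} (hd : r ≠ d)
    (hr : s.reg r < 2 ^ w) (h : R 2 { s with reg := Function.update s.reg d (s.reg r) }) :
    W w (mov d r) s R := by
  refine W.seq (W.const (by positivity) (W.op ?_ ?_))
  · simpa [Op.eval, hd] using hr
  · simpa [Op.eval, hd] using h

theorem W.addr {w k k' : ℕ} {s : State} {a : α} {R : ℕ → State → Prop} (hk : k ≠ k')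
    (hw : s.reg (tmp k) * Fintype.card α + s.reg 0 + Fintype.card α < 2 ^ w)
    (h : R 5 ⟨Function.update (Function.update s.reg (tmp k') (ix a)) (tmp k)
      (s.reg (tmp k) * Fintype.card α + s.reg 0 + ix a), s.mem⟩) :
    W w (addr k k' a) s R := by
  have ha := ix_lt a
  refine W.seq (W.const (by omega) (W.seq (W.op ?_ (W.seq (W.op ?_ (W.seq
    (W.const (by omega) (W.op ?_ ?_))))))))
  · simp [Op.eval, hk]; omega
  · simp [Op.eval, hk]; omega
  · simp [Op.eval, hk]; omega
  · convert h using 2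
    funext r
    by_cases h1 : r = tmp k
    · subst h1; simp [Op.eval, hk]
    · by_cases h2 : r = tmp k'
      · subst h2; simp [h1]
      · simp [h1, h2]

/-- Each of the three terms is at most `B ^ (d + K)`, and `B ^ 3 ≥ 8` absorbs their number. This is
the origin of the summand `K + 3` in `Ex.deg` and `Hl.deg`. -/
theorem addr_lt {B N x d K w : ℕ} (hB : 2 ≤ B) (hN : N ≤ B) (hx : x ≤ B ^ d) (hd : 1 ≤ d)
    (hw : B ^ (d + K + 3) < 2 ^ w) : x * K + N + K < 2 ^ w := by
  refine lt_of_le_of_lt ?_ hw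
  have hK : K ≤ B ^ K := (Nat.lt_two_pow_self.le).trans (Nat.pow_le_pow_left hB K)
  have h1 : x * K ≤ B ^ (d + K) := by rw [pow_add]; exact Nat.mul_le_mul hx hK
  have h2 : N ≤ B ^ (d + K) := hN.trans (Nat.le_self_pow (by omega) B)
  have h3 : K ≤ B ^ (d + K) := hK.trans (Nat.pow_le_pow_right (by omega) (by omega))
  have h4 : 8 ≤ B ^ 3 := by
    calc 8 = 2 ^ 3 := by norm_num
      _ ≤ B ^ 3 := Nat.pow_le_pow_left hB 3
  rw [pow_add]
  nlinarith [Nat.zero_le (B ^ (d + K))]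

/-- The clause on temporaries below `k` is what lets the first operand, or the accumulator of a sum,
survive the evaluation of the next subexpression. -/
theorem Ex.compile_spec {B N w : ℕ} (hB : 2 ≤ B) (hN : N ≤ B) (e : Ex ν α) :
    B ^ e.deg (Fintype.card α) < 2 ^ w → ∀ (k : ℕ) (s : State) (σ : St ν α), Sim N s σ →
    σ.Bd B → W w (e.compile k) s fun t s' => t ≤ e.factor * (1 + e.cost σ) ∧
      s'.reg (tmp k) = e.eval σ ∧ Sim N s' σ ∧ s'.mem = s.mem ∧
      ∀ j < k, s'.reg (tmp j) = s.reg (tmp j) := by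
  have lt_w : ∀ {d d' x : ℕ}, x ≤ B ^ d → d ≤ d' → B ^ d' < 2 ^ w → x < 2 ^ w :=
    fun h1 h2 h3 => (h1.trans (Nat.pow_le_pow_right (by omega) h2)).trans_lt h3
  induction e with
  | var r =>
    intro hw k s σ hs hbd
    have := hbd.1 r
    simp only [Ex.deg, pow_one] at hw
    refine W.mov (by simp) (by rw [hs.v]; omega) ⟨by simp [Ex.factor, Ex.cost], ?_,
      hs.update_tmp k _, rfl, fun j hj => ?_⟩
    · simpa [Ex.eval] using hs.v r
    · simp [show j ≠ k by omega]
  | lit c =>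
    intro hw k s σ hs hbd
    refine W.const (lt_w (Ex.eval_le hB (Fintype.card α) (Ex.lit c) hbd) le_rfl hw)
      ⟨by simp [Ex.factor, Ex.cost], ?_, hs.update_tmp k _, rfl, fun j hj => ?_⟩
    · simp [Ex.eval]
    · simp [show j ≠ k by omega]
  | op o a b iha ihb =>
    intro hw k s σ hs hbd
    have hv := Ex.eval_le hB (Fintype.card α) (Ex.op o a b) hbd
    have hwa : B ^ a.deg (Fintype.card α) < 2 ^ w := lt_w le_rfl (by simp [Ex.deg]) hw
    have hwb : B ^ b.deg (Fintype.card α) < 2 ^ w := lt_w le_rfl (by simp [Ex.deg]) hw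
    refine W.seq ((iha hwa k s σ hs hbd).mono ?_)
    rintro t1 s1 ⟨ht1, hr1, hs1, hm1, hj1⟩
    refine W.seq ((ihb hwb (k + 1) s1 σ hs1 hbd).mono ?_)
    rintro t2 s2 ⟨ht2, hr2, hs2, hm2, hj2⟩
    have hrk : s2.reg (tmp k) = a.eval σ := by rw [hj2 k (by omega), hr1]
    refine W.op (by rw [hrk, hr2]; exact lt_w hv le_rfl hw)
      ⟨?_, ?_, hs2.update_tmp k _, hm2.trans hm1, fun j hj => ?_⟩
    · simp only [Ex.factor, Ex.cost]
      nlinarith [Nat.zero_le (a.factor * b.cost σ), Nat.zero_le (b.factor * a.cost σ)]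
    · simp [Ex.eval, hrk, hr2]
    · simp [show j ≠ k by omega, hj2 j (by omega), hj1 j hj]
  | get a i ih =>
    intro hw k s σ hs hbd
    have hv := Ex.eval_le hB (Fintype.card α) i hbd
    have hv' := Ex.eval_le hB (Fintype.card α) (Ex.get a i) hbd
    refine W.seq ((ih (lt_w le_rfl (by simp [Ex.deg]; omega) hw) k s σ hs hbd).mono ?_)
    rintro t1 s1 ⟨ht1, hr1, hs1, hm1, hj1⟩
    have ha := hs1.a a (i.eval σ)
    refine W.seq (W.addr (by omega) ?_ (W.load ?_ ⟨?_, ?_, ?_, hm1, fun j hj => ?_⟩))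
    · rw [hr1, hs1.base]
      exact addr_lt hB hN hv (i.deg_pos _) hw
    · simp only [Function.update_self, hr1, hs1.base, ha]
      exact lt_w hv' le_rfl hw
    · simp only [Ex.factor, Ex.cost]
      nlinarith
    · simp [hr1, hs1.base, ha, Ex.eval]
    · exact ((hs1.update_tmp _ _).update_tmp k _).update_tmp k _
    · simp [show j ≠ k by omega, show j ≠ k + 1 by omega, hj1 j hj]
  | sum r x e ih =>
    intro hw k s σ hs hbd
    have hBw : B < 2 ^ w := lt_w (d := 1) (by simp) (by simp [Ex.deg]) hw
    have hwe : B ^ e.deg (Fintype.card α) < 2 ^ w := lt_w le_rfl (by simp [Ex.deg]) hw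
    -- Partial sums are bounded by the complete sum, so the accumulator never exceeds the word
    -- length.
    have hacc : ∀ i ≤ σ.v x, ∑ l ∈ Finset.range i, e.eval (σ.setv r l) < 2 ^ w := by
      intro i hi
      refine lt_w (le_trans ?_ (Ex.eval_le hB (Fintype.card α) (Ex.sum r x e) hbd)) le_rfl hw
      exact Finset.sum_le_sum_of_subset (Finset.range_mono hi)
    have hrB := hbd.1 r
    have hxB := hbd.1 x
    refine W.seq (W.mov (by simp) (by rw [hs.v]; omega) ?_)
    refine W.seq (W.mov (by simp) (by simp [hs.v]; omega) ?_)
    refine W.seq (W.const (by positivity) (W.seq (W.const (by positivity)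
      (W.seq (W.op ?_ (W.seq ?_))))))
    · simp [Op.eval, hs.v]; omega
    set s0 : State := _ 
    refine (W.loop (N := σ.v x) (fun i s' => Sim N s' (σ.setv r i) ∧ s'.mem = s.mem ∧
        (∀ j < k, s'.reg (tmp j) = s.reg (tmp j)) ∧ s'.reg (tmp (k + 1)) = σ.v r ∧
        s'.reg (tmp (k + 2)) = σ.v x ∧ s'.reg (tmp (k + 3)) = σ.v x - i ∧
        s'.reg (tmp k) = ∑ l ∈ Finset.range i, e.eval (σ.setv r l))
      (fun i => e.factor * (1 + e.cost (σ.setv r i)) + 4) ?_ ?_ (s := s0) ?_).mono ?_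
    · rintro i hi s' ⟨-, -, -, -, -, h, -⟩; exact h
    · rintro i hi s1 ⟨hs1, hm1, hj1, hk1, hk2, hk3, hk0⟩
      have hbi : (σ.setv r i).Bd B := hbd.setv r (by omega)
      refine W.seq ((ih hwe (k + 4) s1 _ hs1 hbi).mono ?_)
      rintro t2 s2 ⟨ht2, hr2, hs2, hm2, hj2⟩
      have hk0' : s2.reg (tmp k) = ∑ l ∈ Finset.range i, e.eval (σ.setv r l) := by
        rw [hj2 k (by omega), hk0]
      have hv := hs2.v r
      simp only [St.setv_v, Function.update_self] at hv
      have h5 := hacc (i + 1) hi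
      rw [Finset.sum_range_succ] at h5
      refine W.seq (W.op ?_ (W.seq (W.const ?_ (W.seq (W.op ?_ (W.op ?_
        ⟨?_, ?_, hm2.trans hm1, fun j hj => ?_, ?_, ?_, ?_, ?_⟩))))))
      · simpa [Op.eval, hk0', hr2] using h5
      · omega
      · simp [Op.eval, hv]; omega
      · simp [Op.eval, hj2 (k + 2) (by omega), hk2, hv]; omega
      · omega
      · have h6 := (((hs2.update_tmp k (s2.reg (tmp k) + s2.reg (tmp (k + 4)))).update_tmp
          (k + 3) 1).update_rg r (i + 1)).update_tmp (k + 3) (σ.v x - (i + 1))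
        have h7 : (σ.setv r i).setv r (i + 1) = σ.setv r (i + 1) := by simp [St.setv]
        rw [h7] at h6
        convert h6 using 4 <;> simp [Op.eval, hv, hj2 (k + 2) (by omega), hk2]
      · simp [show j ≠ k by omega, show j ≠ k + 3 by omega, hj2 j (by omega), hj1 j hj]
      · simp [hj2 (k + 1) (by omega), hk1]
      · simp [hj2 (k + 2) (by omega), hk2]
      · simp [Op.eval, hj2 (k + 2) (by omega), hk2, hv]
      · simp [Op.eval, hk0', hr2, Finset.sum_range_succ]
    · refine ⟨?_, rfl, fun j hj => ?_, ?_, ?_, ?_, ?_⟩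
      · exact ((((hs.update_tmp _ _).update_tmp _ _).update_tmp _ _).update_rg r 0).update_tmp _ _
      · simp [s0, show j ≠ k by omega, show j ≠ k + 1 by omega, show j ≠ k + 2 by omega,
          show j ≠ k + 3 by omega]
      · simp [s0, hs.v]
      · simp [s0, hs.v]
      · simp [s0, hs.v, Op.eval]
      · simp [s0]
    · rintro t1 s1 ⟨ht1, hs1, hm1, hj1, hk1, hk2, hk3, hk0⟩
      refine W.mov (by simp) (by rw [hk1]; omega) ⟨?_, ?_, ?_, hm1, fun j hj => ?_⟩
      · simp only [Ex.factor, Ex.cost]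
        have h8 : ∑ i ∈ Finset.range (σ.v x), (1 + (e.factor * (1 + e.cost (σ.setv r i)) + 4)) ≤
            (e.factor + 5) * ∑ i ∈ Finset.range (σ.v x), (1 + e.cost (σ.setv r i)) := by
          rw [Finset.mul_sum]
          refine Finset.sum_le_sum fun i _ => ?_
          nlinarith [Nat.zero_le (e.cost (σ.setv r i))]
        nlinarith [Nat.zero_le (∑ i ∈ Finset.range (σ.v x), (1 + e.cost (σ.setv r i)))]
      · simpa [Ex.eval] using hk0
      · have h6 := hs1.update_rg r (σ.v r)
        have h7 : (σ.setv r (σ.v x)).setv r (σ.v r) = σ := by simp [St.setv]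
        rw [h7] at h6
        rw [hk1]
        exact h6
      · simp [hj1 j hj]

/-- Unlike in a sum, the counter of a loop lives in a temporary and is copied to the variable in
every round, because the body may assign to that variable. The body may also overwrite the tested
register, which is recomputed afterwards. -/
noncomputable def Hl.compile : ℕ → Hl ν α → Cmd
  | k, set r e => .seq (e.compile k) (mov (rg r) (tmp k))
  | k, put a i e => .seq (i.compile k) <| .seq (e.compile (k + 1)) <|
      .seq (addr k (k + 2) a) <| .store (tmp k) (tmp (k + 1))
  | k, inp r i => .seq (i.compile k) (.load (rg r) (tmp k))
  | k, out i e => .seq (i.compile k) <| .seq (e.compile (k + 1)) <| .store (tmp k) (tmp (k + 1))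
  | k, seq P Q => .seq (P.compile k) (Q.compile k)
  | k, rep r x P => .seq (mov (tmp k) (rg r)) <| .seq (mov (tmp (k + 1)) (rg x)) <|
      .seq (.const (tmp (k + 2)) 0) <|
      .seq (.op .sub (tmp (k + 3)) (tmp (k + 1)) (tmp (k + 2))) <|
      .seq (.loop (tmp (k + 3)) <|
        .seq (mov (rg r) (tmp (k + 2))) <| .seq (P.compile (k + 3)) <|
        .seq (.const (tmp (k + 3)) 1) <| .seq (.op .add (tmp (k + 2)) (tmp (k + 2)) (tmp (k + 3))) <|
        .op .sub (tmp (k + 3)) (tmp (k + 1)) (tmp (k + 2))) <|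
      mov (rg r) (tmp k)

/-- The time of the compiled program is at most this constant times its cost. -/
def Hl.factor : Hl ν α → ℕ
  | set _ e => e.factor + 2
  | put _ i e => i.factor + e.factor + 6
  | inp _ i => i.factor + 1
  | out i e => i.factor + e.factor + 1
  | seq P Q => P.factor + Q.factor
  | rep _ _ P => P.factor + 10

theorem Hl.compile_spec {B N w : ℕ} (hB : 2 ≤ B) (hN : N ≤ B) (P : Hl ν α) :
    B ^ P.deg (Fintype.card α) < 2 ^ w → ∀ (k : ℕ) (s : State) (σ : St ν α), Sim N s σ →
    σ.Bd B → P.Safe B N σ → W w (P.compile k) s fun t s' => t ≤ P.factor * P.cost σ ∧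
      Sim N s' (P.run σ) ∧ ∀ j < k, s'.reg (tmp j) = s.reg (tmp j) := by
  have lt_w : ∀ {d d' x : ℕ}, x ≤ B ^ d → d ≤ d' → B ^ d' < 2 ^ w → x < 2 ^ w :=
    fun h1 h2 h3 => (h1.trans (Nat.pow_le_pow_right (by omega) h2)).trans_lt h3
  induction P with
  | set r e =>
    intro hw k s σ hs hbd hsafe
    refine W.seq ((e.compile_spec hB hN hw k s σ hs hbd).mono ?_)
    rintro t1 s1 ⟨ht1, hr1, hs1, hm1, hj1⟩
    refine W.mov (by simp) ?_ ⟨?_, ?_, fun j hj => ?_⟩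
    · rw [hr1]; exact lt_w (e.eval_le hB _ hbd) le_rfl hw
    · simp only [Hl.factor, Hl.cost]; nlinarith
    · rw [hr1]; exact hs1.update_rg r _
    · simp [hj1 j hj]
  | put a i e =>
    intro hw k s σ hs hbd hsafe
    have hvi := i.eval_le hB (Fintype.card α) hbd
    simp only [Hl.deg] at hw
    refine W.seq ((i.compile_spec hB hN (lt_w le_rfl (by omega) hw) k s σ hs hbd).mono ?_)
    rintro t1 s1 ⟨ht1, hr1, hs1, hm1, hj1⟩
    refine W.seq ((e.compile_spec hB hN (lt_w le_rfl (by omega) hw) (k + 1) s1 σ hs1 hbd).mono ?_)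
    rintro t2 s2 ⟨ht2, hr2, hs2, hm2, hj2⟩
    have hrk : s2.reg (tmp k) = i.eval σ := by rw [hj2 k (by omega), hr1]
    refine W.seq (W.addr (by omega) ?_ (W.store ⟨?_, ?_, fun j hj => ?_⟩))
    · rw [hrk, hs2.base]
      exact addr_lt hB hN hvi (i.deg_pos _) (lt_w le_rfl (by omega) hw)
    · simp only [Hl.factor, Hl.cost]
      nlinarith [Nat.zero_le (i.factor * e.cost σ), Nat.zero_le (e.factor * i.cost σ)]
    · have hs3 := (hs2.update_tmp (k + 2) (ix a)).update_tmp k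
        (s2.reg (tmp k) * Fintype.card α + s2.reg 0 + ix a)
      refine ⟨hs3.base, hs3.v, fun j hj => ?_, fun b j => ?_⟩
      · have : j ≠ i.eval σ * Fintype.card α + N + ix a := by omega
        simp [hrk, hs2.base, this, Hl.run, hs2.io j hj]
      · have hb := ix_lt b
        have ha := ix_lt a
        by_cases hab : b = a
        · subst hab
          by_cases hji : j = i.eval σ
          · subst hji
            simp [hrk, hs2.base, Hl.run, hr2]
          · have : ¬ (j * Fintype.card α + N + ix b = i.eval σ * Fintype.card α + N + ix b) := by
              intro h
              exact hji (Nat.eq_of_mul_eq_mul_right (by omega : 0 < Fintype.card α) (by omega))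
            simp [hrk, hs2.base, Hl.run, hji, Function.update_of_ne this, hs2.a]
        · have : ¬ (j * Fintype.card α + N + ix b = i.eval σ * Fintype.card α + N + ix a) := by
            intro h
            -- Relative to the base address, different arrays occupy different residue classes
            -- modulo the number of arrays.
            have h1 : (j * Fintype.card α + ix b) % Fintype.card α =
              (i.eval σ * Fintype.card α + ix a) % Fintype.card α := by congr 1; omega
            rw [Nat.mul_add_mod', Nat.mul_add_mod', Nat.mod_eq_of_lt hb, Nat.mod_eq_of_lt ha,
              ix_inj] at h1
            exact hab h1
          simp [hrk, hs2.base, Hl.run, this, hab, hs2.a]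
    · simp [show j ≠ k by omega, show j ≠ k + 2 by omega, hj2 j (by omega), hj1 j hj]
  | inp r i =>
    intro hw k s σ hs hbd hsafe
    refine W.seq ((i.compile_spec hB hN hw k s σ hs hbd).mono ?_)
    rintro t1 s1 ⟨ht1, hr1, hs1, hm1, hj1⟩
    have hio := hs1.io _ hsafe
    refine W.load ?_ ⟨?_, ?_, fun j hj => ?_⟩
    · rw [hr1, hio]
      exact lt_w (d := 1) (by simpa using hbd.2.2 _) (i.deg_pos _) hw
    · simp only [Hl.factor, Hl.cost]; nlinarith
    · rw [hr1, hio]; exact hs1.update_rg r _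
    · simp [hj1 j hj]
  | out i e =>
    intro hw k s σ hs hbd hsafe
    simp only [Hl.deg] at hw
    refine W.seq ((i.compile_spec hB hN (lt_w le_rfl (by omega) hw) k s σ hs hbd).mono ?_)
    rintro t1 s1 ⟨ht1, hr1, hs1, hm1, hj1⟩
    refine W.seq ((e.compile_spec hB hN (lt_w le_rfl (by omega) hw) (k + 1) s1 σ hs1 hbd).mono ?_)
    rintro t2 s2 ⟨ht2, hr2, hs2, hm2, hj2⟩
    have hrk : s2.reg (tmp k) = i.eval σ := by rw [hj2 k (by omega), hr1]
    refine W.store ⟨?_, ⟨hs2.base, hs2.v, fun j hj => ?_, fun b j => ?_⟩, fun j hj => ?_⟩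
    · simp only [Hl.factor, Hl.cost]
      nlinarith [Nat.zero_le (i.factor * e.cost σ), Nat.zero_le (e.factor * i.cost σ)]
    · by_cases hji : j = i.eval σ
      · subst hji; simp [hrk, hr2, Hl.run]
      · simp [hrk, hr2, Hl.run, hji, hs2.io j hj]
    · have : j * Fintype.card α + N + ix b ≠ i.eval σ := by have := hsafe.1; omega
      simp [hrk, this, Hl.run, hs2.a]
    · simp [hj2 j (by omega), hj1 j hj]
  | seq P Q ihP ihQ =>
    intro hw k s σ hs hbd hsafe
    refine W.seq ((ihP (lt_w le_rfl (by simp [Hl.deg]) hw) k s σ hs hbd hsafe.1).mono ?_)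
    rintro t1 s1 ⟨ht1, hs1, hj1⟩
    refine (ihQ (lt_w le_rfl (by simp [Hl.deg]) hw) k s1 _ hs1 (P.bd_run hbd hsafe.1)
      hsafe.2).mono ?_
    rintro t2 s2 ⟨ht2, hs2, hj2⟩
    refine ⟨?_, hs2, fun j hj => by rw [hj2 j hj, hj1 j hj]⟩
    simp only [Hl.factor, Hl.cost]
    nlinarith [Nat.zero_le (P.factor * Q.cost (P.run σ)), Nat.zero_le (Q.factor * P.cost σ)]
  | rep r x P ih =>
    intro hw k s σ hs hbd hsafe
    have hBw : B < 2 ^ w := lt_w (d := 1) (by simp) (by simp [Hl.deg]) hw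
    have hwP : B ^ P.deg (Fintype.card α) < 2 ^ w := lt_w le_rfl (by simp [Hl.deg]) hw
    have hrB := hbd.1 r
    have hxB := hbd.1 x
    have hbi := Hl.bd_iter hbd (fun τ h1 h2 => P.bd_run h1 h2) hsafe
    refine W.seq (W.mov (by simp) (by rw [hs.v]; omega) ?_)
    refine W.seq (W.mov (by simp) (by simp [hs.v]; omega) ?_)
    refine W.seq (W.const (by positivity) (W.seq (W.op ?_ (W.seq ?_))))
    · simp [Op.eval, hs.v]; omega
    set s0 : State := _
    refine (W.loop (N := σ.v x) (fun i s' => Sim N s' (P.iter r σ i) ∧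
        (∀ j < k, s'.reg (tmp j) = s.reg (tmp j)) ∧ s'.reg (tmp k) = σ.v r ∧
        s'.reg (tmp (k + 1)) = σ.v x ∧ s'.reg (tmp (k + 2)) = i ∧
        s'.reg (tmp (k + 3)) = σ.v x - i)
      (fun i => P.factor * P.cost ((P.iter r σ i).setv r i) + 5) ?_ ?_ (s := s0) ?_).mono ?_
    · rintro i hi s' ⟨-, -, -, -, -, h⟩; exact h
    · rintro i hi s1 ⟨hs1, hj1, hk0, hk1, hk2, hk3⟩
      refine W.seq (W.mov (by simp) (by omega) ?_)
      rw [hk2]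
      refine W.seq ((ih hwP (k + 3) _ _ (hs1.update_rg r i) ((hbi i hi.le).setv r (by omega))
        (hsafe i hi)).mono ?_)
      rintro t2 s2 ⟨ht2, hs2, hj2⟩
      have h0 := hj2 k (by omega)
      have h1 := hj2 (k + 1) (by omega)
      have h2 := hj2 (k + 2) (by omega)
      simp [hk0, hk1, hk2] at h0 h1 h2
      refine W.seq (W.const (by omega) (W.seq (W.op ?_ (W.op ?_
        ⟨?_, ?_, fun j hj => ?_, ?_, ?_, ?_, ?_⟩))))
      · simp [Op.eval, h2]; omega
      · simp [Op.eval, h2, h1]; omega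
      · omega
      · exact ((hs2.update_tmp _ _).update_tmp _ _).update_tmp _ _
      · have := hj2 j (by omega)
        simp [hj1 j hj] at this
        simp [show j ≠ k + 3 by omega, show j ≠ k + 2 by omega, this]
      · simp [h0]
      · simp [h1]
      · simp [Op.eval, h2]
      · simp [Op.eval, h2, h1]
    · refine ⟨?_, fun j hj => ?_, ?_, ?_, ?_, ?_⟩
      · exact (((hs.update_tmp _ _).update_tmp _ _).update_tmp _ _).update_tmp _ _
      · simp [s0, show j ≠ k by omega, show j ≠ k + 1 by omega, show j ≠ k + 2 by omega,
          show j ≠ k + 3 by omega]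
      · simp [s0, hs.v]
      · simp [s0, hs.v]
      · simp [s0]
      · simp [s0, hs.v, Op.eval]
    · rintro t1 s1 ⟨ht1, hs1, hj1, hk0, hk1, hk2, hk3⟩
      refine W.mov (by simp) (by rw [hk0]; omega) ⟨?_, ?_, fun j hj => ?_⟩
      · simp only [Hl.factor, Hl.cost]
        have h8 : ∑ i ∈ Finset.range (σ.v x),
            (1 + (P.factor * P.cost ((P.iter r σ i).setv r i) + 5)) ≤
            (P.factor + 6) *
              ∑ i ∈ Finset.range (σ.v x), (1 + P.cost ((P.iter r σ i).setv r i)) := by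
          rw [Finset.mul_sum]
          refine Finset.sum_le_sum fun i _ => ?_
          nlinarith [Nat.zero_le (P.cost ((P.iter r σ i).setv r i))]
        nlinarith [Nat.zero_le
          (∑ i ∈ Finset.range (σ.v x), (1 + P.cost ((P.iter r σ i).setv r i)))]
      · rw [hk0]; exact hs1.update_rg r _
      · simp [hj1 j hj]

end RAM

/-! ### Reasoning about programs -/

/-- The least number below `N` with property `p`, and `N` if there is none. -/
noncomputable def least (p : ℕ → Prop) (N : ℕ) : ℕ := sInf {j | p j ∨ N ≤ j}

theorem least_le (p : ℕ → Prop) (N : ℕ) : least p N ≤ N := Nat.sInf_le (Or.inr le_rfl)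

theorem least_spec {p : ℕ → Prop} {N : ℕ} (h : least p N < N) : p (least p N) := by
  rcases Nat.sInf_mem (s := {j | p j ∨ N ≤ j}) ⟨N, Or.inr le_rfl⟩ with h1 | h1
  · exact h1
  · exact absurd h (not_lt.2 h1)

theorem not_of_lt_least {p : ℕ → Prop} {N j : ℕ} (h : j < least p N) : ¬ p j :=
  fun hp => Nat.notMem_of_lt_sInf h (Or.inl hp)

theorem least_le_of {p : ℕ → Prop} {N j : ℕ} (h : p j) : least p N ≤ j := Nat.sInf_le (Or.inl h)

theorem least_lt {p : ℕ → Prop} {N j : ℕ} (h : p j) (hj : j < N) : least p N < N :=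
  (least_le_of h).trans_lt hj

theorem least_congr {p q : ℕ → Prop} {N : ℕ} (h : ∀ j < N, p j ↔ q j) : least p N = least q N := by
  unfold least
  congr 1
  ext j
  by_cases hj : j < N
  · simp [h j hj]
  · simp [not_lt.1 hj]

namespace RAM

set_option linter.unusedSectionVars false

variable {ν α : Type} [DecidableEq ν] [DecidableEq α]

instance : Add (Ex ν α) := ⟨.op .add⟩
instance : Sub (Ex ν α) := ⟨.op .sub⟩
instance : Mul (Ex ν α) := ⟨.op .mul⟩
instance : Div (Ex ν α) := ⟨.op .div⟩
instance : Mod (Ex ν α) := ⟨.op .mod⟩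

namespace Ex

section
variable (e f : Ex ν α) (σ : St ν α)

@[simp] theorem eval_var (r : ν) : (var r : Ex ν α).eval σ = σ.v r := rfl
@[simp] theorem eval_lit (k : ℕ) : (lit k : Ex ν α).eval σ = k := rfl
@[simp] theorem eval_get (a : α) : (get a e).eval σ = σ.a a (e.eval σ) := rfl
@[simp] theorem eval_add : (e + f).eval σ = e.eval σ + f.eval σ := rfl
@[simp] theorem eval_sub : (e - f).eval σ = e.eval σ - f.eval σ := rfl
@[simp] theorem eval_mul : (e * f).eval σ = e.eval σ * f.eval σ := rfl
@[simp] theorem eval_div : (e / f).eval σ = e.eval σ / f.eval σ := rfl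
@[simp] theorem eval_mod : (e % f).eval σ = e.eval σ % f.eval σ := rfl
@[simp] theorem eval_sum (r x : ν) :
    (sum r x e).eval σ = ∑ i ∈ Finset.range (σ.v x), e.eval (σ.setv r i) := rfl
@[simp] theorem cost_var (r : ν) : (var r : Ex ν α).cost σ = 0 := rfl
@[simp] theorem cost_lit (k : ℕ) : (lit k : Ex ν α).cost σ = 0 := rfl
@[simp] theorem cost_get (a : α) : (get a e).cost σ = e.cost σ := rfl
@[simp] theorem cost_add : (e + f).cost σ = e.cost σ + f.cost σ := rfl
@[simp] theorem cost_sub : (e - f).cost σ = e.cost σ + f.cost σ := rfl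
@[simp] theorem cost_mul : (e * f).cost σ = e.cost σ + f.cost σ := rfl
@[simp] theorem cost_div : (e / f).cost σ = e.cost σ + f.cost σ := rfl
@[simp] theorem cost_mod : (e % f).cost σ = e.cost σ + f.cost σ := rfl
@[simp] theorem cost_sum (r x : ν) :
    (sum r x e).cost σ = 1 + ∑ i ∈ Finset.range (σ.v x), (1 + e.cost (σ.setv r i)) := rfl

end

/-- The truth value of `e = 0`. -/
def isz (e : Ex ν α) : Ex ν α := lit 1 - e

/-- The truth value of `e ≤ f`. -/
def leI (e f : Ex ν α) : Ex ν α := lit 1 - (e - f)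

/-- The truth value of `e < f`. -/
def ltI (e f : Ex ν α) : Ex ν α := lit 1 - (e + lit 1 - f)

/-- The truth value of `e = f`. -/
def eqI (e f : Ex ν α) : Ex ν α := lit 1 - ((e - f) + (f - e))

section
variable (e f : Ex ν α) (σ : St ν α)

@[simp] theorem eval_isz : (isz e).eval σ = if e.eval σ = 0 then 1 else 0 := by
  simp only [isz, eval_sub, eval_lit]; split_ifs <;> omega
@[simp] theorem eval_leI : (leI e f).eval σ = if e.eval σ ≤ f.eval σ then 1 else 0 := by
  simp only [leI, eval_sub, eval_lit]; split_ifs <;> omega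
@[simp] theorem eval_ltI : (ltI e f).eval σ = if e.eval σ < f.eval σ then 1 else 0 := by
  simp only [ltI, eval_sub, eval_add, eval_lit]; split_ifs <;> omega
@[simp] theorem eval_eqI : (eqI e f).eval σ = if e.eval σ = f.eval σ then 1 else 0 := by
  simp only [eqI, eval_sub, eval_add, eval_lit]; split_ifs <;> omega
@[simp] theorem cost_isz : (isz e).cost σ = e.cost σ := by simp [isz]
@[simp] theorem cost_leI : (leI e f).cost σ = e.cost σ + f.cost σ := by simp [leI]
@[simp] theorem cost_ltI : (ltI e f).cost σ = e.cost σ + f.cost σ := by simp [ltI]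
@[simp] theorem cost_eqI : (eqI e f).cost σ = 2 * (e.cost σ + f.cost σ) := by
  simp [eqI]; omega

end

/-- The least value of `r'` below `x` at which `c` is nonzero, and `x` if there is none. -/
def mu (r r' x : ν) (c : Ex ν α) : Ex ν α := sum r x (isz (sum r' x (leI (var r') (var r) * c)))

end Ex

/-- The inner sum vanishes at `i` exactly when no `j ≤ i` has the property, that is, when `i` lies
below the least such number; counting these `i` gives that number. This does the work of a search
with early exit at quadratic cost. -/
theorem Ex.eval_mu {r r' x : ν} {c : Ex ν α} {σ : St ν α} (hr : x ≠ r) (hr' : r ≠ r')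
    {p : ℕ → Prop} (hp : ∀ i < σ.v x, ∀ j < σ.v x,
      c.eval ((σ.setv r i).setv r' j) ≠ 0 ↔ p j) :
    (mu r r' x c).eval σ = least p (σ.v x) := by
  classical
  have h1 : (mu r r' x c).eval σ =
      ∑ i ∈ Finset.range (σ.v x), if i < least p (σ.v x) then 1 else 0 := by
    simp only [mu, eval_sum, eval_isz, eval_mul, eval_leI, eval_var, St.setv_v,
      Function.update_self, Function.update_of_ne hr, Function.update_of_ne hr']
    refine Finset.sum_congr rfl fun i hi => ?_
    rw [Finset.mem_range] at hi
    congr 1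
    simp only [Finset.sum_eq_zero_iff, Finset.mem_range, mul_eq_zero, ite_eq_right_iff,
      one_ne_zero, imp_false, not_le, eq_iff_iff]
    constructor
    · intro h
      by_contra! hle
      have hlt : least p (σ.v x) < σ.v x := hle.trans_lt hi
      rcases h _ hlt with h2 | h2
      · omega
      · exact (hp i hi _ hlt).2 (least_spec hlt) h2
    · intro h j hj
      by_cases hij : i < j
      · exact Or.inl hij
      · right
        by_contra h2
        exact not_of_lt_least (N := σ.v x) (by omega) ((hp i hi j hj).1 h2)
  rw [h1, Finset.sum_ite, Finset.sum_const_zero, add_zero, Finset.sum_const, smul_eq_mul, mul_one]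
  have : Finset.filter (fun i => i < least p (σ.v x)) (Finset.range (σ.v x)) =
      Finset.range (least p (σ.v x)) := by
    ext i
    have := least_le p (σ.v x)
    simp only [Finset.mem_filter, Finset.mem_range]; omega
  rw [this, Finset.card_range]

theorem Ex.cost_mu {r r' x : ν} {c : Ex ν α} {σ : St ν α} (hr : x ≠ r) {T : ℕ}
    (hc : ∀ i < σ.v x, ∀ j < σ.v x, c.cost ((σ.setv r i).setv r' j) ≤ T) :
    (mu r r' x c).cost σ ≤ 1 + σ.v x * (2 + σ.v x * (1 + T)) := by
  simp only [mu, cost_sum, cost_isz, cost_mul, cost_leI, cost_var, St.setv_v,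
    Function.update_of_ne hr, zero_add]
  refine Nat.add_le_add_left ?_ 1
  refine (Finset.sum_le_card_nsmul _ _ _ fun i hi => ?_).trans (by rw [Finset.card_range, smul_eq_mul])
  have h2 : ∑ j ∈ Finset.range (σ.v x), (1 + c.cost ((σ.setv r i).setv r' j)) ≤
      σ.v x * (1 + T) := by
    refine (Finset.sum_le_card_nsmul _ _ _ fun j hj => ?_).trans
      (by rw [Finset.card_range, smul_eq_mul])
    exact Nat.add_le_add_left (hc i (Finset.mem_range.1 hi) j (Finset.mem_range.1 hj)) 1
  omega

theorem Ex.cost_sum_le {r x : ν} {e : Ex ν α} {σ : St ν α} {T : ℕ}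
    (h : ∀ i < σ.v x, e.cost (σ.setv r i) ≤ T) : (sum r x e).cost σ ≤ 1 + σ.v x * (1 + T) := by
  rw [cost_sum]
  refine Nat.add_le_add_left ((Finset.sum_le_card_nsmul _ _ (1 + T) fun i hi => ?_).trans
    (by rw [Finset.card_range, smul_eq_mul])) 1
  exact Nat.add_le_add_left (h i (Finset.mem_range.1 hi)) 1

/-! #### Frames -/

/-- The variables that a program may change. -/
def Hl.vars : Hl ν α → List ν
  | set r _ => [r]
  | put _ _ _ => []
  | inp r _ => [r]
  | out _ _ => []
  | seq P Q => P.vars ++ Q.vars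
  | rep r _ P => r :: P.vars

/-- The arrays that a program may change. -/
def Hl.arrs : Hl ν α → List α
  | set _ _ => []
  | put a _ _ => [a]
  | inp _ _ => []
  | out _ _ => []
  | seq P Q => P.arrs ++ Q.arrs
  | rep _ _ P => P.arrs

/-- The program does not write to the input area. -/
def Hl.Pure : Hl ν α → Prop
  | out _ _ => False
  | seq P Q => P.Pure ∧ Q.Pure
  | rep _ _ P => P.Pure
  | _ => True

/-- `τ` and `σ` agree except for the variables `V` and the arrays `A`. -/
structure EqOff (V : List ν) (A : List α) (τ σ : St ν α) : Prop where
  v : ∀ r, r ∉ V → τ.v r = σ.v r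
  a : ∀ a, a ∉ A → τ.a a = σ.a a

theorem EqOff.refl (V : List ν) (A : List α) (σ : St ν α) : EqOff V A σ σ :=
  ⟨fun _ _ => rfl, fun _ _ => rfl⟩

theorem EqOff.trans {V : List ν} {A : List α} {τ σ ρ : St ν α} (h : EqOff V A τ σ)
    (h' : EqOff V A σ ρ) : EqOff V A τ ρ :=
  ⟨fun r hr => (h.v r hr).trans (h'.v r hr), fun a ha => (h.a a ha).trans (h'.a a ha)⟩

theorem EqOff.mono {V V' : List ν} {A A' : List α} {τ σ : St ν α} (h : EqOff V A τ σ)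
    (hV : V ⊆ V') (hA : A ⊆ A') : EqOff V' A' τ σ :=
  ⟨fun r hr => h.v r fun h => hr (hV h), fun a ha => h.a a fun h => ha (hA h)⟩

theorem EqOff.setv {V : List ν} (A : List α) (σ : St ν α) {r : ν} (hr : r ∈ V) (k : ℕ) :
    EqOff V A (σ.setv r k) σ :=
  ⟨fun q hq => by simp [show q ≠ r from fun h => hq (h ▸ hr)], fun _ _ => rfl⟩

theorem Hl.run_eqOff (P : Hl ν α) : ∀ σ : St ν α, EqOff P.vars P.arrs (P.run σ) σ := by
  induction P with
  | set r e => intro σ; exact EqOff.setv _ σ (by simp [Hl.vars]) _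
  | put a i e =>
    intro σ
    exact ⟨fun _ _ => rfl, fun b hb => by
      have : b ≠ a := by simpa [Hl.arrs] using hb
      simp [Hl.run, this]⟩
  | inp r i => intro σ; exact EqOff.setv _ σ (by simp [Hl.vars]) _
  | out i e => intro σ; exact ⟨fun _ _ => rfl, fun _ _ => rfl⟩
  | seq P Q ihP ihQ =>
    intro σ
    exact ((ihQ _).mono (by simp [Hl.vars]) (by simp [Hl.arrs])).trans
      ((ihP σ).mono (by simp [Hl.vars]) (by simp [Hl.arrs]))
  | rep r x P ih =>
    intro σ
    have key : ∀ i, EqOff (r :: P.vars) P.arrs (P.iter r σ i) σ := by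
      intro i
      induction i with
      | zero => exact EqOff.refl _ _ _
      | succ i ihi =>
        exact ((ih _).mono (by simp) (by simp)).trans ((EqOff.setv _ _ (by simp) _).trans ihi)
    exact (EqOff.setv _ _ (by simp [Hl.vars]) _).trans (key _)

theorem Hl.iter_eqOff (P : Hl ν α) (r : ν) (σ : St ν α) (i : ℕ) :
    EqOff (r :: P.vars) P.arrs (P.iter r σ i) σ := by
  induction i with
  | zero => exact EqOff.refl _ _ _
  | succ i ihi =>
    exact ((P.run_eqOff _).mono (by simp) (by simp)).trans ((EqOff.setv _ _ (by simp) _).trans ihi)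

theorem Hl.run_input (P : Hl ν α) : P.Pure → ∀ σ : St ν α, (P.run σ).io = σ.io := by
  induction P with
  | out i e => intro h; exact h.elim
  | seq P Q ihP ihQ => intro h σ; exact (ihQ h.2 _).trans (ihP h.1 _)
  | rep r x P ih =>
    intro h σ
    have key : ∀ i, (P.iter r σ i).io = σ.io := by
      intro i
      induction i with
      | zero => rfl
      | succ i ihi => exact (ih h _).trans ihi
    exact key _
  | _ => intro _ σ; rfl

/-! #### Triples -/

/-- From `σ`, the program is safe, has cost at most `T`, and ends in a state satisfying `Q`. -/
def Tri (B N : ℕ) (P : Hl ν α) (σ : St ν α) (T : ℕ) (Q : St ν α → Prop) : Prop :=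
  P.Safe B N σ ∧ P.cost σ ≤ T ∧ Q (P.run σ)

variable {B N T : ℕ} {P P' : Hl ν α} {σ : St ν α} {Q Q' : St ν α → Prop}

theorem Tri.mono {T' : ℕ} (h : Tri B N P σ T Q) (hT : T ≤ T') (hQ : ∀ τ, Q τ → Q' τ) :
    Tri B N P σ T' Q' :=
  ⟨h.1, h.2.1.trans hT, hQ _ h.2.2⟩

theorem Tri.frame (h : Tri B N P σ T Q) :
    Tri B N P σ T fun τ => Q τ ∧ EqOff P.vars P.arrs τ σ :=
  ⟨h.1, h.2.1, h.2.2, P.run_eqOff σ⟩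

theorem Tri.frame_input (hP : P.Pure) (h : Tri B N P σ T Q) :
    Tri B N P σ T fun τ => Q τ ∧ τ.io = σ.io :=
  ⟨h.1, h.2.1, h.2.2, P.run_input hP σ⟩

theorem Tri.set {r : ν} {e : Ex ν α} (hB : e.eval σ ≤ B) (hT : 1 + e.cost σ ≤ T)
    (h : Q (σ.setv r (e.eval σ))) : Tri B N (.set r e) σ T Q := ⟨hB, hT, h⟩

theorem Tri.put {a : α} {i e : Ex ν α} (hB : e.eval σ ≤ B) (hT : 1 + i.cost σ + e.cost σ ≤ T)
    (h : Q (σ.seta a (Function.update (σ.a a) (i.eval σ) (e.eval σ)))) :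
    Tri B N (.put a i e) σ T Q := ⟨hB, hT, h⟩

theorem Tri.inp {r : ν} {i : Ex ν α} (hB : i.eval σ < N) (hT : 1 + i.cost σ ≤ T)
    (h : Q (σ.setv r (σ.io (i.eval σ)))) : Tri B N (.inp r i) σ T Q := ⟨hB, hT, h⟩

theorem Tri.out {i e : Ex ν α} (hi : i.eval σ < N) (hB : e.eval σ ≤ B)
    (hT : 1 + i.cost σ + e.cost σ ≤ T)
    (h : Q (σ.setio (i.eval σ) (e.eval σ))) : Tri B N (.out i e) σ T Q := ⟨⟨hi, hB⟩, hT, h⟩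

theorem Tri.seq {T₁ T₂ : ℕ} (h : Tri B N P σ T₁ fun τ => Tri B N P' τ T₂ Q)
    (hT : T₁ + T₂ ≤ T) : Tri B N (.seq P P') σ T Q := by
  obtain ⟨h1, h2, h3, h4, h5⟩ := h
  exact ⟨⟨h1, h3⟩, by simp only [Hl.cost]; omega, h5⟩

/-- Agreement with the initial state outside of the variables and arrays that the body writes is
supplied automatically, so an invariant has to mention only what changes. -/
theorem Tri.rep {r x : ν} (Inv : ℕ → St ν α → Prop) (t : ℕ → ℕ) (h0 : Inv 0 σ)
    (hstep : ∀ i < σ.v x, ∀ τ, EqOff (r :: P.vars) P.arrs τ σ → Inv i τ →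
      Tri B N P (τ.setv r i) (t i) (Inv (i + 1)))
    (hT : 1 + ∑ i ∈ Finset.range (σ.v x), (1 + t i) ≤ T)
    (hQ : ∀ τ, EqOff (r :: P.vars) P.arrs τ σ → Inv (σ.v x) τ → Q (τ.setv r (σ.v r))) :
    Tri B N (.rep r x P) σ T Q := by
  have hI : ∀ i ≤ σ.v x, Inv i (P.iter r σ i) := by
    intro i hi
    induction i with
    | zero => exact h0
    | succ i ih => exact (hstep i hi _ (P.iter_eqOff r σ i) (ih (by omega))).2.2
  refine ⟨fun i hi => (hstep i hi _ (P.iter_eqOff r σ i) (hI i hi.le)).1, ?_,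
    hQ _ (P.iter_eqOff r σ _) (hI _ le_rfl)⟩
  refine le_trans ?_ hT
  simp only [Hl.cost]
  refine Nat.add_le_add_left (Finset.sum_le_sum fun i hi => ?_) 1
  have hi := Finset.mem_range.1 hi
  exact Nat.add_le_add_left (hstep i hi _ (P.iter_eqOff r σ i) (hI i hi.le)).2.1 1

/-- Write the value of `e` to `a[off + r]` for all `r` below `x`. -/
def Hl.fill (a : α) (r x : ν) (off e : Ex ν α) : Hl ν α := .rep r x (.put a (off + .var r) e)

/-- The expression may read the cells already written. In this way recurrences such as the powers of
three, the elimination order, the greedy colouring and the layers of a transform each become one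
loop. -/
theorem Tri.fill {a : α} {r x : ν} {off e : Ex ν α} (spec : ℕ → ℕ) (t o n : ℕ) (hn : σ.v x = n)
    (hoff : ∀ k A, off.eval ((σ.seta a A).setv r k) = o ∧
      off.cost ((σ.seta a A).setv r k) = 0)
    (he : ∀ i < n, ∀ A : ℕ → ℕ, (∀ j < i, A (o + j) = spec j) →
      e.eval ((σ.seta a A).setv r i) = spec i ∧ e.cost ((σ.seta a A).setv r i) ≤ t)
    (hB : ∀ i < n, spec i ≤ B) (hT : 1 + n * (2 + t) ≤ T)
    (hQ : ∀ A : ℕ → ℕ, (∀ j < n, A (o + j) = spec j) →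
      (∀ j, (j < o ∨ o + n ≤ j) → A j = σ.a a j) → Q (σ.seta a A)) :
    Tri B N (.fill a r x off e) σ T Q := by
  subst hn
  refine Tri.rep (fun i τ => ∃ A : ℕ → ℕ, (∀ j < i, A (o + j) = spec j) ∧
      (∀ j, (j < o ∨ o + i ≤ j) → A j = σ.a a j) ∧ ∃ k, τ = (σ.seta a A).setv r k)
    (fun _ => 1 + t) ⟨σ.a a, by simp, by simp, σ.v r, by simp [St.seta, St.setv]⟩ ?_ ?_ ?_
  · rintro i hi τ - ⟨A, hA, hA', k, rfl⟩
    have hs : ((σ.seta a A).setv r k).setv r i = (σ.seta a A).setv r i := by simp [St.setv]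
    rw [hs]
    obtain ⟨h1, h2⟩ := he i hi A hA
    have h3 := hoff i A
    refine Tri.put (by rw [h1]; exact hB i hi) (by simp [h3]; omega)
      ⟨Function.update A (o + i) (spec i), fun j hj => ?_, fun j hj => ?_, i, ?_⟩
    · by_cases hji : j = i
      · subst hji; simp
      · simp [hji, hA j (by omega)]
    · rw [Function.update_of_ne (by omega)]
      exact hA' j (by omega)
    · simp only [Ex.eval_add, Ex.eval_var, h3.1, h1, St.setv_v, Function.update_self]
      simp [St.seta, St.setv]
  · simp only [Finset.sum_const, Finset.card_range, smul_eq_mul]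
    rw [show 1 + (1 + t) = 2 + t by omega]
    exact hT
  · rintro τ - ⟨A, hA, hA', k, rfl⟩
    have : ((σ.seta a A).setv r k).setv r (σ.v r) = σ.seta a A := by simp [St.setv, St.seta]
    rw [this]
    exact hQ A hA hA'

end RAM

/-! ### Ternary codes -/

/-- The digit of `s` at place `c` in base three. -/
def dg (s c : ℕ) : ℕ := s / 3 ^ c % 3

/-- The number with the digits `f c` for `c < b`. -/
def code (f : ℕ → ℕ) (b : ℕ) : ℕ := ∑ c ∈ Finset.range b, f c * 3 ^ c

theorem dg_lt (s c : ℕ) : dg s c < 3 := Nat.mod_lt _ (by norm_num)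

theorem code_succ (f : ℕ → ℕ) (b : ℕ) : code f (b + 1) = code f b + f b * 3 ^ b :=
  Finset.sum_range_succ _ _

theorem code_lt {f : ℕ → ℕ} {b : ℕ} (hf : ∀ c < b, f c < 3) : code f b < 3 ^ b := by
  induction b with
  | zero => simp [code]
  | succ b ih =>
    rw [code_succ, pow_succ]
    have h1 := ih fun c hc => hf c (by omega)
    have h2 := Nat.mul_le_mul_right (3 ^ b) (Nat.le_of_lt_succ (hf b (by omega)))
    omega

theorem dg_code {f : ℕ → ℕ} {b : ℕ} (hf : ∀ c < b, f c < 3) {c : ℕ} (hc : c < b) :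
    dg (code f b) c = f c := by
  induction b with
  | zero => omega
  | succ b ih =>
    have hlt := code_lt (f := f) (b := b) fun c hc => hf c (by omega)
    have hp : 0 < 3 ^ b := by positivity
    rw [code_succ]
    rcases Nat.lt_succ_iff_lt_or_eq.1 hc with h | rfl
    · rw [← ih (fun c hc => hf c (by omega)) h]
      obtain ⟨d, rfl⟩ : ∃ d, b = c + 1 + d := ⟨b - (c + 1), by omega⟩
      unfold dg
      rw [show f (c + 1 + d) * 3 ^ (c + 1 + d) = 3 ^ c * (3 * (f (c + 1 + d) * 3 ^ d)) by ring,
        Nat.add_mul_div_left _ _ (by positivity), Nat.add_mul_mod_self_left]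
    · unfold dg
      rw [Nat.add_mul_div_right _ _ hp, Nat.div_eq_of_lt hlt, zero_add,
        Nat.mod_eq_of_lt (hf c (by omega))]

theorem code_dg (s b : ℕ) : code (dg s) b = s % 3 ^ b := by
  induction b with
  | zero => simp [code, Nat.mod_one]
  | succ b ih =>
    rw [code_succ, ih, dg, pow_succ, Nat.mod_mul]
    ring

theorem code_dg_of_lt {s b : ℕ} (h : s < 3 ^ b) : code (dg s) b = s := by
  rw [code_dg, Nat.mod_eq_of_lt h]

theorem eq_of_dg {b s t : ℕ} (hs : s < 3 ^ b) (ht : t < 3 ^ b) (h : ∀ c < b, dg s c = dg t c) :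
    s = t := by
  rw [← code_dg_of_lt hs, ← code_dg_of_lt ht]
  exact Finset.sum_congr rfl fun c hc => by rw [h c (Finset.mem_range.1 hc)]

/-- Replace the digit at place `c` by `d`. -/
def setDg (s c d : ℕ) : ℕ := s - dg s c * 3 ^ c + d * 3 ^ c

theorem dg_mul_le (s c : ℕ) : dg s c * 3 ^ c ≤ s :=
  (Nat.mul_le_mul_right _ (Nat.mod_le _ _)).trans (Nat.div_mul_le_self _ _)

theorem setDg_eq_code {b s c d : ℕ} (hs : s < 3 ^ b) (hc : c < b) :
    setDg s c d = code (Function.update (dg s) c d) b := by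
  have h1 : code (Function.update (dg s) c d) b + dg s c * 3 ^ c = s + d * 3 ^ c := by
    conv_rhs => rw [← code_dg_of_lt hs]
    have hm : c ∈ Finset.range b := Finset.mem_range.2 hc
    unfold code
    rw [← Finset.add_sum_erase _ _ hm, ← Finset.add_sum_erase _ _ hm, Function.update_self]
    have : ∑ x ∈ (Finset.range b).erase c, Function.update (dg s) c d x * 3 ^ x =
        ∑ x ∈ (Finset.range b).erase c, dg s x * 3 ^ x :=
      Finset.sum_congr rfl fun x hx => by rw [Function.update_of_ne (Finset.ne_of_mem_erase hx)]
    omega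
  have := dg_mul_le s c
  unfold setDg
  omega

theorem setDg_lt {b s c d : ℕ} (hs : s < 3 ^ b) (hc : c < b) (hd : d < 3) :
    setDg s c d < 3 ^ b := by
  rw [setDg_eq_code hs hc]
  refine code_lt fun x _ => ?_
  by_cases hx : x = c
  · subst hx; simpa
  · simpa [hx] using dg_lt s x

theorem dg_setDg {b s c d : ℕ} (hs : s < 3 ^ b) (hc : c < b) (hd : d < 3) {x : ℕ} (hx : x < b) :
    dg (setDg s c d) x = if x = c then d else dg s x := by
  rw [setDg_eq_code hs hc, dg_code _ hx, Function.update_apply]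
  intro x _
  by_cases hx : x = c
  · subst hx; simpa
  · simpa [hx] using dg_lt s x

/-- The number of digits one among the first `b`. -/
def ones (b s : ℕ) : ℕ := ∑ c ∈ Finset.range b, if dg s c = 1 then 1 else 0

theorem ones_le (b s : ℕ) : ones b s ≤ b := by
  refine (Finset.sum_le_card_nsmul _ _ 1 fun c _ => ?_).trans (by simp)
  split_ifs <;> omega

/-! ### Transforms over codes -/

open Classical in
/-- The places below `j` satisfy `β`, and the others `α`. -/
def Mix {ι : Type*} (b : ℕ) (α β : ι → ℕ → ℕ → Prop) (j s : ℕ) (i : ι) : Prop :=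
  ∀ c < b, if c < j then β i c (dg s c) else α i c (dg s c)

section
variable {ι : Type*} {b : ℕ} {α β : ι → ℕ → ℕ → Prop}

/-- Isolates place `j`, the only one whose condition changes between stages `j` and `j + 1`. The
remaining factor is the same in `mix_succ_iff` and `mix_sub_iff`. -/
theorem mix_iff {j s : ℕ} (hj : j < b) (i : ι) :
    Mix b α β j s i ↔ (∀ c < b, c ≠ j → if c < j then β i c (dg s c) else α i c (dg s c)) ∧
      α i j (dg s j) := by
  constructor
  · intro h
    exact ⟨fun c hc _ => h c hc, by simpa using h j hj⟩
  · rintro ⟨h1, h2⟩ c hc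
    by_cases hcj : c = j
    · subst hcj; simpa using h2
    · exact h1 c hc hcj

theorem mix_succ_iff {j s : ℕ} (hj : j < b) (i : ι) :
    Mix b α β (j + 1) s i ↔
      (∀ c < b, c ≠ j → if c < j then β i c (dg s c) else α i c (dg s c)) ∧ β i j (dg s j) := by
  constructor
  · intro h
    refine ⟨fun c hc hcj => ?_, by simpa using h j hj⟩
    have := h c hc
    by_cases h1 : c < j
    · simpa [h1, show c < j + 1 by omega] using this
    · simpa [h1, show ¬ c < j + 1 by omega] using this
  · rintro ⟨h1, h2⟩ c hc
    by_cases hcj : c = j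
    · subst hcj; simpa using h2
    · have := h1 c hc hcj
      by_cases h1 : c < j
      · simpa [h1, show c < j + 1 by omega] using this
      · simpa [h1, show ¬ c < j + 1 by omega] using this

theorem sub_pow_eq_setDg {s j : ℕ} (h : dg s j = 1) : s - 3 ^ j = setDg s j 0 := by
  simp [setDg, h]

theorem mix_sub_iff {j s : ℕ} (hj : j < b) (hs : s < 3 ^ b) (h : dg s j = 1) (i : ι) :
    Mix b α β j (s - 3 ^ j) i ↔
      (∀ c < b, c ≠ j → if c < j then β i c (dg s c) else α i c (dg s c)) ∧ α i j 0 := by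
  rw [sub_pow_eq_setDg h, mix_iff hj]
  have hd : ∀ c < b, dg (setDg s j 0) c = if c = j then 0 else dg s c :=
    fun c hc => dg_setDg hs hj (by norm_num) hc
  rw [hd j hj, if_pos rfl]
  refine and_congr_left fun _ => forall_congr' fun c => forall_congr' fun hc =>
    forall_congr' fun hcj => ?_
  rw [hd c hc, if_neg hcj]

-- Only codes with digit one at place `j` are affected. There `β` is the disjoint union of `α` at
-- one and `α` at zero, and the second part is the old sum at the code with this digit lowered to
-- zero.
open Classical in
theorem sum_mix_zeta (X : Finset ι) (w : ι → ℕ) {j s : ℕ} (hj : j < b) (hs : s < 3 ^ b)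
    (h2 : ∀ i d, d ≠ 1 → (β i j d ↔ α i j d)) (h1 : ∀ i, β i j 1 ↔ α i j 1 ∨ α i j 0)
    (h0 : ∀ i, ¬ (α i j 1 ∧ α i j 0)) :
    (∑ i ∈ X, if Mix b α β (j + 1) s i then w i else 0) =
      (∑ i ∈ X, if Mix b α β j s i then w i else 0) +
        if dg s j = 1 then ∑ i ∈ X, if Mix b α β j (s - 3 ^ j) i then w i else 0 else 0 := by
  split_ifs with h
  · rw [← Finset.sum_add_distrib]
    refine Finset.sum_congr rfl fun i _ => ?_
    have e1 := mix_succ_iff (α := α) (β := β) (s := s) hj i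
    have e2 := mix_iff (α := α) (β := β) (s := s) hj i
    rw [h, h1] at e1
    rw [h] at e2
    simp only [e1, e2, mix_sub_iff hj hs h]
    have := h0 i
    by_cases ha : α i j 1 <;> by_cases hb : α i j 0 <;> simp_all
  · rw [add_zero]
    refine Finset.sum_congr rfl fun i _ => ?_
    simp only [mix_succ_iff hj, mix_iff hj, h2 i _ h]

-- The reverse step: `α` at one is the disjoint union of `β` at one and `α` at zero. The sum
-- subtracted is part of the sum it is taken from, so truncated subtraction is exact.
open Classical in
theorem sum_mix_moebius (X : Finset ι) (w : ι → ℕ) {j s : ℕ} (hj : j < b) (hs : s < 3 ^ b)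
    (h2 : ∀ i d, d ≠ 1 → (β i j d ↔ α i j d)) (h1 : ∀ i, α i j 1 ↔ β i j 1 ∨ α i j 0)
    (h0 : ∀ i, ¬ (β i j 1 ∧ α i j 0)) :
    (∑ i ∈ X, if Mix b α β (j + 1) s i then w i else 0) =
      (∑ i ∈ X, if Mix b α β j s i then w i else 0) -
        if dg s j = 1 then ∑ i ∈ X, if Mix b α β j (s - 3 ^ j) i then w i else 0 else 0 := by
  split_ifs with h
  · refine Nat.eq_sub_of_add_eq ?_
    rw [← Finset.sum_add_distrib]
    refine Finset.sum_congr rfl fun i _ => ?_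
    have e1 := mix_succ_iff (α := α) (β := β) (s := s) hj i
    have e2 := mix_iff (α := α) (β := β) (s := s) hj i
    rw [h] at e1
    rw [h, h1] at e2
    simp only [e1, e2, mix_sub_iff hj hs h]
    have := h0 i
    by_cases ha : β i j 1 <;> by_cases hb : α i j 0 <;> simp_all
  · rw [Nat.sub_zero]
    refine Finset.sum_congr rfl fun i _ => ?_
    simp only [mix_succ_iff hj, mix_iff hj, h2 i _ h]

end

/-- The first `j` rounds of summing over the codes obtained by turning digits one into zero. -/
def zetaL (f : ℕ → ℕ) : ℕ → ℕ → ℕ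
  | 0, s => f s
  | j + 1, s => zetaL f j s + if dg s j = 1 then zetaL f j (s - 3 ^ j) else 0

/-- The first `j` rounds of the inverse transform. -/
def moebL (f : ℕ → ℕ) : ℕ → ℕ → ℕ
  | 0, s => f s
  | j + 1, s => moebL f j s - if dg s j = 1 then moebL f j (s - 3 ^ j) else 0

theorem zetaL_le {f : ℕ → ℕ} {M : ℕ} (h : ∀ s, f s ≤ M) (j s : ℕ) : zetaL f j s ≤ 2 ^ j * M := by
  induction j generalizing s with
  | zero => simpa [zetaL] using h s
  | succ j ih =>
    have h1 := ih s
    have h2 := ih (s - 3 ^ j)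
    rw [zetaL, pow_succ]
    split_ifs <;> nlinarith

theorem moebL_le (f : ℕ → ℕ) (j s : ℕ) : moebL f j s ≤ f s := by
  induction j with
  | zero => exact le_rfl
  | succ j ih => rw [moebL]; omega

open Classical in
theorem zetaL_eq (f : ℕ → ℕ) {b j s : ℕ} (hj : j ≤ b) (hs : s < 3 ^ b) :
    zetaL f j s = ∑ a ∈ Finset.range (3 ^ b),
      if Mix b (fun a c d => dg a c = d) (fun a c d => dg a c = d ∨ d = 1 ∧ dg a c = 0) j s a
        then f a else 0 := by
  induction j generalizing s with
  | zero =>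
    rw [zetaL, Finset.sum_eq_single s]
    · rw [if_pos]; intro c hc; simp
    · intro a ha has
      rw [if_neg]
      intro h
      exact has (eq_of_dg (Finset.mem_range.1 ha) hs fun c hc => by simpa using h c hc)
    · intro h; exact absurd (Finset.mem_range.2 hs) h
  | succ j ih =>
    rw [zetaL, ih (by omega) hs, ih (by omega) (lt_of_le_of_lt (Nat.sub_le s _) hs)]
    refine (sum_mix_zeta _ _ hj hs ?_ ?_ ?_).symm
    · intro a d hd; simp [hd]
    · intro a; simp
    · intro a h; omega

-- On a sum over pairs whose digits may both be lowered, the inverse transform discards, place by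
-- place, the pairs with two zeros under a one of `s`. What remains after all rounds are the pairs
-- whose ones together cover those of `s`.
open Classical in
theorem moebL_eq (g : ℕ → ℕ) (F : ℕ × ℕ → ℕ) {b j s : ℕ} (hj : j ≤ b) (hs : s < 3 ^ b)
    (hg : ∀ s < 3 ^ b, g s = ∑ p ∈ Finset.range (3 ^ b) ×ˢ Finset.range (3 ^ b),
      if ∀ c < b, (dg p.1 c = dg s c ∨ dg s c = 1 ∧ dg p.1 c = 0) ∧
        (dg p.2 c = dg s c ∨ dg s c = 1 ∧ dg p.2 c = 0) then F p else 0) :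
    moebL g j s = ∑ p ∈ Finset.range (3 ^ b) ×ˢ Finset.range (3 ^ b),
      if Mix b (fun p c d => (dg p.1 c = d ∨ d = 1 ∧ dg p.1 c = 0) ∧
          (dg p.2 c = d ∨ d = 1 ∧ dg p.2 c = 0))
        (fun p c d => ((dg p.1 c = d ∨ d = 1 ∧ dg p.1 c = 0) ∧
          (dg p.2 c = d ∨ d = 1 ∧ dg p.2 c = 0)) ∧ ¬ (d = 1 ∧ dg p.1 c = 0 ∧ dg p.2 c = 0)) j s p
        then F p else 0 := by
  induction j generalizing s with
  | zero =>
    rw [moebL, hg s hs]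
    refine Finset.sum_congr rfl fun p _ => ?_
    congr 1
  | succ j ih =>
    rw [moebL, ih (by omega) hs, ih (by omega) (lt_of_le_of_lt (Nat.sub_le s _) hs)]
    refine (sum_mix_moebius _ _ hj hs ?_ ?_ ?_).symm
    · intro a d hd; simp [hd]
    · intro a; simp; tauto
    · intro a h; omega

/-- The coefficient at `k` of the product of two truncated polynomials. -/
def conv (L k : ℕ) (f g : ℕ → ℕ) : ℕ :=
  ∑ i ∈ Finset.range L, (if i ≤ k then 1 else 0) * f i * g (k - i)

theorem conv_le {L k M : ℕ} {f g : ℕ → ℕ} (hf : ∀ i, f i ≤ M) (hg : ∀ i, g i ≤ M) :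
    conv L k f g ≤ L * (M * M) := by
  refine (Finset.sum_le_card_nsmul _ _ (M * M) fun i _ => ?_).trans (by simp)
  have := Nat.mul_le_mul (hf i) (hg (k - i))
  split_ifs <;> simp [this]

/-- The union product of two families of polynomials, by pointwise multiplication of transforms. -/
def unionProd (b L : ℕ) (f g : ℕ → ℕ → ℕ) (j s k : ℕ) : ℕ :=
  moebL (fun s => conv L k (fun i => zetaL (fun a => f a i) b s)
    (fun i => zetaL (fun a => g a i) b s)) j s

/-- A product of two transforms is the transform of the family of pairs, so `moebL_eq` applies with
the convolution as weight. All terms are natural numbers, hence nothing cancels and a nonzero sum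
has a nonzero term. -/
theorem unionProd_ne_zero {b L : ℕ} {f g : ℕ → ℕ → ℕ} {s k : ℕ} (hs : s < 3 ^ b) (hk : k < L) :
    unionProd b L f g b s k ≠ 0 ↔ ∃ a < 3 ^ b, ∃ a' < 3 ^ b, ∃ i ≤ k, f a i ≠ 0 ∧ g a' (k - i) ≠ 0 ∧
      ∀ c < b, ((dg a c = dg s c ∨ dg s c = 1 ∧ dg a c = 0) ∧
          (dg a' c = dg s c ∨ dg s c = 1 ∧ dg a' c = 0)) ∧
          ¬ (dg s c = 1 ∧ dg a c = 0 ∧ dg a' c = 0) := by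
  classical
  rw [unionProd, moebL_eq _ (fun p => conv L k (f p.1) (g p.2)) le_rfl hs]
  · simp only [ne_eq, Finset.sum_eq_zero_iff, Finset.mem_product, Finset.mem_range,
      ite_eq_right_iff, not_forall, Prod.exists, conv, mul_eq_zero, one_ne_zero,
      imp_false, not_or, not_le, not_lt, Mix]
    constructor
    · rintro ⟨a, a', ⟨ha, ha'⟩, hM, i, hi, ⟨hik, h1⟩, h2⟩
      refine ⟨a, ha, a', ha', i, hik, h1, h2, fun c hc => ?_⟩
      have := hM c hc
      rwa [if_pos hc] at this
    · rintro ⟨a, ha, a', ha', i, hik, h1, h2, h⟩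
      refine ⟨a, a', ⟨ha, ha'⟩, fun c hc => ?_, i, by omega, ⟨hik, h1⟩, h2⟩
      rw [if_pos hc]
      exact h c hc
  · intro s hs
    simp only [conv, zetaL_eq _ le_rfl hs]
    simp_rw [mul_assoc, Finset.sum_mul_sum, Finset.mul_sum]
    rw [Finset.sum_product, Finset.sum_comm]
    refine Finset.sum_congr rfl fun a _ => ?_
    rw [Finset.sum_comm]
    refine Finset.sum_congr rfl fun a' _ => ?_
    have hiff : (∀ c < b, (dg a c = dg s c ∨ dg s c = 1 ∧ dg a c = 0) ∧
        (dg a' c = dg s c ∨ dg s c = 1 ∧ dg a' c = 0)) ↔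
        Mix b (fun a c d => dg a c = d) (fun a c d => dg a c = d ∨ d = 1 ∧ dg a c = 0) b s a ∧
        Mix b (fun a c d => dg a c = d) (fun a c d => dg a c = d ∨ d = 1 ∧ dg a c = 0) b s a' := by
      simp only [Mix, ← forall_and]
      refine forall_congr' fun c => forall_congr' fun hc => ?_
      simp [hc]
    simp only [hiff]
    split_ifs <;> simp_all

theorem unionProd_le {b L : ℕ} {f g : ℕ → ℕ → ℕ} {M : ℕ} (hf : ∀ s i, f s i ≤ M)
    (hg : ∀ s i, g s i ≤ M) (j s k : ℕ) :
    unionProd b L f g j s k ≤ L * (2 ^ b * M * (2 ^ b * M)) :=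
  (moebL_le _ _ _).trans (conv_le (fun i => zetaL_le (fun s => hf s i) b s)
    fun i => zetaL_le (fun s => hg s i) b s)

/-- The digits `x` and `y` combine to `z` without carrying a one twice. -/
def Comb (x y z : ℕ) : Prop := (x = 2 ∧ y = 2 ∧ z = 2) ∨ (x ≠ 2 ∧ y ≠ 2 ∧ z ≠ 2 ∧ x + y = z)

/-- The entry of a table in which each code `s` has its keys congruent to `ones b s`. -/
noncomputable def ranked (b R : ℕ) (p : ℕ → ℕ → Prop) (s k : ℕ) : ℕ :=
  open Classical in if k % R = ones b s ∧ p s (k / R) then 1 else 0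

theorem ranked_le (b R : ℕ) (p : ℕ → ℕ → Prop) (s k : ℕ) : ranked b R p s k ≤ 1 := by
  unfold ranked; split_ifs <;> omega

/-- The union product covers each one of `s` at least once. If the numbers of ones of the two
factors add up to that of `s`, each is covered exactly once, which is addition without double ones.
Each rank is at most `b` and `R` exceeds `2 * b`, so the keys `k * R + rank` add without carry and
one convolution handles cost and rank together. -/
theorem unionProd_ranked {b R n : ℕ} (hR : 2 * b < R) {p q : ℕ → ℕ → Prop} {s k : ℕ}
    (hs : s < 3 ^ b) (hk : k < n) :
    unionProd b (n * R) (ranked b R p) (ranked b R q) b s (k * R + ones b s) ≠ 0 ↔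
      ∃ a < 3 ^ b, ∃ a' < 3 ^ b, (∀ c < b, Comb (dg a c) (dg a' c) (dg s c)) ∧
        ∃ k₁ k₂, k₁ + k₂ = k ∧ p a k₁ ∧ q a' k₂ := by
  have hRpos : 0 < R := by omega
  have hos := ones_le b s
  have hkL : k * R + ones b s < n * R := by
    have : (k + 1) * R ≤ n * R := Nat.mul_le_mul_right R hk
    rw [add_mul] at this; omega
  rw [unionProd_ne_zero hs hkL]
  have hones : ∀ a a' : ℕ, (∀ c < b, ((dg a c = dg s c ∨ dg s c = 1 ∧ dg a c = 0) ∧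
      (dg a' c = dg s c ∨ dg s c = 1 ∧ dg a' c = 0)) ∧ ¬ (dg s c = 1 ∧ dg a c = 0 ∧ dg a' c = 0)) →
      (ones b a + ones b a' = ones b s ↔ ∀ c < b, Comb (dg a c) (dg a' c) (dg s c)) := by
    intro a a' h
    unfold ones
    rw [← Finset.sum_add_distrib]
    have hle : ∀ c ∈ Finset.range b, (if dg s c = 1 then 1 else 0) ≤
        ((if dg a c = 1 then 1 else 0) + if dg a' c = 1 then 1 else 0) := by
      intro c hc
      have := h c (Finset.mem_range.1 hc)
      split_ifs <;> omega
    -- Termwise inequalities whose sums agree are termwise equalities.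
    rw [eq_comm, Finset.sum_eq_sum_iff_of_le hle]
    simp only [Finset.mem_range]
    refine forall_congr' fun c => forall_congr' fun hc => ?_
    have h1 := h c hc
    have h2 := dg_lt s c
    unfold Comb
    split_ifs <;> omega
  constructor
  · rintro ⟨a, ha, a', ha', i, hi, h1, h2, h3⟩
    simp only [ranked, ne_eq, ite_eq_right_iff, one_ne_zero, imp_false, not_not] at h1 h2
    obtain ⟨h1, h1'⟩ := h1
    obtain ⟨h2, h2'⟩ := h2
    have e1 := Nat.div_add_mod i R
    have e2 := Nat.div_add_mod (k * R + ones b s - i) R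
    have oa := ones_le b a
    have oa' := ones_le b a'
    -- Quotient and remainder by `R` separate the costs from the ranks, since both rank totals are
    -- below `R`.
    have hsum : R * (i / R + (k * R + ones b s - i) / R) + (ones b a + ones b a') =
        R * k + ones b s := by rw [mul_add, mul_comm R k]; omega
    have hdiv := congrArg (· / R) hsum
    have hmod := congrArg (· % R) hsum
    simp only [Nat.mul_add_div hRpos, Nat.mul_add_mod] at hdiv hmod
    rw [Nat.div_eq_of_lt (show ones b a + ones b a' < R by omega),
      Nat.div_eq_of_lt (show ones b s < R by omega)] at hdiv
    rw [Nat.mod_eq_of_lt (show ones b a + ones b a' < R by omega),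
      Nat.mod_eq_of_lt (show ones b s < R by omega)] at hmod
    exact ⟨a, ha, a', ha', (hones a a' h3).1 hmod, _, _, by omega, h1', h2'⟩
  · rintro ⟨a, ha, a', ha', hc, k₁, k₂, rfl, hp, hq⟩
    have h3 : ∀ c < b, ((dg a c = dg s c ∨ dg s c = 1 ∧ dg a c = 0) ∧
      (dg a' c = dg s c ∨ dg s c = 1 ∧ dg a' c = 0)) ∧
        ¬ (dg s c = 1 ∧ dg a c = 0 ∧ dg a' c = 0) := by
      intro c h
      have h1 := hc c h
      have h2 := dg_lt s c
      unfold Comb at h1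
      omega
    have ho := (hones a a' h3).2 hc
    have oa : ones b a < R := by have := ones_le b a; omega
    have oa' : ones b a' < R := by have := ones_le b a'; omega
    refine ⟨a, ha, a', ha', k₁ * R + ones b a, by rw [add_mul]; omega, ?_, ?_, h3⟩
    · rw [ranked, if_pos]
      · simp
      · rw [Nat.mul_add_mod', Nat.mod_eq_of_lt oa, mul_comm, Nat.mul_add_div hRpos,
          Nat.div_eq_of_lt oa]
        exact ⟨rfl, hp⟩
    · have : (k₁ + k₂) * R + ones b s - (k₁ * R + ones b a) = k₂ * R + ones b a' := by
        rw [add_mul]; omega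
      rw [ranked, this, if_pos]
      · simp
      · rw [Nat.mul_add_mod', Nat.mod_eq_of_lt oa', mul_comm, Nat.mul_add_div hRpos,
          Nat.div_eq_of_lt oa']
        exact ⟨rfl, hq⟩

/-! ### Dynamic programming over an elimination order -/

/-- A graph on the numbers below `n`, eliminated in their natural order: `U i` is the set of later
vertices that become adjacent to `i`, and `col` is a proper colouring of the filled graph. -/
structure ElimOrder (n b : ℕ) (adj U : ℕ → ℕ → Prop) (col : ℕ → ℕ) : Prop where
  symm : ∀ {x y}, adj x y → adj y x
  irrefl : ∀ x, ¬ adj x x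
  lt : ∀ {x y}, adj x y → y < n
  edge : ∀ {i j}, adj i j → i < j → U i j
  U_lt : ∀ {i j}, U i j → i < j ∧ j < n
  trans : ∀ {i j k}, U i j → U i k → j < k → U j k
  col_lt : ∀ {i}, i < n → col i < b
  col_ne : ∀ {i j}, U i j → col i ≠ col j

namespace ElimOrder

set_option linter.unusedSectionVars false

open Classical in
/-- The vertices whose tables have been merged into the table of `v` after `i` steps. -/
noncomputable def desc (n : ℕ) (U : ℕ → ℕ → Prop) : ℕ → ℕ → Finset ℕ
  | 0, _ => ∅
  | i + 1, v => if v = least (U i) n then insert i (desc n U i v ∪ desc n U i i) else desc n U i v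

section
open Classical

variable (n : ℕ) (adj U : ℕ → ℕ → Prop) (col : ℕ → ℕ)

noncomputable def degIn (S : Finset ℕ) (w : ℕ) : ℕ := (S.filter fun y => adj w y).card

/-- The number of neighbours of `w` outside of `D` that `s` does not delete. -/
noncomputable def degOut (D : Finset ℕ) (s w : ℕ) : ℕ :=
  ((Finset.range n \ D).filter fun y => adj w y ∧ dg s (col y) ≠ 2).card

/-- The number of edges between `S` and the vertices of colour `c` outside of `D`. -/
noncomputable def edgeCol (D S : Finset ℕ) (c : ℕ) : ℕ :=
  ∑ u ∈ (Finset.range n \ D).filter fun u => col u = c, degIn adj S u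

/-- `S` is the set of vertices kept in `D` by a solution of cost `k` compatible with the code `s`:
digit two stands for deletion, and a smaller digit is the number of neighbours in `S`. -/
structure Keep (b : ℕ) (Φ : ℕ → Prop) (D : Finset ℕ) (s k : ℕ) (S : Finset ℕ) : Prop where
  sub : S ⊆ D
  card : (D \ S).card = k
  forced : ∀ x ∈ D, Φ x → x ∈ S
  deg : ∀ w ∈ S, degIn adj S w + degOut n adj col D s w ≤ 1
  edge : ∀ c < b, dg s c ≠ 2 → edgeCol n adj col D S c = dg s c

/-- There is a solution of cost `k` compatible with `s`. -/
def Val (b : ℕ) (Φ : ℕ → Prop) (D : Finset ℕ) (s k : ℕ) : Prop :=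
  ∃ S, Keep n adj col b Φ D s k S

variable {n adj U col} {b : ℕ} {Φ : ℕ → Prop}

theorem degIn_eq_zero {S : Finset ℕ} {w : ℕ} (h : ∀ y ∈ S, ¬ adj w y) : degIn adj S w = 0 := by
  unfold degIn
  rw [Finset.card_eq_zero, Finset.filter_eq_empty_iff]
  exact fun y hy => h y hy

theorem degIn_union {S S' : Finset ℕ} (h : Disjoint S S') (w : ℕ) :
    degIn adj (S ∪ S') w = degIn adj S w + degIn adj S' w := by
  unfold degIn
  rw [Finset.filter_union, Finset.card_union_of_disjoint (Finset.disjoint_filter_filter h)]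

theorem degIn_insert {S : Finset ℕ} {i : ℕ} (h : i ∉ S) (w : ℕ) :
    degIn adj (insert i S) w = degIn adj S w + if adj w i then 1 else 0 := by
  unfold degIn
  rw [Finset.filter_insert]
  split_ifs with hw
  · rw [Finset.card_insert_of_notMem (by simp [h])]
  · rfl

/-- With nothing eliminated there are no edges to count, so a digit one cannot be met, whereas zero
and two are always consistent. -/
theorem val_empty {s k : ℕ} : Val n adj col b Φ ∅ s k ↔ k = 0 ∧ ones b s = 0 := by
  have h0 : ∀ c, edgeCol n adj col ∅ ∅ c = 0 := fun c => by simp [edgeCol, degIn]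
  have h1 : ones b s = 0 ↔ ∀ c < b, dg s c ≠ 1 := by simp [ones]
  constructor
  · rintro ⟨S, hS⟩
    obtain rfl : S = ∅ := Finset.subset_empty.1 hS.sub
    refine ⟨by simpa using hS.card.symm, h1.2 fun c hc h => ?_⟩
    have := hS.edge c hc (by omega)
    rw [h0] at this
    omega
  · rintro ⟨rfl, h⟩
    refine ⟨∅, subset_rfl, by simp, by simp, by simp, fun c hc h2 => ?_⟩
    have := h1.1 h c hc
    have := dg_lt s c
    rw [h0]
    omega

/-- The codes of two merged parts and of their union have their digits two in the same places, so
they define the same outside degrees. -/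
theorem degOut_congr {D : Finset ℕ} {s t w : ℕ} (hcol : ∀ {i}, i < n → col i < b)
    (h : ∀ c < b, dg s c = 2 ↔ dg t c = 2) :
    degOut n adj col D s w = degOut n adj col D t w := by
  unfold degOut
  congr 1
  refine Finset.filter_congr fun y hy => ?_
  have hy : y < n := Finset.mem_range.1 (Finset.mem_sdiff.1 hy).1
  rw [ne_eq, h _ (hcol hy)]

theorem degOut_union {D D' : Finset ℕ} {s w : ℕ} (h : ∀ y ∈ D', ¬ adj w y) :
    degOut n adj col (D ∪ D') s w = degOut n adj col D s w := by
  unfold degOut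
  congr 1
  ext y
  simp only [Finset.mem_filter, Finset.mem_sdiff, Finset.mem_union, not_or]
  constructor
  · rintro ⟨⟨h1, h2, -⟩, h3⟩; exact ⟨⟨h1, h2⟩, h3⟩
  · rintro ⟨⟨h1, h2⟩, h3⟩; exact ⟨⟨h1, h2, fun hy => h y hy h3.1⟩, h3⟩

theorem edgeCol_union_left {D D' S : Finset ℕ} {c : ℕ} (h : ∀ u ∈ D', ∀ y ∈ S, ¬ adj u y) :
    edgeCol n adj col (D ∪ D') S c = edgeCol n adj col D S c := by
  unfold edgeCol
  refine Finset.sum_subset (fun u => ?_) fun u h1 h2 => ?_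
  · simp only [Finset.mem_filter, Finset.mem_sdiff, Finset.mem_union, not_or]
    rintro ⟨⟨h1, h2, -⟩, h3⟩; exact ⟨⟨h1, h2⟩, h3⟩
  · refine degIn_eq_zero (h u ?_)
    simp only [Finset.mem_filter, Finset.mem_sdiff, Finset.mem_union, not_or] at h1 h2
    by_contra h3
    exact h2 ⟨⟨h1.1.1, h1.1.2, h3⟩, h1.2⟩

theorem edgeCol_union {D D' S S' : Finset ℕ} {c : ℕ} (hS : S ⊆ D) (hS' : S' ⊆ D')
    (hd : Disjoint D D') (h : ∀ x ∈ D, ∀ y ∈ D', ¬ adj x y)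
    (hsymm : ∀ {x y}, adj x y → adj y x) :
    edgeCol n adj col (D ∪ D') (S ∪ S') c =
      edgeCol n adj col D S c + edgeCol n adj col D' S' c := by
  have h1 : edgeCol n adj col (D ∪ D') (S ∪ S') c =
      edgeCol n adj col (D ∪ D') S c + edgeCol n adj col (D ∪ D') S' c := by
    unfold edgeCol
    rw [← Finset.sum_add_distrib]
    exact Finset.sum_congr rfl fun u _ => degIn_union (hd.mono hS hS') u
  rw [h1, edgeCol_union_left fun u hu y hy h2 => h y (hS hy) u hu (hsymm h2), Finset.union_comm,
    edgeCol_union_left fun u hu y hy h2 => h u hu y (hS' hy) h2]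

theorem _root_.Comb.two_left {x y z : ℕ} (h : Comb x y z) : x = 2 ↔ z = 2 := by
  unfold Comb at h; omega

theorem _root_.Comb.two_right {x y z : ℕ} (h : Comb x y z) : y = 2 ↔ z = 2 := by
  unfold Comb at h; omega

/-- Without edges between the two sets, edge counts to the outside add up, and the degree of a kept
vertex involves only its own part and the common outside. A solution for the union is thus a pair of
solutions with the same deletions outside and with counts adding to those of `s`. -/
theorem val_union (hsymm : ∀ {x y}, adj x y → adj y x) (hcol : ∀ {i}, i < n → col i < b)
    {D D' : Finset ℕ} (hd : Disjoint D D') (h : ∀ x ∈ D, ∀ y ∈ D', ¬ adj x y) {s k : ℕ} :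
    Val n adj col b Φ (D ∪ D') s k ↔ ∃ a < 3 ^ b, ∃ a' < 3 ^ b,
      (∀ c < b, Comb (dg a c) (dg a' c) (dg s c)) ∧
        ∃ k₁ k₂, k₁ + k₂ = k ∧ Val n adj col b Φ D a k₁ ∧ Val n adj col b Φ D' a' k₂ := by
  constructor
  · rintro ⟨S, hS⟩
    have hS0 : S = S ∩ D ∪ S ∩ D' := by
      rw [← Finset.inter_union_distrib_left, Finset.inter_eq_left.2 hS.sub]
    have hdS : Disjoint (S ∩ D) (S ∩ D') := hd.mono Finset.inter_subset_right Finset.inter_subset_right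
    have he : ∀ c < b, dg s c ≠ 2 →
        edgeCol n adj col D (S ∩ D) c + edgeCol n adj col D' (S ∩ D') c = dg s c := by
      intro c hc h2
      rw [← edgeCol_union Finset.inter_subset_right Finset.inter_subset_right hd h hsymm, ← hS0]
      exact hS.edge c hc h2
    -- The code of a part copies the deletions of `s` and records the edges of that part. These
    -- counts are legal digits because the two of them add up to a digit of `s`.
    set f : ℕ → ℕ := fun c => if dg s c = 2 then 2 else edgeCol n adj col D (S ∩ D) c with hf
    set f' : ℕ → ℕ := fun c => if dg s c = 2 then 2 else edgeCol n adj col D' (S ∩ D') c with hf'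
    have hf3 : ∀ c < b, f c < 3 := by
      intro c hc
      have h1 := he c hc
      have h2 := dg_lt s c
      simp only [hf]; split_ifs <;> omega
    have hf3' : ∀ c < b, f' c < 3 := by
      intro c hc
      have h1 := he c hc
      have h2 := dg_lt s c
      simp only [hf']; split_ifs <;> omega
    have hcomb : ∀ c < b, Comb (dg (code f b) c) (dg (code f' b) c) (dg s c) := by
      intro c hc
      rw [dg_code hf3 hc, dg_code hf3' hc]
      have h1 := he c hc
      have h2 := dg_lt s c
      simp only [hf, hf', Comb]; split_ifs <;> omega
    refine ⟨code f b, code_lt hf3, code f' b, code_lt hf3', hcomb,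
      (D \ S).card, (D' \ S).card, ?_, ⟨S ∩ D, ?_⟩, ⟨S ∩ D', ?_⟩⟩
    · rw [← hS.card, Finset.union_sdiff_distrib, Finset.card_union_of_disjoint]
      exact hd.mono Finset.sdiff_subset Finset.sdiff_subset
    · refine ⟨Finset.inter_subset_right, by rw [Finset.inter_comm, Finset.sdiff_inter_self_left],
        fun x hx hΦ => Finset.mem_inter.2 ⟨hS.forced x (by simp [hx]) hΦ, hx⟩, fun w hw => ?_,
        fun c hc h2 => ?_⟩
      · have hwD := (Finset.mem_inter.1 hw).2
        have := hS.deg w (Finset.mem_inter.1 hw).1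
        rw [hS0, degIn_union hdS, degOut_union (h w hwD),
          ← degOut_congr hcol fun c hc => (hcomb c hc).two_left] at this
        omega
      · rw [dg_code hf3 hc] at h2 ⊢
        have h3 : ¬ dg s c = 2 := fun h => by simp [hf, h] at h2
        simp [hf, h3]
    · refine ⟨Finset.inter_subset_right, by rw [Finset.inter_comm, Finset.sdiff_inter_self_left],
        fun x hx hΦ => Finset.mem_inter.2 ⟨hS.forced x (by simp [hx]) hΦ, hx⟩, fun w hw => ?_,
        fun c hc h2 => ?_⟩
      · have hwD := (Finset.mem_inter.1 hw).2
        have := hS.deg w (Finset.mem_inter.1 hw).1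
        rw [hS0, degIn_union hdS, Finset.union_comm D D',
          degOut_union fun y hy h1 => h y hy w hwD (hsymm h1),
          ← degOut_congr hcol fun c hc => (hcomb c hc).two_right] at this
        omega
      · rw [dg_code hf3' hc] at h2 ⊢
        have h3 : ¬ dg s c = 2 := fun h => by simp [hf', h] at h2
        simp [hf', h3]
  · rintro ⟨a, -, a', -, hcomb, k₁, k₂, rfl, ⟨S, hS⟩, ⟨S', hS'⟩⟩
    have hdS := hd.mono hS.sub hS'.sub
    have hsd : (D ∪ D') \ (S ∪ S') = D \ S ∪ D' \ S' := by
      ext x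
      have h1 := @hS.sub x
      have h2 := @hS'.sub x
      have h3 : x ∈ D → x ∉ D' := fun h => Finset.disjoint_left.1 hd h
      simp only [Finset.mem_sdiff, Finset.mem_union]
      tauto
    refine ⟨S ∪ S', Finset.union_subset_union hS.sub hS'.sub, ?_, fun x hx hΦ => ?_,
      fun w hw => ?_, fun c hc h2 => ?_⟩
    · rw [hsd, Finset.card_union_of_disjoint (hd.mono Finset.sdiff_subset Finset.sdiff_subset),
        hS.card, hS'.card]
    · rcases Finset.mem_union.1 hx with hx | hx
      · exact Finset.mem_union_left _ (hS.forced x hx hΦ)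
      · exact Finset.mem_union_right _ (hS'.forced x hx hΦ)
    · rw [degIn_union hdS]
      rcases Finset.mem_union.1 hw with hw | hw
      · rw [degIn_eq_zero (S := S') fun y hy => h w (hS.sub hw) y (hS'.sub hy),
          degOut_union (h w (hS.sub hw)), ← degOut_congr hcol fun c hc => (hcomb c hc).two_left]
        exact hS.deg w hw
      · rw [degIn_eq_zero (S := S) fun y hy h1 => h y (hS.sub hy) w (hS'.sub hw) (hsymm h1),
          Finset.union_comm D D', degOut_union fun y hy h1 => h y hy w (hS'.sub hw) (hsymm h1),
          ← degOut_congr hcol fun c hc => (hcomb c hc).two_right, zero_add]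
        exact hS'.deg w hw
    · rw [edgeCol_union hS.sub hS'.sub hd h hsymm]
      have h3 := hcomb c hc
      have h4 := hS.edge c hc
      have h5 := hS'.edge c hc
      unfold Comb at h3
      omega

variable (n adj U col) in
/-- The later neighbours of `i` that `s` does not delete. -/
noncomputable def later (i s : ℕ) : Finset ℕ :=
  (Finset.range n).filter fun j => U i j ∧ adj i j ∧ dg s (col j) ≠ 2

variable (h : ElimOrder n b adj U col)
include h

/-! ### Elimination of a single vertex -/

section
variable {D : Finset ℕ} {i : ℕ} (hi : i < n) (hD : i ∉ D)
  (hbd : ∀ x ∈ D, ∀ y, adj x y → y ∉ D → y = i ∨ U i y) (hlow : ∀ y < i, adj i y → y ∈ D)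
include hi hD

theorem range_sdiff : Finset.range n \ D = insert i (Finset.range n \ insert i D) := by
  ext x
  simp only [Finset.mem_sdiff, Finset.mem_insert, Finset.mem_range]
  by_cases hx : x = i
  · subst hx; simp [hi, hD]
  · simp [hx]

theorem edgeCol_insert_of_ne {S : Finset ℕ} {c : ℕ} (hc : c ≠ col i) :
    edgeCol n adj col (insert i D) S c = edgeCol n adj col D S c := by
  unfold edgeCol
  rw [range_sdiff h hi hD, Finset.filter_insert, if_neg (Ne.symm hc)]

include hbd

/-- A vertex other than `i` that lies outside and meets `D` is a later relative of `i`, hence of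
another colour. Once `i` has been eliminated its colour is free for reuse. -/
theorem edgeCol_insert_self {S : Finset ℕ} (hS : S ⊆ D) :
    edgeCol n adj col (insert i D) S (col i) = 0 := by
  unfold edgeCol
  refine Finset.sum_eq_zero fun u hu => degIn_eq_zero fun y hy hadj => ?_
  simp only [Finset.mem_filter, Finset.mem_sdiff, Finset.mem_insert, not_or] at hu
  rcases hbd y (hS hy) u (h.symm hadj) hu.1.2.2 with h1 | h1
  · exact hu.1.2.1 h1
  · exact h.col_ne h1 hu.2.symm

/-- Among the outside vertices of the colour of `i`, only `i` itself can contribute; its digit in a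
code is therefore its own degree into `S`. -/
theorem edgeCol_self {S : Finset ℕ} (hS : S ⊆ D) :
    edgeCol n adj col D S (col i) = degIn adj S i := by
  have := edgeCol_insert_self h hi hD hbd hS
  unfold edgeCol at this ⊢
  rw [range_sdiff h hi hD, Finset.filter_insert, if_pos rfl, Finset.sum_insert (by simp), this,
    add_zero]

theorem degOut_eq {s t w : ℕ} (hw : w ∈ D)
    (ht : ∀ c < b, c ≠ col i → (dg t c = 2 ↔ dg s c = 2)) :
    degOut n adj col D t w = (if adj w i ∧ dg t (col i) ≠ 2 then 1 else 0) +
      degOut n adj col (insert i D) s w := by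
  have h1 : ∀ y ∈ Finset.range n \ insert i D,
      adj w y ∧ dg t (col y) ≠ 2 ↔ adj w y ∧ dg s (col y) ≠ 2 := by
    intro y hy
    simp only [Finset.mem_sdiff, Finset.mem_insert, not_or, Finset.mem_range] at hy
    refine and_congr_right fun hwy => ?_
    rcases hbd w hw y hwy hy.2.2 with h2 | h2
    · exact absurd h2 hy.2.1
    · rw [ne_eq, ht _ (h.col_lt hy.1) (h.col_ne h2).symm]
  unfold degOut
  rw [range_sdiff h hi hD, Finset.filter_insert, Finset.filter_congr h1]
  split_ifs with h2
  · rw [Finset.card_insert_of_notMem (by simp), add_comm]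
  · rw [zero_add]

omit hbd
include hlow

theorem adj_out_iff {u : ℕ} (hu : u ∉ insert i D) : adj i u ↔ U i u ∧ adj i u := by
  refine ⟨fun h1 => ⟨h.edge h1 ?_, h1⟩, fun h1 => h1.2⟩
  simp only [Finset.mem_insert, not_or] at hu
  by_contra! h2
  exact hu.2 (hlow u (lt_of_le_of_ne h2 hu.1) h1)

include hbd in
theorem edgeCol_insert_insert {S : Finset ℕ} (hS : S ⊆ D) (c : ℕ) :
    edgeCol n adj col (insert i D) (insert i S) c = edgeCol n adj col (insert i D) S c +
      (((Finset.range n \ insert i D).filter fun u => col u = c).filter fun u => adj i u).card := by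
  unfold edgeCol
  rw [Finset.card_filter, ← Finset.sum_add_distrib]
  refine Finset.sum_congr rfl fun u _ => ?_
  rw [degIn_insert fun h => hD (hS h)]
  simp only [show adj u i ↔ adj i u from ⟨h.symm, h.symm⟩]

variable (hDi : ∀ x ∈ D, x < i)
include hDi

theorem degOut_insert_self {s : ℕ} :
    degOut n adj col (insert i D) s i = (later n adj U col i s).card := by
  unfold degOut later
  congr 1
  ext y
  simp only [Finset.mem_filter, Finset.mem_sdiff, Finset.mem_range]
  constructor
  · rintro ⟨⟨h1, h2⟩, h3, h4⟩
    have := (adj_out_iff h hi hD hlow h2).1 h3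
    exact ⟨h1, this.1, h3, h4⟩
  · rintro ⟨h1, h2, h3, h4⟩
    refine ⟨⟨h1, fun hy => ?_⟩, h3, h4⟩
    have := (h.U_lt h2).1
    rcases Finset.mem_insert.1 hy with h5 | h5
    · omega
    · have := hDi y h5; omega

theorem filter_col_eq {s c : ℕ} (hc : dg s c ≠ 2) :
    (((Finset.range n \ insert i D).filter fun u => col u = c).filter fun u => adj i u) =
      (later n adj U col i s).filter fun u => col u = c := by
  ext u
  unfold later
  simp only [Finset.mem_filter, Finset.mem_sdiff, Finset.mem_range]
  constructor
  · rintro ⟨⟨⟨h1, h2⟩, rfl⟩, h3⟩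
    exact ⟨⟨h1, ((adj_out_iff h hi hD hlow h2).1 h3).1, h3, hc⟩, rfl⟩
  · rintro ⟨⟨h1, h2, h3, h4⟩, h5⟩
    refine ⟨⟨⟨h1, fun hy => ?_⟩, h5⟩, h3⟩
    have := (h.U_lt h2).1
    rcases Finset.mem_insert.1 hy with h5 | h5
    · omega
    · have := hDi u h5; omega

include hbd

/-- Seen from `D`, deleting `i` means that its colour carries the digit two; it costs one.
Afterwards no outside vertex of this colour meets the solution, so the new digit may be zero or two
but not one. -/
theorem keep_insert_of_notMem {S : Finset ℕ} {s k : ℕ} (hs : s < 3 ^ b) (hS : S ⊆ D) :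
    Keep n adj col b Φ (insert i D) s k S ↔ dg s (col i) ≠ 1 ∧ ¬ Φ i ∧ 1 ≤ k ∧
      Keep n adj col b Φ D (setDg s (col i) 2) (k - 1) S := by
  have hci := h.col_lt hi
  have hdg : ∀ c < b, dg (setDg s (col i) 2) c = if c = col i then 2 else dg s c :=
    fun c hc => dg_setDg hs hci (by norm_num) hc
  have hiS : i ∉ S := fun h => hD (hS h)
  have hcard : (insert i D \ S).card = (D \ S).card + 1 := by
    rw [Finset.insert_sdiff_of_notMem _ hiS, Finset.card_insert_of_notMem (by simp [hD])]
  have hout : ∀ w ∈ S, degOut n adj col D (setDg s (col i) 2) w =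
      degOut n adj col (insert i D) s w := by
    intro w hw
    rw [degOut_eq h hi hD hbd (s := s) (hS hw) fun c hc hne => by rw [hdg c hc, if_neg hne],
      hdg _ hci]
    simp
  constructor
  · intro hK
    refine ⟨fun h1 => ?_, fun h1 => hiS (hK.forced i (by simp) h1), ?_, hS, ?_, fun x hx hΦ =>
      hK.forced x (by simp [hx]) hΦ, fun w hw => ?_, fun c hc h2 => ?_⟩
    · have := hK.edge _ hci (by omega)
      rw [edgeCol_insert_self h hi hD hbd hS] at this
      omega
    · have := hK.card; omega
    · have := hK.card; omega
    · rw [hout w hw]; exact hK.deg w hw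
    · rw [hdg c hc] at h2 ⊢
      split_ifs at h2 ⊢ with hne
      · exact absurd rfl h2
      · rw [← edgeCol_insert_of_ne h hi hD hne]; exact hK.edge c hc h2
  · rintro ⟨h1, h2, h3, hK⟩
    refine ⟨hS.trans (Finset.subset_insert _ _), ?_, fun x hx hΦ => ?_, fun w hw => ?_,
      fun c hc h4 => ?_⟩
    · have := hK.card; omega
    · rcases Finset.mem_insert.1 hx with rfl | hx
      · exact absurd hΦ h2
      · exact hK.forced x hx hΦ
    · rw [← hout w hw]; exact hK.deg w hw
    · by_cases hne : c = col i
      · subst hne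
        have := dg_lt s (col i)
        rw [edgeCol_insert_self h hi hD hbd hS]
        omega
      · have h5 := hK.edge c hc
        rw [hdg c hc, if_neg hne] at h5
        rw [edgeCol_insert_of_ne h hi hD hne]
        exact h5 h4

/-- Keeping `i` in addition to `S`, where `t` is the code without the contribution of `i`. -/
theorem keep_insert_insert {S : Finset ℕ} {s t k : ℕ} (hS : S ⊆ D)
    (h2 : ∀ c < b, c ≠ col i → (dg t c = 2 ↔ dg s c = 2)) (h2i : dg t (col i) ≠ 2)
    (hst : ∀ c < b, c ≠ col i → dg s c ≠ 2 →
      dg t c + ((later n adj U col i s).filter fun u => col u = c).card = dg s c)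
    (hsum : dg t (col i) + (later n adj U col i s).card ≤ 1) (h1 : dg s (col i) ≠ 1) :
    Keep n adj col b Φ D t k S → Keep n adj col b Φ (insert i D) s k (insert i S) := by
  have hci := h.col_lt hi
  have hiS : i ∉ S := fun h => hD (hS h)
  have hsd : insert i D \ insert i S = D \ S := by
    ext x
    simp only [Finset.mem_sdiff, Finset.mem_insert]
    by_cases hx : x = i
    · subst hx; simp [hD]
    · simp [hx]
  intro hK
  have hdi : degIn adj S i = dg t (col i) := by
    rw [← edgeCol_self h hi hD hbd hS]
    exact hK.edge _ hci h2i
  refine ⟨Finset.insert_subset_insert _ hS, by rw [hsd]; exact hK.card, fun x hx hΦ => ?_,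
    fun w hw => ?_, fun c hc h3 => ?_⟩
  · rcases Finset.mem_insert.1 hx with rfl | hx
    · simp
    · exact Finset.mem_insert_of_mem (hK.forced x hx hΦ)
  · rw [degIn_insert hiS]
    rcases Finset.mem_insert.1 hw with rfl | hw
    · rw [degOut_insert_self h hi hD hlow hDi, if_neg (h.irrefl _), hdi]
      exact hsum
    · have := hK.deg w hw
      rw [degOut_eq h hi hD hbd (s := s) (hS hw) h2] at this
      simp only [h2i, ne_eq, not_false_eq_true, and_true] at this
      omega
  · rw [edgeCol_insert_insert h hi hD hbd hlow hS, filter_col_eq h hi hD hlow hDi h3]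
    by_cases hne : c = col i
    · subst hne
      rw [edgeCol_insert_self h hi hD hbd hS]
      have h4 : (later n adj U col i s).filter (fun u => col u = col i) = ∅ := by
        rw [Finset.filter_eq_empty_iff]
        intro u hu
        exact (h.col_ne (Finset.mem_filter.1 hu).2.1).symm
      have := dg_lt s (col i)
      rw [h4, Finset.card_empty]
      omega
    · rw [edgeCol_insert_of_ne h hi hD hne]
      have h5 := hK.edge c hc (by rw [ne_eq, h2 c hc hne]; exact h3)
      rw [h5]
      exact hst c hc hne h3

/-- The converse of `keep_insert_insert`. The digit of `i` in `t` is now read off from `S`, and its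
bound follows from the degree condition at `i` where it is needed. -/
theorem keep_of_insert_insert {S : Finset ℕ} {s t k : ℕ} (hS : S ⊆ D)
    (h2 : ∀ c < b, c ≠ col i → (dg t c = 2 ↔ dg s c = 2))
    (hti : dg t (col i) = degIn adj S i)
    (hst : ∀ c < b, c ≠ col i → dg s c ≠ 2 →
      dg t c + ((later n adj U col i s).filter fun u => col u = c).card = dg s c) :
    Keep n adj col b Φ (insert i D) s k (insert i S) → Keep n adj col b Φ D t k S := by
  have hci := h.col_lt hi
  have hiS : i ∉ S := fun h => hD (hS h)
  have hsd : insert i D \ insert i S = D \ S := by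
    ext x
    simp only [Finset.mem_sdiff, Finset.mem_insert]
    by_cases hx : x = i
    · subst hx; simp [hD]
    · simp [hx]
  intro hK
  refine ⟨hS, by rw [← hsd]; exact hK.card, fun x hx hΦ => ?_, fun w hw => ?_, fun c hc h3 => ?_⟩
  · have := hK.forced x (Finset.mem_insert_of_mem hx) hΦ
    exact (Finset.mem_insert.1 this).resolve_left fun h => hD (h ▸ hx)
  · have := hK.deg w (Finset.mem_insert_of_mem hw)
    rw [degIn_insert hiS] at this
    rw [degOut_eq h hi hD hbd (s := s) (hS hw) h2]
    split_ifs at this ⊢ <;> first | omega | tauto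
  · by_cases hne : c = col i
    · subst hne
      rw [edgeCol_self h hi hD hbd hS, hti]
    · rw [ne_eq, h2 c hc hne] at h3
      have := hK.edge c hc h3
      rw [edgeCol_insert_insert h hi hD hbd hlow hS, filter_col_eq h hi hD hlow hDi h3,
        edgeCol_insert_of_ne h hi hD hne, ← hst c hc hne h3] at this
      omega

/-- There are three ways to treat `i`. It is deleted; or it is kept without a surviving later
neighbour, and then it may have zero or one kept neighbour in `D`; or it is kept with exactly one
surviving later neighbour. In the last case `i` can have no kept neighbour in `D`, so its digit is
zero. Its later neighbour gets its only allowed edge from `i`, so the digit of that neighbour is one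
afterwards and zero before. Sums over `later` avoid naming this neighbour and can be evaluated by a
loop. -/
theorem val_insert {s k : ℕ} (hs : s < 3 ^ b) :
    Val n adj col b Φ (insert i D) s k ↔ dg s (col i) ≠ 1 ∧
      ((¬ Φ i ∧ 1 ≤ k ∧ Val n adj col b Φ D (setDg s (col i) 2) (k - 1)) ∨
      ((later n adj U col i s).card = 0 ∧ (Val n adj col b Φ D (setDg s (col i) 0) k ∨
        Val n adj col b Φ D (setDg s (col i) 1) k)) ∨
      ((later n adj U col i s).card = 1 ∧ ∑ j ∈ later n adj U col i s, dg s (col j) = 1 ∧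
        Val n adj col b Φ D (setDg s (col i) 0 - ∑ j ∈ later n adj U col i s, 3 ^ col j) k)) := by
  have hci := h.col_lt hi
  have hdg : ∀ d < 3, ∀ c < b, dg (setDg s (col i) d) c = if c = col i then d else dg s c :=
    fun d hd c hc => dg_setDg hs hci hd hc
  have hne : ∀ u ∈ later n adj U col i s, col u ≠ col i := fun u hu =>
    (h.col_ne (Finset.mem_filter.1 hu).2.1).symm
  -- Since the digit at `col u` is one, subtracting the power of three turns it into zero without a
  -- borrow.
  have hone : ∀ u, later n adj U col i s = {u} → dg s (col u) = 1 →
      (∀ c < b, dg (setDg s (col i) 0 - 3 ^ col u) c =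
        if c = col u then 0 else if c = col i then 0 else dg s c) ∧ col u ≠ col i := by
    intro u hu h1
    have hul : u ∈ later n adj U col i s := by simp [hu]
    have hcu := hne u hul
    have hub : col u < b := h.col_lt (Finset.mem_range.1 (Finset.mem_filter.1 hul).1)
    have h3 : dg (setDg s (col i) 0) (col u) = 1 := by
      rw [hdg 0 (by norm_num) _ hub, if_neg hcu, h1]
    refine ⟨fun c hc => ?_, hcu⟩
    rw [sub_pow_eq_setDg h3, dg_setDg (setDg_lt hs hci (by norm_num)) hub (by norm_num) hc,
      hdg 0 (by norm_num) c hc]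
  have hfil : ∀ u c, later n adj U col i s = {u} →
      ((later n adj U col i s).filter fun u => col u = c).card = if col u = c then 1 else 0 := by
    intro u c hu
    rw [hu, Finset.filter_singleton]
    split_ifs <;> simp
  constructor
  · rintro ⟨S, hK⟩
    by_cases hiS : i ∈ S
    · obtain ⟨S, hiS', rfl⟩ : ∃ S', i ∉ S' ∧ S = insert i S' :=
        ⟨S.erase i, by simp, (Finset.insert_erase hiS).symm⟩
      have hS : S ⊆ D := fun x hx => (Finset.mem_insert.1 (hK.sub (Finset.mem_insert_of_mem hx))
        ).resolve_left fun h => hiS' (h ▸ hx)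
      have hdeg := hK.deg i (by simp)
      rw [degIn_insert hiS', if_neg (h.irrefl _), degOut_insert_self h hi hD hlow hDi,
        add_zero] at hdeg
      refine ⟨fun h1 => ?_, Or.inr ?_⟩
      · have := hK.edge _ hci (by omega)
        rw [edgeCol_insert_insert h hi hD hbd hlow hS, filter_col_eq h hi hD hlow hDi
          (show dg s (col i) ≠ 2 by omega), edgeCol_insert_self h hi hD hbd hS, h1, zero_add, Finset.filter_eq_empty_iff.2,
          Finset.card_empty] at this
        · omega
        · exact fun u hu => hne u hu
      · by_cases h0 : (later n adj U col i s).card = 0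
        · left
          refine ⟨h0, ?_⟩
          have h3 : degIn adj S i < 3 := by omega
          have key : Keep n adj col b Φ D (setDg s (col i) (degIn adj S i)) k S := by
            refine keep_of_insert_insert h hi hD hbd hlow hDi hS (fun c hc hc' => ?_) ?_
              (fun c hc hc' _ => ?_) hK
            · rw [hdg _ h3 c hc, if_neg hc']
            · rw [hdg _ h3 _ hci, if_pos rfl]
            · rw [hdg _ h3 c hc, if_neg hc', Finset.card_eq_zero.1 h0]
              simp
          rcases Nat.le_one_iff_eq_zero_or_eq_one.1 (show degIn adj S i ≤ 1 by omega) with h4 | h4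
          · rw [h4] at key; exact Or.inl ⟨S, key⟩
          · rw [h4] at key; exact Or.inr ⟨S, key⟩
        · right
          have hc1 : (later n adj U col i s).card = 1 := by omega
          obtain ⟨u, hu⟩ := Finset.card_eq_one.1 hc1
          have hul : u ∈ later n adj U col i s := by simp [hu]
          have hub : col u < b := h.col_lt (Finset.mem_range.1 (Finset.mem_filter.1 hul).1)
          have hu2 : dg s (col u) ≠ 2 := (Finset.mem_filter.1 hul).2.2.2
          have h1 : dg s (col u) = 1 := by
            have := hK.edge _ hub hu2
            rw [edgeCol_insert_insert h hi hD hbd hlow hS, filter_col_eq h hi hD hlow hDi hu2,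
              hfil u _ hu, if_pos rfl] at this
            have := dg_lt s (col u)
            omega
          obtain ⟨ho, hcu⟩ := hone u hu h1
          refine ⟨hc1, by simp [hu, h1], S, ?_⟩
          rw [hu, Finset.sum_singleton]
          refine keep_of_insert_insert h hi hD hbd hlow hDi hS (fun c hc hc' => ?_) ?_
            (fun c hc hc' h5 => ?_) hK
          · rw [ho c hc, if_neg hc']
            split_ifs with h6
            · subst h6; simp [h1]
            · rfl
          · rw [ho _ hci, if_neg hcu.symm, if_pos rfl]; omega
          · rw [ho c hc, if_neg hc', hfil u c hu]
            split_ifs with h6 h7 h7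
            · rw [h6, h1]
            · exact absurd h6.symm h7
            · exact absurd h7.symm h6
            · rfl
    · have hS : S ⊆ D := fun x hx => (Finset.mem_insert.1 (hK.sub hx)).resolve_left
        fun h => hiS (h ▸ hx)
      obtain ⟨h1, h2, h3, h4⟩ := (keep_insert_of_notMem h hi hD hbd hlow hDi hs hS).1 hK
      exact ⟨h1, Or.inl ⟨h2, h3, S, h4⟩⟩
  · rintro ⟨h1, ⟨h2, h3, S, hK⟩ | ⟨h0, hK⟩ | ⟨hc1, hsum, S, hK⟩⟩
    · exact ⟨S, (keep_insert_of_notMem h hi hD hbd hlow hDi hs hK.sub).2 ⟨h1, h2, h3, hK⟩⟩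
    · obtain ⟨d, hd, S, hK⟩ : ∃ d ≤ 1, Val n adj col b Φ D (setDg s (col i) d) k := by
        rcases hK with hK | hK
        · exact ⟨0, by omega, hK⟩
        · exact ⟨1, le_rfl, hK⟩
      have h3 : d < 3 := by omega
      refine ⟨insert i S, keep_insert_insert h hi hD hbd hlow hDi hK.sub (fun c hc hc' => ?_) ?_
        (fun c hc hc' _ => ?_) ?_ h1 hK⟩
      · rw [hdg _ h3 c hc, if_neg hc']
      · rw [hdg _ h3 _ hci, if_pos rfl]; omega
      · rw [hdg _ h3 c hc, if_neg hc', Finset.card_eq_zero.1 h0]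
        simp
      · rw [hdg _ h3 _ hci, if_pos rfl]; omega
    · obtain ⟨u, hu⟩ := Finset.card_eq_one.1 hc1
      rw [hu, Finset.sum_singleton] at hsum hK
      obtain ⟨ho, hcu⟩ := hone u hu hsum
      refine ⟨insert i S, keep_insert_insert h hi hD hbd hlow hDi hK.sub (fun c hc hc' => ?_) ?_
        (fun c hc hc' _ => ?_) ?_ h1 hK⟩
      · rw [ho c hc, if_neg hc']
        split_ifs with h6
        · subst h6; simp [hsum]
        · rfl
      · rw [ho _ hci, if_neg hcu.symm, if_pos rfl]; omega
      · rw [ho c hc, if_neg hc', hfil u c hu]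
        split_ifs with h6 h7 h7
        · rw [h6, hsum]
        · exact absurd h6.symm h7
        · exact absurd h7.symm h6
        · rfl
      · rw [ho _ hci, if_neg hcu.symm, if_pos rfl]; omega

end

/-! #### The merged sets -/

/-- The default value `n` is also a later index: it acts as an artificial root into which the
vertices without later relatives are merged. -/
theorem least_gt {i : ℕ} (hi : i < n) : i < least (U i) n := by
  rcases (least_le (U i) n).lt_or_eq with h1 | h1
  · exact (h.U_lt (least_spec h1)).1
  · omega

theorem desc_lt (i : ℕ) : ∀ v, ∀ x ∈ desc n U i v, x < i := by
  induction i with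
  | zero => intro v x hx; simp [desc] at hx
  | succ i ih =>
    intro v x hx
    rw [desc] at hx
    split_ifs at hx
    · simp only [Finset.mem_insert, Finset.mem_union] at hx
      rcases hx with rfl | hx | hx
      · omega
      · have := ih _ _ hx; omega
      · have := ih _ _ hx; omega
    · have := ih _ _ hx; omega

theorem desc_disjoint {i : ℕ} (hin : i ≤ n) : ∀ {v w}, i ≤ v → i ≤ w → v ≠ w →
    Disjoint (desc n U i v) (desc n U i w) := by
  induction i with
  | zero => intro v w _ _ _; simp [desc]
  | succ i ih =>
    intro v w hv hw hvw
    have hni : ∀ v, i ∉ desc n U i v := fun v hi => absurd (desc_lt h i v i hi) (lt_irrefl i)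
    have d1 := ih (by omega) (v := v) (w := w) (by omega) (by omega) hvw
    have d2 := ih (by omega) (v := i) (w := w) (by omega) (by omega) (by omega)
    have d3 := ih (by omega) (v := v) (w := i) (by omega) (by omega) (by omega)
    rw [desc, desc]
    split_ifs with h1 h2 h2
    · omega
    · rw [Finset.disjoint_insert_left, Finset.disjoint_union_left]
      exact ⟨hni w, d1, d2⟩
    · rw [Finset.disjoint_insert_right, Finset.disjoint_union_right]
      exact ⟨hni v, d1, d3⟩
    · exact d1

/-- When `i` is processed, it moves together with everything merged into it to a later index, so no
eliminated vertex is lost. -/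
theorem desc_cover {i : ℕ} (hin : i ≤ n) : ∀ x < i, ∃ v, i ≤ v ∧ v ≤ n ∧ x ∈ desc n U i v := by
  induction i with
  | zero => intro x hx; omega
  | succ i ih =>
    intro x hx
    have hgt := least_gt h (show i < n by omega)
    have hle := least_le (U i) n
    have key : x = i ∨ x ∈ desc n U i i → ∃ v, i + 1 ≤ v ∧ v ≤ n ∧ x ∈ desc n U (i + 1) v := by
      intro hx
      refine ⟨least (U i) n, hgt, hle, ?_⟩
      rw [desc, if_pos rfl]
      simp only [Finset.mem_insert, Finset.mem_union]
      tauto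
    rcases Nat.lt_succ_iff_lt_or_eq.1 hx with h1 | h1
    · obtain ⟨v, hv, hvn, hxv⟩ := ih (by omega) x h1
      rcases hv.lt_or_eq with h2 | rfl
      · refine ⟨v, h2, hvn, ?_⟩
        rw [desc]
        split_ifs
        · simp [hxv]
        · exact hxv
      · exact key (Or.inr hxv)
    · exact key (Or.inl h1)

/-- The invariant that keeps tables small. When `i` is merged into its first later relative `v`, its
other later relatives become relatives of `v` by `trans`. An earlier neighbour of `i` already
belongs to the set of `i`: wherever it has been merged, the invariant for that set, applied to the
edge to `i`, excludes every other place. -/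
theorem desc_boundary {i : ℕ} (hin : i ≤ n) : ∀ {v}, i ≤ v → ∀ x ∈ desc n U i v, ∀ y, adj x y →
    y ∉ desc n U i v → y = v ∨ U v y := by
  induction i with
  | zero => intro v _ x hx; simp [desc] at hx
  | succ i ih =>
    intro v hv x hx y hxy hy
    rw [desc] at hx hy
    split_ifs at hx hy with h1
    · have hU : U i y → y = v ∨ U v y := by
        intro hUy
        have hle : v ≤ y := h1 ▸ least_le_of hUy
        have hyn := (h.U_lt hUy).2
        have hUv : U i v := h1 ▸ least_spec (least_lt hUy hyn)
        rcases hle.lt_or_eq with h2 | h2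
        · exact Or.inr (h.trans hUv hUy h2)
        · exact Or.inl h2.symm
      simp only [Finset.mem_insert, Finset.mem_union, not_or] at hx hy
      rcases hx with rfl | hx | hx
      · rcases lt_trichotomy y x with h2 | h2 | h2
        · obtain ⟨w, hw, hwn, hyw⟩ := desc_cover h (show x ≤ n by omega) y h2
          have hxw : x ∉ desc n U x w := fun h3 => absurd (desc_lt h x w x h3) (lt_irrefl x)
          rcases ih (by omega) hw y hyw x (h.symm hxy) hxw with rfl | h3
          · exact absurd hyw hy.2.2
          · have := (h.U_lt h3).1; omega
        · exact absurd h2 hy.1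
        · exact hU (h.edge hxy h2)
      · exact ih (by omega) (by omega) x hx y hxy hy.2.1
      · rcases ih (by omega) le_rfl x hx y hxy hy.2.2 with h3 | h3
        · exact absurd h3 hy.1
        · exact hU h3
    · exact ih (by omega) (by omega) x hx y hxy hy

theorem desc_low {i : ℕ} (hin : i ≤ n) : ∀ y < i, adj i y → y ∈ desc n U i i := by
  intro y hy hadj
  obtain ⟨w, hw, hwn, hyw⟩ := desc_cover h hin y hy
  have hxw : i ∉ desc n U i w := fun h3 => absurd (desc_lt h i w i h3) (lt_irrefl i)
  rcases desc_boundary h hin hw y hyw i (h.symm hadj) hxw with rfl | h3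
  · exact hyw
  · have := (h.U_lt h3).1; omega

theorem desc_last : desc n U n n = Finset.range n := by
  ext x
  rw [Finset.mem_range]
  refine ⟨desc_lt h n n x, fun hx => ?_⟩
  obtain ⟨v, h1, h2, h3⟩ := desc_cover h le_rfl x hx
  obtain rfl : v = n := by omega
  exact h3

theorem desc_succ_of_ne {i v : ℕ} (hv : v ≠ least (U i) n) :
    desc n U (i + 1) v = desc n U i v := by rw [desc, if_neg hv]

/-- The table of the parent of `i` is merged with the one obtained by eliminating `i`. -/
theorem val_desc_succ {i s k : ℕ} (hin : i < n) :
    Val n adj col b Φ (desc n U (i + 1) (least (U i) n)) s k ↔ ∃ a < 3 ^ b, ∃ a' < 3 ^ b,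
      (∀ c < b, Comb (dg a c) (dg a' c) (dg s c)) ∧ ∃ k₁ k₂, k₁ + k₂ = k ∧
        Val n adj col b Φ (desc n U i (least (U i) n)) a k₁ ∧
        Val n adj col b Φ (insert i (desc n U i i)) a' k₂ := by
  have hgt := least_gt h hin
  have hni : ∀ v, i ∉ desc n U i v := fun v hi => absurd (desc_lt h i v i hi) (lt_irrefl i)
  rw [desc, if_pos rfl, ← Finset.union_insert]
  have hd := desc_disjoint h hin.le (hgt.le) le_rfl (by omega : least (U i) n ≠ i)
  refine val_union h.symm h.col_lt ?_ fun x hx y hy hxy => ?_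
  · rw [Finset.disjoint_insert_right]; exact ⟨hni _, hd⟩
  · have hyn : y ∉ desc n U i (least (U i) n) := by
      rcases Finset.mem_insert.1 hy with rfl | hy
      · exact hni _
      · exact Finset.disjoint_right.1 hd hy
    -- By the boundary property, an edge leaving the set of the parent ends at the parent or beyond,
    -- hence after `i`; the set to be merged contains no such vertex.
    have hyi : y ≤ i := by
      rcases Finset.mem_insert.1 hy with rfl | hy
      · exact le_rfl
      · exact (desc_lt h _ _ _ hy).le
    rcases desc_boundary h hin.le hgt.le x hx y hxy hyn with h1 | h1
    · omega
    · have := (h.U_lt h1).1; omega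

theorem val_insert_desc {i s k : ℕ} (hi : i < n) (hs : s < 3 ^ b) :
    Val n adj col b Φ (insert i (desc n U i i)) s k ↔ dg s (col i) ≠ 1 ∧
      ((¬ Φ i ∧ 1 ≤ k ∧ Val n adj col b Φ (desc n U i i) (setDg s (col i) 2) (k - 1)) ∨
      ((later n adj U col i s).card = 0 ∧ (Val n adj col b Φ (desc n U i i) (setDg s (col i) 0) k ∨
        Val n adj col b Φ (desc n U i i) (setDg s (col i) 1) k)) ∨
      ((later n adj U col i s).card = 1 ∧ ∑ j ∈ later n adj U col i s, dg s (col j) = 1 ∧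
        Val n adj col b Φ (desc n U i i)
          (setDg s (col i) 0 - ∑ j ∈ later n adj U col i s, 3 ^ col j) k)) :=
  val_insert h hi (fun h1 => absurd (desc_lt h i i i h1) (lt_irrefl i))
    (desc_boundary h hi.le le_rfl) (desc_low h hi.le) (desc_lt h i i) hs

-- At the artificial root no vertex is left outside, so all outside counts vanish and the code zero
-- imposes no condition.
omit h in
theorem val_range {k : ℕ} : Val n adj col b Φ (Finset.range n) 0 k ↔ ∃ S ⊆ Finset.range n,
    (Finset.range n \ S).card = k ∧ (∀ x < n, Φ x → x ∈ S) ∧ ∀ w ∈ S, degIn adj S w ≤ 1 := by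
  have h1 : ∀ w, degOut n adj col (Finset.range n) 0 w = 0 := fun w => by simp [degOut]
  have h2 : ∀ S c, edgeCol n adj col (Finset.range n) S c = 0 := fun S c => by simp [edgeCol]
  constructor
  · rintro ⟨S, hS⟩
    exact ⟨S, hS.sub, hS.card, fun x hx => hS.forced x (Finset.mem_range.2 hx),
      fun w hw => by simpa [h1] using hS.deg w hw⟩
  · rintro ⟨S, h3, h4, h5, h6⟩
    exact ⟨S, h3, h4, fun x hx => h5 x (Finset.mem_range.1 hx), fun w hw => by
      simpa [h1] using h6 w hw, fun c _ _ => by rw [h2]; simp [dg]⟩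

end

end ElimOrder

/-! ### Top nodes of a tree decomposition -/

namespace TreeDecomposition

open SimpleGraph

variable {V I : Type*} {G : SimpleGraph V} (D : TreeDecomposition G I)

noncomputable def rootPath (i : I) : D.tree.Walk i D.root :=
  (D.isTree.existsUnique_path i D.root).choose

theorem rootPath_isPath (i : I) : (D.rootPath i).IsPath :=
  (D.isTree.existsUnique_path i D.root).choose_spec.1

theorem eq_rootPath {i : I} {q : D.tree.Walk i D.root} (hq : q.IsPath) : q = D.rootPath i :=
  (D.isTree.existsUnique_path i D.root).choose_spec.2 q hq

theorem parent_eq (i : I) : D.parent i = (D.rootPath i).snd := rfl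

theorem parent_root : D.parent D.root = D.root := by
  rw [parent_eq, ← D.eq_rootPath (q := Walk.nil) (by simp)]
  rfl

noncomputable def depth (i : I) : ℕ := (D.rootPath i).length

theorem depth_parent {i : I} (hi : i ≠ D.root) : D.depth (D.parent i) + 1 = D.depth i := by
  unfold depth
  rw [parent_eq]
  have hp := D.rootPath_isPath i
  generalize D.rootPath i = p at hp
  cases p with
  | nil => exact absurd rfl hi
  | cons h q =>
    rw [Walk.cons_isPath_iff] at hp
    rw [Walk.snd_cons, ← D.eq_rootPath hp.1, Walk.length_cons]

/-- Uniqueness of paths: if `j` lies on the root path of `i`, the edge is the initial segment of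
that path; otherwise prefixing the edge gives the root path of `j`. -/
theorem adj_parent {i j : I} (h : D.tree.Adj i j) : D.parent i = j ∨ D.parent j = i := by
  classical
  by_cases hj : j ∈ (D.rootPath i).support
  · left
    have h1 : (D.rootPath i).takeUntil j hj = Walk.cons h Walk.nil := by
      have h2 := (D.rootPath_isPath i).takeUntil hj
      have h3 : (Walk.cons h Walk.nil : D.tree.Walk i j).IsPath := by
        simp [Walk.cons_isPath_iff, h.ne]
      exact congrArg Subtype.val
        ((D.isTree.isAcyclic.subsingleton_path i j).elim ⟨_, h2⟩ ⟨_, h3⟩)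
    rw [parent_eq, ← (D.rootPath i).take_spec hj, h1]
    simp
  · right
    have h1 : (Walk.cons h.symm (D.rootPath i)).IsPath :=
      (Walk.cons_isPath_iff _ _).2 ⟨D.rootPath_isPath i, hj⟩
    rw [parent_eq, ← D.eq_rootPath h1, Walk.snd_cons]

/-- A path in a rooted tree goes up first and then down. If its first step is not upwards, it only
descends, and so it enters its end from the parent of the end. -/
theorem parent_mem_path {i k : I} (q : D.tree.Walk i k) : q.IsPath → i ≠ k →
    D.parent i = q.snd ∨ (D.parent k ∈ q.support ∧ k ≠ D.root) := by
  induction q with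
  | nil => intro _ h; exact absurd rfl h
  | @cons i j k h q ih =>
    intro hq hik
    rw [Walk.cons_isPath_iff] at hq
    rw [Walk.snd_cons]
    rcases D.adj_parent h with h1 | h1
    · exact Or.inl h1
    by_cases hjk : j = k
    · subst hjk
      refine Or.inr ⟨by simp [h1], fun hr => hik ?_⟩
      rw [← h1, hr, parent_root]
    · rcases ih hq.1 hjk with h2 | h2
      · exact absurd (h1 ▸ h2 ▸ Walk.getVert_mem_support q 1) hq.2
      · exact Or.inr ⟨by simp [h2.1], h2.2⟩

/-- `i` is the node closest to the root whose bag contains `v`. -/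
def IsTop (v : V) (i : I) : Prop := v ∈ D.bag i ∧ (i = D.root ∨ v ∉ D.bag (D.parent i))

theorem isTop_unique {v : V} {i k : I} (hi : D.IsTop v i) (hk : D.IsTop v k) : i = k := by
  by_contra hik
  obtain ⟨q, hq, -⟩ := D.isTree.existsUnique_path i k
  have hmem : ∀ j ∈ q.support, v ∈ D.bag j := fun j hj =>
    D.mem_bag_of_path i k q hq j hj v hi.1 hk.1
  rcases D.parent_mem_path q hq hik with h | ⟨h, hr⟩
  · rcases hi.2 with h1 | h1
    · have hadj := Walk.adj_snd (p := q) (Walk.not_nil_of_ne hik)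
      rw [← h, h1, parent_root] at hadj
      exact D.tree.loopless.irrefl _ hadj
    · exact h1 (h ▸ hmem _ (Walk.getVert_mem_support q 1))
  · exact (hk.2.resolve_left hr) (hmem _ h)

theorem exists_isTop_iterate {v : V} (i : I) (hi : v ∈ D.bag i) :
    ∃ k, D.IsTop v (D.parent^[k] i) ∧ ∀ j ≤ k, v ∈ D.bag (D.parent^[j] i) := by
  induction h : D.depth i generalizing i with
  | zero =>
    refine ⟨0, ⟨hi, Or.inl ?_⟩, fun j hj => ?_⟩
    · by_contra hr
      have := D.depth_parent (i := i) hr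
      omega
    · obtain rfl : j = 0 := by omega
      exact hi
  | succ d ih =>
    by_cases ht : D.IsTop v i
    · refine ⟨0, ht, fun j hj => ?_⟩
      obtain rfl : j = 0 := by omega
      exact hi
    · simp only [IsTop, not_and_or, not_or, not_not] at ht
      have ht := ht.resolve_left (not_not.2 hi)
      have hd := D.depth_parent ht.1
      obtain ⟨k, h1, h2⟩ := ih (D.parent i) ht.2 (by omega)
      refine ⟨k + 1, h1, fun j hj => ?_⟩
      cases j with
      | zero => exact hi
      | succ j => exact h2 j (by omega)

theorem exists_isTop (v : V) : ∃ i, D.IsTop v i := by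
  obtain ⟨i, hi⟩ := D.exists_mem_bag v
  obtain ⟨k, hk, -⟩ := D.exists_isTop_iterate i hi
  exact ⟨_, hk⟩

noncomputable def top (v : V) : I := (D.exists_isTop v).choose

theorem isTop_top (v : V) : D.IsTop v (D.top v) := (D.exists_isTop v).choose_spec

theorem mem_bag_top (v : V) : v ∈ D.bag (D.top v) := (D.isTop_top v).1

theorem exists_iterate_eq_top {v : V} {i : I} (hi : v ∈ D.bag i) :
    ∃ k, D.parent^[k] i = D.top v ∧ ∀ j ≤ k, v ∈ D.bag (D.parent^[j] i) := by
  obtain ⟨k, h1, h2⟩ := D.exists_isTop_iterate i hi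
  exact ⟨k, D.isTop_unique h1 (D.isTop_top v), h2⟩

/-- Climb from the common bag towards the root. When the first of the two tops is reached, the other
vertex is still present. -/
theorem mem_bag_top_or {u v : V} {i : I} (hu : u ∈ D.bag i) (hv : v ∈ D.bag i) :
    u ∈ D.bag (D.top v) ∨ v ∈ D.bag (D.top u) := by
  obtain ⟨k, h1, h2⟩ := D.exists_iterate_eq_top hu
  obtain ⟨l, h3, h4⟩ := D.exists_iterate_eq_top hv
  rcases le_total k l with h | h
  · exact Or.inr (h1 ▸ h4 k h)
  · exact Or.inl (h3 ▸ h2 l h)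

theorem iterate_parent_eq {i : I} (k : ℕ) (h : D.depth i ≤ D.depth (D.parent^[k] i)) :
    D.parent^[k] i = i := by
  by_cases hi : i = D.root
  · subst hi
    exact Function.iterate_fixed D.parent_root k
  cases k with
  | zero => rfl
  | succ k =>
    have hle : ∀ k i, D.depth (D.parent^[k] i) ≤ D.depth i := by
      intro k
      induction k with
      | zero => intro i; exact le_rfl
      | succ k ih =>
        intro i
        refine (ih (D.parent i)).trans ?_
        by_cases hi : i = D.root
        · rw [hi, parent_root]
        · have := D.depth_parent hi; omega
    have h1 := hle k (D.parent i)
    have h2 := D.depth_parent hi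
    rw [Function.iterate_succ_apply] at h
    omega

/-- Among any set of vertices, one can be eliminated. -/
theorem exists_simplicial {W : Finset V} (hW : W.Nonempty) :
    ∃ v ∈ W, ∀ w ∈ W, v ∈ D.bag (D.top w) → w ∈ D.bag (D.top v) := by
  -- Take `v` with deepest top. If `v` lies in the bag of the top of `w`, then the top of `v` is an
  -- ancestor of that node and no less deep, so the two tops coincide.
  obtain ⟨v, hv, hmax⟩ := W.exists_max_image (fun v => D.depth (D.top v)) hW
  refine ⟨v, hv, fun w hw h => ?_⟩
  obtain ⟨k, h1, -⟩ := D.exists_iterate_eq_top h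
  have h2 := hmax w hw
  rw [← h1] at h2
  rw [← h1, D.iterate_parent_eq k h2]
  exact D.mem_bag_top w

end TreeDecomposition

/-! ### Reading the input -/

namespace VCP

open RAM

set_option linter.unusedSectionVars false

/-- The scalar variables of the program. -/
inductive Nm where
  | n | m | root | n1 | n2 | t | ptr | card | par | b | b1 | S | R | L | SL | BSL | ST | TT
  | K | K0 | q | i | j | z | u | w | x | y
  deriving DecidableEq

/-- The arrays of the program. -/
inductive Ar where
  | adj | mem | top | rel | ord | padj | up | colr | col | pw | ones | pi | fs | tab | za | zb | prod
  deriving DecidableEq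

instance : Fintype Nm where
  elems := {.n, .m, .root, .n1, .n2, .t, .ptr, .card, .par, .b, .b1, .S, .R, .L, .SL, .BSL, .ST,
    .TT, .K, .K0, .q, .i, .j, .z, .u, .w, .x, .y}
  complete r := by cases r <;> decide

instance : Fintype Ar where
  elems := {.adj, .mem, .top, .rel, .ord, .padj, .up, .colr, .col, .pw, .ones, .pi, .fs, .tab,
    .za, .zb, .prod}
  complete r := by cases r <;> decide

abbrev E := Ex Nm Ar
abbrev Pr := Hl Nm Ar
abbrev vr (r : Nm) : E := .var r
abbrev nt (k : ℕ) : E := .lit k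
abbrev gt (a : Ar) (i : E) : E := .get a i

/-- Read the sizes. -/
def header : Pr :=
  .seq (.inp .n (nt 0)) <| .seq (.inp .m (nt 1)) <| .seq (.inp .root (nt 2)) <|
  .seq (.set .n1 (vr .n + nt 1)) (.set .n2 (vr .n * vr .n))

/-- Copy the adjacency matrix. -/
def copyAdj : Pr :=
  .rep .z .n2 <| .seq (.inp .t (nt 3 + vr .z)) (.put .adj (vr .z) (vr .t))

/-- Mark the elements of the bags. -/
def scan : Pr :=
  .seq (.set .ptr (nt 3 + vr .n2 + vr .m)) <| .rep .i .m <|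
    .seq (.inp .card (vr .ptr)) <|
    .seq (.rep .j .card <| .seq (.inp .t (vr .ptr + nt 1 + vr .j)) <|
      .put .mem (vr .i * vr .n + vr .t) (nt 1)) <|
    .set .ptr (vr .ptr + (vr .card + nt 1))

/-- Find the node closest to the root whose bag contains a given vertex. -/
def scanTop : Pr :=
  .seq (.set .ptr (nt 3 + vr .n2 + vr .m)) <| .rep .i .m <|
    .seq (.inp .card (vr .ptr)) <|
    .seq (.inp .par (nt 3 + vr .n2 + vr .i)) <|
    .seq (.rep .j .card <| .seq (.inp .t (vr .ptr + nt 1 + vr .j)) <|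
      .seq (.set .x (.isz (.isz (.eqI (vr .i) (vr .root) +
        .isz (gt .mem (vr .par * vr .n + vr .t)))))) <|
      .put .top (vr .t) (vr .x * vr .i + (nt 1 - vr .x) * gt .top (vr .t))) <|
    .set .ptr (vr .ptr + (vr .card + nt 1))

/-- The position of the bag of node `i` behind the parents. -/
def off (card : ℕ → ℕ) (i : ℕ) : ℕ := ∑ l ∈ Finset.range i, (card l + 1)

/-- The layout of the input: adjacency matrix `A`, parents `par`, and bags with `card i` elements
`el i j`. -/
structure Layout (io : ℕ → ℕ) (n m : ℕ) (A par card : ℕ → ℕ) (el : ℕ → ℕ → ℕ) : Prop where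
  adj_eq : ∀ z < n * n, io (3 + z) = A z
  par_eq : ∀ i < m, io (3 + n * n + i) = par i
  card_eq : ∀ i < m, io (3 + n * n + m + off card i) = card i
  el_eq : ∀ i < m, ∀ j < card i, io (3 + n * n + m + off card i + 1 + j) = el i j
  par_lt : ∀ i < m, par i < m
  el_lt : ∀ i < m, ∀ j < card i, el i j < n
  adj_le : ∀ z < n * n, A z ≤ 1

theorem off_succ (card : ℕ → ℕ) (i : ℕ) : off card (i + 1) = off card i + (card i + 1) :=
  Finset.sum_range_succ _ _

theorem off_mono {card : ℕ → ℕ} {i j : ℕ} (h : i ≤ j) : off card i ≤ off card j :=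
  Finset.sum_le_sum_of_subset (Finset.range_mono h)

theorem off_lt {card : ℕ → ℕ} {i m : ℕ} (h : i < m) : off card i + card i + 1 ≤ off card m := by
  have := off_succ card i
  have := off_mono (card := card) (show i + 1 ≤ m from h)
  omega

theorem pair_inj {n i i' u v : ℕ} (hu : u < n) (hv : v < n) :
    i * n + u = i' * n + v ↔ i = i' ∧ u = v := by
  refine ⟨fun h => ?_, by rintro ⟨rfl, rfl⟩; rfl⟩
  have hn : 0 < n := by omega
  have h1 := congrArg (· / n) h
  have h2 := congrArg (· % n) h
  simp only [Nat.mul_add_mod', Nat.mod_eq_of_lt hu, Nat.mod_eq_of_lt hv] at h2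
  simp only [mul_comm _ n, Nat.mul_add_div hn, Nat.div_eq_of_lt hu, Nat.div_eq_of_lt hv] at h1
  exact ⟨by omega, h2⟩

theorem pair_lt {n m i u : ℕ} (hi : i < m) (hu : u < n) : i * n + u < m * n := by
  have : (i + 1) * n ≤ m * n := Nat.mul_le_mul_right n hi
  rw [add_mul] at this
  omega

section
variable {B N n m root : ℕ} {A par card : ℕ → ℕ} {el : ℕ → ℕ → ℕ} {σ : St Nm Ar}

theorem copyAdj_spec (hn2 : σ.v .n2 = n * n) (hl : Layout σ.io n m A par card el)
    (hN : 3 + n * n ≤ N) (hB : 1 ≤ B) :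
    Tri B N copyAdj σ (1 + n * n * 3) fun τ => ∀ z < n * n, τ.a .adj z = A z := by
  refine Tri.rep (fun i τ => τ.io = σ.io ∧ ∀ z < i, τ.a .adj z = A z) (fun _ => 2)
    ⟨rfl, fun z hz => absurd hz (by omega)⟩ ?_ ?_ ?_
  · rintro z hz τ - ⟨hio, hA⟩
    rw [hn2] at hz
    refine Tri.seq (T₁ := 1) (T₂ := 1) (Tri.inp ?_ (by simp) (Tri.put ?_ (by simp) ⟨hio, ?_⟩)) le_rfl
    · simp; omega
    · simpa [hio, hl.adj_eq z hz] using (hl.adj_le z hz).trans hB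
    · intro y hy
      by_cases hyz : y = z
      · subst hyz; simp [hio, hl.adj_eq y hz]
      · simpa [hyz] using hA y (by omega)
  · simp [hn2]
  · rintro τ - ⟨-, h⟩ z hz
    simpa using h z (by omega)

variable (hn : σ.v .n = n) (hm : σ.v .m = m) (hn2 : σ.v .n2 = n * n)
  (hl : Layout σ.io n m A par card el) (hN : 3 + n * n + m + off card m ≤ N)
  (hB : 3 + n * n + m + off card m ≤ B)
include hn hm hn2 hl hN hB

open Classical in
theorem scan_spec (h0 : ∀ i, σ.a .mem i = 0) :
    Tri B N scan σ (5 + 5 * off card m) fun τ => ∀ i < m, ∀ v < n,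
      τ.a .mem (i * n + v) = if ∃ j < card i, el i j = v then 1 else 0 := by
  refine Tri.seq (T₁ := 1) (T₂ := 1 + 5 * off card m) ?_ (by omega)
  refine Tri.set (by simp [hn2, hm]; omega) (by simp) ?_
  refine Tri.rep (fun i τ => τ.io = σ.io ∧ τ.v .ptr = 3 + n * n + m + off card i ∧
      ∀ i' < m, ∀ v < n, τ.a .mem (i' * n + v) =
        if i' < i ∧ ∃ j < card i', el i' j = v then 1 else 0)
    (fun i => 3 + card i * 3) ⟨rfl, by simp [hn2, hm, off], by simp [h0]⟩ ?_ ?_ ?_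
  · rintro i hi τ hf ⟨hio, hptr, hmem⟩
    replace hi : i < m := by simpa [hm] using hi
    have hoff := off_lt (card := card) hi
    have hcard := hl.card_eq i hi
    have hτn : τ.v .n = n := (hf.v .n (by decide)).trans (by simpa using hn)
    refine Tri.seq (T₁ := 1) (T₂ := 2 + card i * 3) (Tri.inp ?_ (by simp) ?_) (by omega)
    · simp [hptr]; omega
    refine Tri.seq (T₁ := 1 + card i * 3) (T₂ := 1) ?_ (by omega)
    -- Within bag `i` the marks are those of all earlier bags together with the first `j` elements
    -- of this one.
    refine Tri.rep (fun j τ' => τ'.io = σ.io ∧ ∀ i' < m, ∀ v < n, τ'.a .mem (i' * n + v) =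
        if (i' < i ∧ ∃ j < card i', el i' j = v) ∨ (i' = i ∧ ∃ j' < j, el i j' = v) then 1 else 0)
      (fun _ => 2) ⟨hio, fun i' hi' v hv => ?_⟩ ?_ ?_ ?_
    · simpa using hmem i' hi' v hv
    · rintro j hj τ' hf' ⟨hio', hmem'⟩
      replace hj : j < card i := by simpa [hptr, hio, hcard] using hj
      have hptr' : τ'.v .ptr = 3 + n * n + m + off card i :=
        (hf'.v .ptr (by decide)).trans (by simpa using hptr)
      have hn' : τ'.v .n = n := (hf'.v .n (by decide)).trans (by simpa using hτn)
      have hi' : τ'.v .i = i := (hf'.v .i (by decide)).trans (by simp)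
      have hel := hl.el_eq i hi j hj
      have hlt := hl.el_lt i hi j hj
      refine Tri.seq (T₁ := 1) (T₂ := 1) (Tri.inp ?_ (by simp) (Tri.put ?_ (by simp)
        ⟨hio', ?_⟩)) le_rfl
      · simp [hptr']; omega
      · simp; omega
      · intro i'' hi'' v hv
        have e1 := pair_inj (i := i'') (i' := i) hv hlt
        simp only [St.setv_io, hio', St.seta_a, Function.update_self, Ex.eval_add, Ex.eval_mul,
          Ex.eval_var, Ex.eval_lit, St.setv_v, St.setv_a, hptr', hel, ne_eq, reduceCtorEq,
          not_false_eq_true, Function.update_of_ne, hi', hn', Function.update_apply, e1]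
        rw [hmem' i'' hi'' v hv]
        by_cases h1 : i'' = i ∧ v = el i j
        · rw [if_pos h1, if_pos]
          exact Or.inr ⟨h1.1, j, by omega, h1.2.symm⟩
        · rw [if_neg h1]
          congr 1
          rw [eq_iff_iff]
          refine or_congr_right (and_congr_right fun h2 => ?_)
          constructor
          · rintro ⟨j', hj', h⟩; exact ⟨j', by omega, h⟩
          · rintro ⟨j', hj', h⟩
            refine ⟨j', lt_of_le_of_ne (by omega) ?_, h⟩
            rintro rfl
            exact h1 ⟨h2, h.symm⟩
    · simp [hptr, hio, hcard]
    · rintro τ' hf' ⟨hio', hmem'⟩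
      have hptr' : τ'.v .ptr = 3 + n * n + m + off card i :=
        (hf'.v .ptr (by decide)).trans (by simpa using hptr)
      have hcard' : τ'.v .card = card i :=
        (hf'.v .card (by decide)).trans (by simp [hptr, hio, hcard])
      have := off_succ card i
      refine Tri.set ?_ (by simp) ⟨hio', ?_, fun i' hi' v hv => ?_⟩
      · simp [hptr', hcard']; omega
      · simp [hptr', hcard']; omega
      · simp only [St.setv_a, hmem' i' hi' v hv]
        congr 1
        simp only [St.setv_v, Ex.eval_var, Function.update_self, eq_iff_iff, St.setv_io, hio,
          ne_eq, reduceCtorEq, not_false_eq_true, Function.update_of_ne, hptr, hcard]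
        constructor
        · rintro (⟨h1, h2⟩ | ⟨rfl, h2⟩)
          · exact ⟨by omega, h2⟩
          · exact ⟨by omega, h2⟩
        · rintro ⟨h1, h2⟩
          rcases Nat.lt_succ_iff_lt_or_eq.1 h1 with h3 | rfl
          · exact Or.inl ⟨h3, h2⟩
          · exact Or.inr ⟨rfl, h2⟩
  · simp only [St.setv_v, ne_eq, reduceCtorEq, not_false_eq_true, Function.update_of_ne, hm]
    refine Nat.add_le_add_left ?_ 1
    rw [off, Finset.mul_sum]
    exact Finset.sum_le_sum fun i _ => by omega
  · rintro τ - ⟨-, -, h⟩ i hi v hv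
    have := h i hi v hv
    simp only [St.setv_v, ne_eq, reduceCtorEq, not_false_eq_true, Function.update_of_ne, hm, hi,
      true_and] at this
    simpa using this

-- The array is written only at top nodes, and by `huniq` no other node can overwrite a correct
-- entry. Other encounters write back the old value, since the language has no branches.
set_option maxHeartbeats 800000 in
open Classical in
theorem scanTop_spec (hroot : σ.v .root = root)
    (hmem : ∀ i < m, ∀ v < n, σ.a .mem (i * n + v) = if ∃ j < card i, el i j = v then 1 else 0)
    (huniq : ∀ v < n, ∀ i < m, ∀ i' < m, (∃ j < card i, el i j = v) →
      (i = root ∨ ¬ ∃ j < card (par i), el (par i) j = v) → (∃ j < card i', el i' j = v) →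
      (i' = root ∨ ¬ ∃ j < card (par i'), el (par i') j = v) → i = i') (hB1 : ∀ v, σ.a .top v ≤ m) :
    Tri B N scanTop σ (5 + 9 * off card m) fun τ => ∀ v < n, ∀ i < m,
      (∃ j < card i, el i j = v) → (i = root ∨ ¬ ∃ j < card (par i), el (par i) j = v) →
      τ.a .top v = i := by
  set Top : ℕ → ℕ → Prop := fun i v => (∃ j < card i, el i j = v) ∧
    (i = root ∨ ¬ ∃ j < card (par i), el (par i) j = v) with hTop
  refine Tri.seq (T₁ := 1) (T₂ := 1 + 9 * off card m) ?_ (by omega)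
  refine Tri.set (by simp [hn2, hm]; omega) (by simp) ?_
  refine Tri.rep (fun i τ => τ.io = σ.io ∧ τ.v .ptr = 3 + n * n + m + off card i ∧
      (∀ v, τ.a .top v ≤ m) ∧ ∀ v < n, ∀ i' < i, Top i' v → τ.a .top v = i')
    (fun i => 4 + card i * 4) ⟨rfl, by simp [hn2, hm, off], by simpa using hB1, by simp⟩ ?_ ?_ ?_
  · rintro i hi τ hf ⟨hio, hptr, hle, htop⟩
    replace hi : i < m := by simpa [hm] using hi
    have hoff := off_lt (card := card) hi
    have hcard := hl.card_eq i hi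
    have hpar := hl.par_eq i hi
    have hτn : τ.v .n = n := (hf.v .n (by decide)).trans (by simpa using hn)
    have hτn2 : τ.v .n2 = n * n := (hf.v .n2 (by decide)).trans (by simpa using hn2)
    have hτr : τ.v .root = root := (hf.v .root (by decide)).trans (by simpa using hroot)
    have hτm : τ.a .mem = σ.a .mem := (hf.a .mem (by decide)).trans (by simp)
    refine Tri.seq (T₁ := 1) (T₂ := 3 + card i * 4) (Tri.inp ?_ (by simp) ?_) (by omega)
    · simp [hptr]; omega
    refine Tri.seq (T₁ := 1) (T₂ := 2 + card i * 4) (Tri.inp ?_ (by simp) ?_) (by omega)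
    · simp [hτn2]; omega
    refine Tri.seq (T₁ := 1 + card i * 4) (T₂ := 1) ?_ (by omega)
    refine Tri.rep (fun j τ' => τ'.io = σ.io ∧ (∀ v, τ'.a .top v ≤ m) ∧
        ∀ v < n, ∀ i' < m, ((i' < i ∧ Top i' v) ∨ (i' = i ∧ Top i' v ∧ ∃ j' < j, el i j' = v)) →
          τ'.a .top v = i')
      (fun _ => 3) ⟨hio, hle, fun v hv i' hi' h => ?_⟩ ?_ ?_ ?_
    · rcases h with h | h
      · exact htop v hv i' h.1 h.2
      · obtain ⟨j', hj', -⟩ := h.2.2; omega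
    · rintro j hj τ' hf' ⟨hio', hle', htop'⟩
      replace hj : j < card i := by simpa [hptr, hio, hcard] using hj
      have hptr' : τ'.v .ptr = 3 + n * n + m + off card i :=
        (hf'.v .ptr (by decide)).trans (by simpa using hptr)
      have hpar' : τ'.v .par = par i :=
        (hf'.v .par (by decide)).trans (by simp [hτn2, hio, hpar])
      have hn' : τ'.v .n = n := (hf'.v .n (by decide)).trans (by simpa using hτn)
      have hr' : τ'.v .root = root := (hf'.v .root (by decide)).trans (by simpa using hτr)
      have hm' : τ'.a .mem = σ.a .mem := (hf'.a .mem (by decide)).trans (by simpa using hτm)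
      have hi' : τ'.v .i = i := (hf'.v .i (by decide)).trans (by simp)
      have hel := hl.el_eq i hi j hj
      have hlt := hl.el_lt i hi j hj
      have hpm := hmem (par i) (hl.par_lt i hi) (el i j) hlt
      -- A sum of truth values followed by a double zero test is their disjunction.
      have hx : (Ex.isz (.isz (.eqI (vr .i) (vr .root) +
          .isz (gt .mem (vr .par * vr .n + vr .t))))).eval
          ((τ'.setv .j j).setv .t (el i j)) = if Top i (el i j) then 1 else 0 := by
        have h1 : ∃ j' < card i, el i j' = el i j := ⟨j, hj, rfl⟩
        simp only [Ex.eval_isz, Ex.eval_add, Ex.eval_eqI, Ex.eval_var, St.setv_v, ne_eq,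
          reduceCtorEq, not_false_eq_true, Function.update_of_ne, hi', hr', Ex.eval_get,
          St.setv_a, hm', Ex.eval_mul, hpar', hn', Function.update_self, hpm, hTop, h1, true_and]
        by_cases h2 : i = root <;>
          by_cases h3 : ∃ j' < card (par i), el (par i) j' = el i j <;> simp [h2, h3]
      have hioj : ((τ'.setv .j j).io ((vr .ptr + nt 1 + vr .j).eval (τ'.setv .j j))) = el i j := by
        simp [hio', hptr', hel]
      refine Tri.seq (T₁ := 1) (T₂ := 2) (Tri.inp ?_ (by simp) ?_) le_rfl
      · simp [hptr']; omega
      rw [hioj]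
      refine Tri.seq (T₁ := 1) (T₂ := 1) (Tri.set ?_ (by simp) ?_) le_rfl
      · rw [hx]; split_ifs <;> omega
      rw [hx]
      have hval : (vr .x * vr .i + (nt 1 - vr .x) * gt .top (vr .t)).eval
          (((τ'.setv .j j).setv .t (el i j)).setv .x (if Top i (el i j) then 1 else 0)) =
          if Top i (el i j) then i else τ'.a .top (el i j) := by
        simp only [Ex.eval_add, Ex.eval_mul, Ex.eval_sub, Ex.eval_var, Ex.eval_lit, Ex.eval_get,
          St.setv_v, St.setv_a, Function.update_self, ne_eq, reduceCtorEq, not_false_eq_true,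
          Function.update_of_ne, hi']
        split_ifs <;> simp
      have hval_le : (if Top i (el i j) then i else τ'.a .top (el i j)) ≤ m := by
        split_ifs
        · exact hi.le
        · exact hle' _
      refine Tri.put ?_ (by simp) ⟨hio', ?_, ?_⟩
      · rw [hval]; omega
      · intro v
        rw [hval]
        by_cases hv : v = el i j
        · simpa [hv] using hval_le
        · simpa [hv] using hle' v
      · intro v hv i'' hi'' h
        rw [hval]
        by_cases hve : v = el i j
        · subst hve
          simp only [St.seta_a, Function.update_self, Ex.eval_var, St.setv_v, ne_eq, reduceCtorEq,
            not_false_eq_true, Function.update_of_ne]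
          have hT'' : Top i'' (el i j) := h.elim (fun h => h.2) fun h => h.2.1
          split_ifs with hT
          · exact huniq _ hlt i hi i'' hi'' hT.1 hT.2 hT''.1 hT''.2
          · refine htop' _ hlt i'' hi'' ?_
            rcases h with h | h
            · exact Or.inl h
            · exact absurd (h.1 ▸ h.2.1) hT
        · have : ∀ f : ℕ → ℕ, ∀ k, Function.update f (el i j) k v = f v := fun f k =>
            Function.update_of_ne hve _ _
          simp only [St.seta_a, Function.update_self, Ex.eval_var, St.setv_v, ne_eq, reduceCtorEq,
            not_false_eq_true, Function.update_of_ne, this, St.setv_a]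
          refine htop' v hv i'' hi'' ?_
          rcases h with h | ⟨h1, h2, j', hj', h3⟩
          · exact Or.inl h
          · refine Or.inr ⟨h1, h2, j', lt_of_le_of_ne (by omega) ?_, h3⟩
            rintro rfl
            exact hve h3.symm
    · simp [hptr, hio, hcard]
    · rintro τ' hf' ⟨hio', hle', htop'⟩
      have hptr' : τ'.v .ptr = 3 + n * n + m + off card i :=
        (hf'.v .ptr (by decide)).trans (by simpa using hptr)
      have hcard' : τ'.v .card = card i :=
        (hf'.v .card (by decide)).trans (by simp [hptr, hio, hcard])
      have := off_succ card i
      refine Tri.set ?_ (by simp) ⟨hio', ?_, hle', fun v hv i' hi' h => ?_⟩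
      · simp [hptr', hcard']; omega
      · simp [hptr', hcard']; omega
      · refine htop' v hv i' (by omega) ?_
        rcases Nat.lt_succ_iff_lt_or_eq.1 hi' with h3 | rfl
        · exact Or.inl ⟨h3, h⟩
        · refine Or.inr ⟨rfl, h, ?_⟩
          simpa [hptr, hio, hcard] using h.1
  · simp only [St.setv_v, ne_eq, reduceCtorEq, not_false_eq_true, Function.update_of_ne, hm]
    refine Nat.add_le_add_left ?_ 1
    rw [off, Finset.mul_sum]
    exact Finset.sum_le_sum fun i _ => by omega
  · rintro τ - ⟨-, -, -, h⟩ v hv i hi h1 h2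
    exact h v hv i (by simpa [hm] using hi) ⟨h1, h2⟩

end

end VCP

/-! ### Elimination order and colouring -/

namespace VCP

open RAM

set_option linter.unusedSectionVars false

/-- Models the array that a filling loop has built after some rounds, so that a recursion on all
earlier terms takes the form in which the program runs it. -/
def seqAux (F : (ℕ → ℕ) → ℕ → ℕ) : ℕ → ℕ → ℕ
  | 0 => fun _ => 0
  | i + 1 => Function.update (seqAux F i) i (F (seqAux F i) i)

/-- The sequence in which each term is computed by `F` from the preceding ones. -/
def seqRec (F : (ℕ → ℕ) → ℕ → ℕ) (i : ℕ) : ℕ := seqAux F (i + 1) i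

theorem seqAux_eq (F : (ℕ → ℕ) → ℕ → ℕ) {i k : ℕ} (h : i < k) : seqAux F k i = seqRec F i := by
  induction k with
  | zero => omega
  | succ k ih =>
    rcases Nat.lt_succ_iff_lt_or_eq.1 h with h1 | rfl
    · rw [seqAux, Function.update_of_ne h1.ne, ih h1]
    · rfl

theorem seqRec_eq {F : (ℕ → ℕ) → ℕ → ℕ}
    (hF : ∀ o o' : ℕ → ℕ, ∀ i, (∀ j < i, o j = o' j) → F o i = F o' i) (i : ℕ) :
    seqRec F i = F (seqRec F) i := by
  have : seqRec F i = F (seqAux F i) i := by simp [seqRec, seqAux]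
  rw [this]
  exact hF _ _ _ fun j hj => seqAux_eq F hj

/-- After `o` has eliminated its first `i` values, `v` can be eliminated. -/
def Cand (Rel : ℕ → ℕ → Prop) (n : ℕ) (o : ℕ → ℕ) (i v : ℕ) : Prop :=
  (∀ j < i, o j ≠ v) ∧ ∀ w < n, (∀ j < i, o j ≠ w) → Rel w v → Rel v w

theorem cand_congr {Rel : ℕ → ℕ → Prop} {n i : ℕ} {o o' : ℕ → ℕ} (h : ∀ j < i, o j = o' j) (v : ℕ) :
    Cand Rel n o i v ↔ Cand Rel n o' i v := by
  have : ∀ w, (∀ j < i, o j ≠ w) ↔ ∀ j < i, o' j ≠ w := fun w =>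
    forall_congr' fun j => forall_congr' fun hj => by rw [h j hj]
  simp only [Cand, this]

noncomputable def ord (Rel : ℕ → ℕ → Prop) (n : ℕ) : ℕ → ℕ :=
  seqRec fun o i => least (Cand Rel n o i) n

theorem ord_eq (Rel : ℕ → ℕ → Prop) (n i : ℕ) :
    ord Rel n i = least (Cand Rel n (ord Rel n) i) n := by
  refine seqRec_eq (fun o o' i h => ?_) i
  exact least_congr fun v _ => cand_congr h v

section
variable {Rel : ℕ → ℕ → Prop} {n : ℕ}
  (hsel : ∀ W ⊆ Finset.range n, W.Nonempty → ∃ v ∈ W, ∀ w ∈ W, Rel w v → Rel v w)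
include hsel

/-- Before step `i` at most `i < n` vertices have been used, so some remain and `hsel` provides a
candidate. The search therefore never returns its default value. -/
theorem ord_spec {i : ℕ} (hi : i < n) :
    ord Rel n i < n ∧ Cand Rel n (ord Rel n) i (ord Rel n i) := by
  classical
  set W := (Finset.range n).filter fun v => ∀ j < i, ord Rel n j ≠ v with hW
  have hne : W.Nonempty := by
    by_contra h
    rw [Finset.not_nonempty_iff_eq_empty, Finset.filter_eq_empty_iff] at h
    have hsub : Finset.range n ⊆ (Finset.range i).image (ord Rel n) := by
      intro v hv
      have := h hv
      push Not at this
      obtain ⟨j, hj, hv⟩ := this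
      exact Finset.mem_image.2 ⟨j, Finset.mem_range.2 hj, hv⟩
    have := (Finset.card_le_card hsub).trans Finset.card_image_le
    simp only [Finset.card_range] at this
    omega
  obtain ⟨v, hv, h⟩ := hsel W (Finset.filter_subset _ _) hne
  simp only [hW, Finset.mem_filter, Finset.mem_range] at hv h
  have hc : Cand Rel n (ord Rel n) i v := ⟨hv.2, fun w hw hw' => h w ⟨hw, hw'⟩⟩
  have hlt : ord Rel n i < n := by rw [ord_eq]; exact least_lt hc hv.1
  refine ⟨hlt, ?_⟩
  have := least_spec (p := Cand Rel n (ord Rel n) i) (N := n) (by rwa [← ord_eq])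
  rwa [← ord_eq] at this

theorem ord_inj {i j : ℕ} (hi : i < n) (hj : j < n) (h : ord Rel n i = ord Rel n j) : i = j := by
  rcases lt_trichotomy i j with h1 | h1 | h1
  · exact absurd h ((ord_spec hsel hj).2.1 i h1)
  · exact h1
  · exact absurd h.symm ((ord_spec hsel hi).2.1 j h1)

/-- Of two related vertices, the one eliminated first is related to the other. -/
theorem rel_ord {i j : ℕ} (hij : i < j) (hj : j < n)
    (h : Rel (ord Rel n i) (ord Rel n j) ∨ Rel (ord Rel n j) (ord Rel n i)) :
    Rel (ord Rel n i) (ord Rel n j) := by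
  rcases h with h | h
  · exact h
  · refine (ord_spec hsel (hij.trans hj)).2.2 _ (ord_spec hsel hj).1 (fun k hk he => ?_) h
    have := ord_inj hsel (by omega) hj he
    omega

end

def upRel (Rel : ℕ → ℕ → Prop) (n i j : ℕ) : Prop :=
  i < j ∧ j < n ∧ Rel (ord Rel n i) (ord Rel n j)

/-- The greedy colour of the vertex at position `i` from the end. -/
noncomputable def colr (U : ℕ → ℕ → Prop) (n : ℕ) : ℕ → ℕ :=
  seqRec fun o i => least (fun c => ∀ j < i, U (n - 1 - i) (n - 1 - j) → o j ≠ c) n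

theorem colr_eq (U : ℕ → ℕ → Prop) (n i : ℕ) : colr U n i =
    least (fun c => ∀ j < i, U (n - 1 - i) (n - 1 - j) → colr U n j ≠ c) n := by
  refine seqRec_eq (F := fun o i => least (fun c => ∀ j < i, U (n - 1 - i) (n - 1 - j) → o j ≠ c) n)
    (fun o o' i h => ?_) i
  exact least_congr fun c _ => forall_congr' fun j => forall_congr' fun hj => by rw [h j hj]

noncomputable def color (U : ℕ → ℕ → Prop) (n i : ℕ) : ℕ := colr U n (n - 1 - i)

/-- The number of colours. -/
noncomputable def colors (U : ℕ → ℕ → Prop) (n : ℕ) : ℕ :=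
  least (fun c => ∀ u < n, color U n u < c) n

section
variable {U : ℕ → ℕ → Prop} {n : ℕ} (hU : ∀ {i j}, U i j → i < j ∧ j < n)
include hU

-- Only later relatives of `i` restrict its colour, and at most `d` colours occur among them, so one
-- of the first `d + 1` is free. The reversal `n - 1 - i` turns colouring from the end into a
-- recursion along increasing indices.
open Classical in
theorem color_spec {i d : ℕ} (hi : i < n)
    (hd : ((Finset.range n).filter fun j => U i j).card ≤ d) :
    color U n i ≤ d ∧ color U n i < n ∧ ∀ j, U i j → color U n i ≠ color U n j := by
  set X := (Finset.range n).filter fun j => U i j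
  set p : ℕ → Prop := fun c => ∀ j < n - 1 - i, U (n - 1 - (n - 1 - i)) (n - 1 - j) →
    colr U n j ≠ c with hp
  have hcol : color U n i = least p n := colr_eq U n (n - 1 - i)
  have hiff : ∀ c, p c ↔ ∀ j, U i j → color U n j ≠ c := by
    intro c
    have hii : n - 1 - (n - 1 - i) = i := by omega
    constructor
    · intro h j hj
      have := hU hj
      refine h (n - 1 - j) (by omega) ?_
      rwa [hii, show n - 1 - (n - 1 - j) = j by omega]
    · intro h j hj hUj
      rw [hii] at hUj
      have := h _ hUj
      rwa [color, show n - 1 - (n - 1 - j) = j by omega] at this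
  have hXn : X.card < n := by
    have : X ⊆ (Finset.range n).erase i := by
      intro j hj
      have hj := Finset.mem_filter.1 hj
      have := hU hj.2
      exact Finset.mem_erase.2 ⟨by omega, hj.1⟩
    have h1 := Finset.card_le_card this
    rw [Finset.card_erase_of_mem (Finset.mem_range.2 hi), Finset.card_range] at h1
    omega
  obtain ⟨c, hc, hcX⟩ : ∃ c ≤ X.card, p c := by
    have h1 : ((Finset.range (X.card + 1)) \ X.image (color U n)).Nonempty := by
      rw [← Finset.card_pos]
      have h2 := Finset.le_card_sdiff (X.image (color U n)) (Finset.range (X.card + 1))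
      have h3 := Finset.card_image_le (s := X) (f := color U n)
      rw [Finset.card_range] at h2
      omega
    obtain ⟨c, hc⟩ := h1
    simp only [Finset.mem_sdiff, Finset.mem_range, Finset.mem_image, not_exists, not_and] at hc
    refine ⟨c, by omega, (hiff c).2 fun j hj => hc.2 j ?_⟩
    exact Finset.mem_filter.2 ⟨Finset.mem_range.2 (hU hj).2, hj⟩
  have hle : color U n i ≤ c := by rw [hcol]; exact least_le_of hcX
  refine ⟨by omega, by omega, fun j hj h => ?_⟩
  have h1 := least_spec (p := p) (N := n) (by omega)
  exact (hiff _).1 h1 j hj (by rw [← h, hcol])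

omit hU in
theorem color_lt_colors {i : ℕ} (hi : i < n) (h : color U n i < n) :
    color U n i < colors U n := by
  rcases (least_le (fun c => ∀ u < n, color U n u < c) n).lt_or_eq with h1 | h1
  · exact least_spec h1 i hi
  · rw [colors, h1]; exact h

end

/-- The order `ord` is an elimination order. -/
theorem elimOrder_ord {Rel adj : ℕ → ℕ → Prop} {n : ℕ}
    (hsel : ∀ W ⊆ Finset.range n, W.Nonempty → ∃ v ∈ W, ∀ w ∈ W, Rel w v → Rel v w)
    (hsymm : ∀ {x y}, adj x y → adj y x) (hirr : ∀ x, ¬ adj x x)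
    (hadj : ∀ {x y}, adj x y → Rel x y ∨ Rel y x)
    (hrel : ∀ {x y z}, y < n → z < n → Rel x y → Rel x z → Rel y z ∨ Rel z y) :
    ElimOrder n (colors (upRel Rel n) n)
      (fun i j => i < n ∧ j < n ∧ adj (ord Rel n i) (ord Rel n j)) (upRel Rel n)
      (color (upRel Rel n) n) := by
  have hU : ∀ {i j}, upRel Rel n i j → i < j ∧ j < n := fun h => ⟨h.1, h.2.1⟩
  refine ⟨fun h => ⟨h.2.1, h.1, hsymm h.2.2⟩, fun x h => hirr _ h.2.2, fun h => h.2.1,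
    fun h hij => ⟨hij, h.2.1, rel_ord hsel hij h.2.1 (hadj h.2.2)⟩, hU, fun {i j k} h h' hjk => ?_,
    fun {i} hi => ?_, fun {i j} h => ?_⟩
  -- Two later relatives of a vertex share the bag of its top, hence are relatives in some
  -- direction; the choice of the order turns this towards the later one.
  · exact ⟨hjk, h'.2.1, rel_ord hsel hjk h'.2.1 (hrel (ord_spec hsel h.2.1).1
      (ord_spec hsel h'.2.1).1 h.2.2 h'.2.2)⟩
  · exact color_lt_colors hi (color_spec hU hi le_rfl).2.1
  · exact (color_spec hU (h.1.trans h.2.1) le_rfl).2.2 j h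

end VCP

/-! ### Computing the elimination order -/

namespace VCP

open RAM

set_option linter.unusedSectionVars false
set_option linter.constructorNameAsVariable false

/-- Fill the first `x` cells of an array. -/
def fill0 (a : Ar) (r x : Nm) (e : E) : Pr := Hl.fill a r x (nt 0) e

theorem fill0_spec {B N T : ℕ} {σ : St Nm Ar} {Q : St Nm Ar → Prop} {a : Ar} {r x : Nm} {e : E}
    (spec : ℕ → ℕ) (t n : ℕ) (hn : σ.v x = n)
    (he : ∀ i < n, ∀ A : ℕ → ℕ, (∀ j < i, A j = spec j) →
      e.eval ((σ.seta a A).setv r i) = spec i ∧ e.cost ((σ.seta a A).setv r i) ≤ t)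
    (hB : ∀ i < n, spec i ≤ B) (hT : 1 + n * (2 + t) ≤ T)
    (hQ : ∀ A : ℕ → ℕ, (∀ j < n, A j = spec j) → Q (σ.seta a A)) :
    Tri B N (fill0 a r x e) σ T Q :=
  Tri.fill spec t 0 n hn (fun _ _ => by simp) (by simpa using he) hB hT
    fun A hA _ => hQ A (by simpa using hA)

theorem div_pair {n i u : ℕ} (hu : u < n) : (i * n + u) / n = i := by
  rw [mul_comm, Nat.mul_add_div (by omega), Nat.div_eq_of_lt hu, add_zero]

theorem mod_pair {n i u : ℕ} (hu : u < n) : (i * n + u) % n = u := by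
  rw [Nat.mul_add_mod', Nat.mod_eq_of_lt hu]

theorem div_lt_of_lt_mul' {z n m : ℕ} (h : z < m * n) : z / n < m :=
  Nat.div_lt_of_lt_mul (by rwa [mul_comm] at h)

theorem pos_of_lt_mul {z n m : ℕ} (h : z < m * n) : 0 < n := by
  rcases n.eq_zero_or_pos with rfl | h1
  · simp at h
  · exact h1

def relS : Pr := fill0 .rel .z .n2 (gt .mem (gt .top (vr .z / vr .n) * vr .n + vr .z % vr .n))

/-- The truth value of: `w` has not been eliminated. -/
def free (w : Nm) : E := .isz (.sum .u .n (.ltI (vr .u) (vr .i) * .eqI (gt .ord (vr .u)) (vr w)))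

def ordS : Pr := fill0 .ord .i .n <| .mu .x .y .n <|
  free .y * .isz (.sum .w .n (free .w * (gt .rel (vr .w * vr .n + vr .y) *
    .isz (gt .rel (vr .y * vr .n + vr .w)))))

def padjS : Pr := fill0 .padj .z .n2
  (gt .adj (gt .ord (vr .z / vr .n) * vr .n + gt .ord (vr .z % vr .n)))

def upS : Pr := fill0 .up .z .n2 (.ltI (vr .z / vr .n) (vr .z % vr .n) *
  gt .rel (gt .ord (vr .z / vr .n) * vr .n + gt .ord (vr .z % vr .n)))

def colrS : Pr := fill0 .colr .i .n <| .mu .x .y .n <| .isz <| .sum .u .n <|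
  .ltI (vr .u) (vr .i) * (gt .up ((vr .n - nt 1 - vr .i) * vr .n + (vr .n - nt 1 - vr .u)) *
    .eqI (gt .colr (vr .u)) (vr .y))

def colS : Pr := fill0 .col .i .n (gt .colr (vr .n - nt 1 - vr .i))

def colorsS : Pr := .set .b <| .mu .x .y .n <| .isz <| .sum .u .n <|
  .leI (vr .y) (gt .col (vr .u))

def pwS : Pr := fill0 .pw .i .b1
  (.isz (vr .i) + .isz (.isz (vr .i)) * (nt 3 * gt .pw (vr .i - nt 1)))

/-- `R` is the modulus separating cost from rank, `L` the number of keys, `SL` the size of one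
layer, `BSL` that of all `b + 1` layers, `ST` the size of a table and `TT` that of all `n + 1`
tables, including the one of the artificial root. -/
def sizes : Pr :=
  .seq (.set .S (gt .pw (vr .b))) <| .seq (.set .R (nt 2 * vr .b + nt 1)) <|
  .seq (.set .L (vr .n1 * vr .R)) <| .seq (.set .SL (vr .S * vr .L)) <|
  .seq (.set .BSL (vr .b1 * vr .SL)) <| .seq (.set .ST (vr .S * vr .n1)) <|
  .set .TT (vr .n1 * vr .ST)

def onesS : Pr := fill0 .ones .z .S (.sum .u .b (.eqI (vr .z / gt .pw (vr .u) % nt 3) (nt 1)))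

def piS : Pr := fill0 .pi .i .n (.mu .x .y .n (gt .up (vr .i * vr .n + vr .y)))

section
open Classical

variable {B N n T b : ℕ} {σ : St Nm Ar} {Q : St Nm Ar → Prop} {Rel U : ℕ → ℕ → Prop}

theorem relS_spec (hn : σ.v .n = n) (hn2 : σ.v .n2 = n * n) (hB : 1 ≤ B)
    (hrel : ∀ v < n, ∀ u < n, σ.a .mem (σ.a .top v * n + u) = if Rel v u then 1 else 0)
    (hT : 1 + n * n * 2 ≤ T)
    (hQ : ∀ A : ℕ → ℕ, (∀ v < n, ∀ u < n, A (v * n + u) = if Rel v u then 1 else 0) →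
      Q (σ.seta .rel A)) : Tri B N relS σ T Q := by
  refine fill0_spec (fun z => if Rel (z / n) (z % n) then 1 else 0) 0 _ hn2 (fun z hz A _ => ?_)
    (fun z hz => ?_) hT fun A hA => hQ A fun v hv u hu => ?_
  · have := hrel (z / n) (div_lt_of_lt_mul' hz) (z % n) (Nat.mod_lt _ (pos_of_lt_mul hz))
    simp [hn, this]
  · split_ifs <;> omega
  · rw [hA _ (pair_lt hv hu), div_pair hu, mod_pair hu]

theorem eval_free {w : Nm} {i : ℕ} {τ : St Nm Ar} (hn : τ.v .n = n) (hi : τ.v .i = i)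
    (hw : w ≠ .u) {o : ℕ → ℕ} (hin : i < n) (ho : ∀ j < i, τ.a .ord j = o j) :
    (free w).eval τ = if ∀ j < i, o j ≠ τ.v w then 1 else 0 := by
  simp only [free, Ex.eval_isz, Ex.eval_sum, hn, Ex.eval_mul, Ex.eval_ltI, Ex.eval_var, St.setv_v,
    Function.update_self, ne_eq, reduceCtorEq, not_false_eq_true, Function.update_of_ne, hi,
    Ex.eval_eqI, Ex.eval_get, St.setv_a, hw, Finset.sum_eq_zero_iff, Finset.mem_range,
    mul_eq_zero, ite_eq_right_iff, one_ne_zero, imp_false, not_lt]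
  congr 1
  rw [eq_iff_iff]
  constructor
  · intro h j hj
    have := h j (by omega)
    rw [ho j hj] at this
    exact this.resolve_left (by omega)
  · intro h j _
    by_cases hj : j < i
    · right; rw [ho j hj]; exact h j hj
    · left; omega

theorem cost_free {w : Nm} {τ : St Nm Ar} (hn : τ.v .n = n) : (free w).cost τ = 1 + n := by
  simp [free, hn]

theorem ordS_spec (hn : σ.v .n = n) (hB : n ≤ B)
    (hrel : ∀ v < n, ∀ u < n, σ.a .rel (v * n + u) = if Rel v u then 1 else 0)
    (hT : 20 * (n + 1) ^ 5 ≤ T)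
    (hQ : ∀ A : ℕ → ℕ, (∀ i < n, A i = ord Rel n i) → Q (σ.seta .ord A)) :
    Tri B N ordS σ T Q := by
  have hlt : ∀ i, ord Rel n i ≤ n := fun i => by rw [ord_eq]; exact least_le _ _
  refine fill0_spec (ord Rel n) (1 + n * (2 + n * (1 + (1 + n + (1 + n * (2 + n)))))) _ hn
    (fun i hi A hA => ⟨?_, ?_⟩) (fun i hi => (hlt i).trans hB) (le_trans ?_ hT) hQ
  · rw [Ex.eval_mu (by simp) (by simp) (p := Cand Rel n (ord Rel n) i)]
    · rw [ord_eq]; simp [hn]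
    · intro x hx y hy
      simp only [St.setv_v, St.seta_v, ne_eq, reduceCtorEq, not_false_eq_true,
        Function.update_of_ne, hn] at hx hy
      rw [Ex.eval_mul, Ex.eval_isz, eval_free (n := n) (i := i) (o := ord Rel n) (by simp [hn])
        (by simp) (by simp) hi (by simpa using hA)]
      have h1 : ((Ex.sum .w .n (free .w * (gt .rel (vr .w * vr .n + vr .y) *
          .isz (gt .rel (vr .y * vr .n + vr .w)))) : E).eval
            ((((σ.seta .ord A).setv .i i).setv .x x).setv .y y) = 0) ↔
          ∀ w < n, (∀ j < i, ord Rel n j ≠ w) → Rel w y → Rel y w := by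
        simp only [Ex.eval_sum, St.setv_v, St.seta_v, ne_eq, reduceCtorEq, not_false_eq_true,
          Function.update_of_ne, hn, Finset.sum_eq_zero_iff, Finset.mem_range]
        refine forall_congr' fun w => forall_congr' fun hw => ?_
        rw [Ex.eval_mul, eval_free (n := n) (i := i) (o := ord Rel n) (by simp [hn])
          (by simp) (by simp) hi (by simpa using hA)]
        have e1 := hrel w hw y hy
        have e2 := hrel y hy w hw
        simp only [St.setv_v, Function.update_self, ne_eq, Ex.eval_mul, Ex.eval_get, St.setv_a,
          St.seta_a, reduceCtorEq, not_false_eq_true, Function.update_of_ne, Ex.eval_add,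
          Ex.eval_var, St.seta_v, hn, e1, Ex.eval_isz, e2]
        by_cases h1 : ∀ j < i, ¬ ord Rel n j = w <;> by_cases h2 : Rel w y <;>
          by_cases h3 : Rel y w <;> simp [h1, h2, h3]
      rw [Cand]
      split_ifs with h2 h3 h3
      · simp only [mul_one, ne_eq, one_ne_zero, not_false_eq_true, true_iff]
        exact ⟨by simpa using h2, h1.1 h3⟩
      · simp only [mul_zero, ne_eq, not_true_eq_false, false_iff, not_and]
        exact fun _ h => h3 (h1.2 h)
      · simp only [zero_mul, ne_eq, not_true_eq_false, false_iff, not_and]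
        exact fun h => absurd (by simpa using h) h2
      · simp only [zero_mul, ne_eq, not_true_eq_false, false_iff, not_and]
        exact fun h => absurd (by simpa using h) h2
  · refine (Ex.cost_mu (T := 1 + n + (1 + n * (2 + n))) (by simp) ?_).trans (by simp [hn])
    intro x _ y _
    rw [Ex.cost_mul, cost_free (n := n) (by simp [hn]), Ex.cost_isz]
    refine Nat.add_le_add_left ((Ex.cost_sum_le (T := 1 + n) fun w hw => ?_).trans ?_) _
    · rw [Ex.cost_mul, cost_free (n := n) (by simp [hn])]; simp
    · simp only [St.setv_v, St.seta_v, ne_eq, reduceCtorEq, not_false_eq_true,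
        Function.update_of_ne, hn]
      rw [show 1 + (1 + n) = 2 + n by omega]
  · have h2 := Nat.zero_le (n ^ 2)
    have h3 := Nat.zero_le (n ^ 3)
    have h4 := Nat.zero_le (n ^ 4)
    have h5 := Nat.zero_le (n ^ 5)
    ring_nf
    omega

theorem padjS_spec {adj : ℕ → ℕ → Prop} (hn : σ.v .n = n) (hn2 : σ.v .n2 = n * n) (hB : 1 ≤ B)
    (hadj : ∀ v < n, ∀ u < n, σ.a .adj (v * n + u) = if adj v u then 1 else 0) {o : ℕ → ℕ}
    (ho : ∀ i < n, σ.a .ord i = o i) (hon : ∀ i < n, o i < n)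
    (hT : 1 + n * n * 2 ≤ T)
    (hQ : ∀ A : ℕ → ℕ, (∀ i < n, ∀ j < n, A (i * n + j) =
      if i < n ∧ j < n ∧ adj (o i) (o j) then 1 else 0) → Q (σ.seta .padj A)) :
    Tri B N padjS σ T Q := by
  refine fill0_spec (fun z => if adj (o (z / n)) (o (z % n)) then 1 else 0) 0 _ hn2
    (fun z hz A _ => ?_) (fun z hz => ?_) hT fun A hA => hQ A fun v hv u hu => ?_
  · have h1 := div_lt_of_lt_mul' hz
    have h2 := Nat.mod_lt z (pos_of_lt_mul hz)
    have := hadj _ (hon _ h1) _ (hon _ h2)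
    simp [hn, this, ho _ h1, ho _ h2]
  · split_ifs <;> omega
  · rw [hA _ (pair_lt hv hu), div_pair hu, mod_pair hu]
    simp [hv, hu]

theorem upS_spec (hn : σ.v .n = n) (hn2 : σ.v .n2 = n * n) (hB : 1 ≤ B)
    (hrel : ∀ v < n, ∀ u < n, σ.a .rel (v * n + u) = if Rel v u then 1 else 0)
    (ho : ∀ i < n, σ.a .ord i = ord Rel n i) (hon : ∀ i < n, ord Rel n i < n)
    (hT : 1 + n * n * 2 ≤ T)
    (hQ : ∀ A : ℕ → ℕ, (∀ i < n, ∀ j < n, A (i * n + j) =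
      if upRel Rel n i j then 1 else 0) → Q (σ.seta .up A)) :
    Tri B N upS σ T Q := by
  refine fill0_spec (fun z => if upRel Rel n (z / n) (z % n) then 1 else 0) 0 _ hn2
    (fun z hz A _ => ?_) (fun z hz => ?_) hT fun A hA => hQ A fun v hv u hu => ?_
  · have h1 := div_lt_of_lt_mul' hz
    have h2 := Nat.mod_lt z (pos_of_lt_mul hz)
    have := hrel _ (hon _ h1) _ (hon _ h2)
    by_cases h3 : z / n < z % n <;> simp [hn, this, ho _ h1, ho _ h2, upRel, h2, h3]
  · split_ifs <;> omega
  · rw [hA _ (pair_lt hv hu), div_pair hu, mod_pair hu]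

variable (hup : ∀ i < n, ∀ j < n, σ.a .up (i * n + j) = if U i j then 1 else 0)

include hup in
theorem colrS_spec (hn : σ.v .n = n) (hB : n ≤ B) (hT : 10 * (n + 1) ^ 4 ≤ T)
    (hQ : ∀ A : ℕ → ℕ, (∀ i < n, A i = colr U n i) → Q (σ.seta .colr A)) :
    Tri B N colrS σ T Q := by
  have hlt : ∀ i, colr U n i ≤ n := fun i => by rw [colr_eq]; exact least_le _ _
  refine fill0_spec (colr U n) (1 + n * (2 + n * (1 + (1 + n)))) _ hn
    (fun i hi A hA => ⟨?_, ?_⟩) (fun i hi => (hlt i).trans hB) (le_trans ?_ hT) hQ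
  · rw [Ex.eval_mu (by simp) (by simp)
      (p := fun c => ∀ j < i, U (n - 1 - i) (n - 1 - j) → colr U n j ≠ c)]
    · rw [colr_eq]; simp [hn]
    · intro x hx y hy
      simp only [St.setv_v, St.seta_v, ne_eq, reduceCtorEq, not_false_eq_true,
        Function.update_of_ne, hn] at hx hy
      simp only [Ex.eval_isz, Ex.eval_sum, St.setv_v, St.seta_v, ne_eq, reduceCtorEq,
        not_false_eq_true, Function.update_of_ne, hn, Finset.sum_eq_zero_iff, Finset.mem_range,
        ite_eq_right_iff, one_ne_zero, imp_false, not_not, Ex.eval_mul, Ex.eval_ltI, Ex.eval_var,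
        Function.update_self, Ex.eval_get, St.setv_a, St.seta_a, Ex.eval_add, Ex.eval_sub,
        Ex.eval_lit, Ex.eval_eqI, mul_eq_zero]
      constructor
      · intro h j hj hUj hc
        rcases h j (by omega) with h1 | h1 | h1
        · exact h1 hj
        · rw [hup _ (by omega) _ (by omega), if_pos hUj] at h1
          omega
        · rw [hA j hj] at h1; exact h1 hc
      · intro h j hj
        by_cases hji : j < i
        · right
          rw [hup _ (by omega) _ (by omega), hA j hji]
          by_cases hUj : U (n - 1 - i) (n - 1 - j)
          · exact Or.inr (h j hji hUj)
          · left; rw [if_neg hUj]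
        · exact Or.inl hji
  · refine (Ex.cost_mu (T := 1 + n) (by simp) ?_).trans (by simp [hn])
    intro x _ y _
    simp [hn]
  · have h2 := Nat.zero_le (n ^ 2)
    have h3 := Nat.zero_le (n ^ 3)
    have h4 := Nat.zero_le (n ^ 4)
    ring_nf
    omega

theorem colS_spec (hn : σ.v .n = n) (hB : n ≤ B)
    (hcolr : ∀ i < n, σ.a .colr i = colr U n i) (hT : 1 + n * 2 ≤ T)
    (hQ : ∀ A : ℕ → ℕ, (∀ i < n, A i = color U n i) → Q (σ.seta .col A)) :
    Tri B N colS σ T Q := by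
  have hlt : ∀ i, colr U n i ≤ n := fun i => by rw [colr_eq]; exact least_le _ _
  refine fill0_spec (color U n) 0 _ hn (fun i hi A _ => ⟨?_, by simp⟩)
    (fun i hi => (hlt _).trans hB) hT hQ
  simp [hn, hcolr (n - 1 - i) (by omega), color]

theorem colorsS_spec (hn : σ.v .n = n) (hB : n ≤ B)
    (hcol : ∀ i < n, σ.a .col i = color U n i) (hT : 5 * (n + 1) ^ 3 ≤ T)
    (hQ : Q (σ.setv .b (colors U n))) : Tri B N colorsS σ T Q := by
  have he : (Ex.mu .x .y .n (.isz (.sum .u .n (.leI (vr .y) (gt .col (vr .u))))) : E).eval σ =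
      colors U n := by
    rw [Ex.eval_mu (by simp) (by simp) (p := fun c => ∀ u < n, color U n u < c), hn, colors]
    intro x hx y hy
    simp only [Ex.eval_isz, Ex.eval_sum, St.setv_v, ne_eq, reduceCtorEq,
      not_false_eq_true, Function.update_of_ne, hn, Finset.sum_eq_zero_iff, Finset.mem_range,
      ite_eq_right_iff, one_ne_zero, imp_false, not_not, Ex.eval_leI, Ex.eval_var,
      Function.update_self, Ex.eval_get, St.setv_a, not_le]
    exact forall_congr' fun u => forall_congr' fun hu => by rw [hcol u hu]
  refine Tri.set ?_ ?_ ?_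
  · rw [he]; exact (least_le _ _).trans hB
  · refine le_trans (Nat.add_le_add_left (Ex.cost_mu (T := 1 + n) (by simp) ?_) 1) (le_trans ?_ hT)
    · intro x _ y _
      simp [hn]
    · have h2 := Nat.zero_le (n ^ 2)
      have h3 := Nat.zero_le (n ^ 3)
      rw [hn]
      ring_nf
      omega
  · rw [he]; exact hQ

theorem pwS_spec (hb1 : σ.v .b1 = b + 1) (hB : 3 ^ b ≤ B) (hT : 1 + (b + 1) * 2 ≤ T)
    (hQ : ∀ A : ℕ → ℕ, (∀ i ≤ b, A i = 3 ^ i) → Q (σ.seta .pw A)) : Tri B N pwS σ T Q := by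
  refine fill0_spec (fun i => 3 ^ i) 0 _ hb1 (fun i hi A hA => ⟨?_, by simp⟩)
    (fun i hi => (Nat.pow_le_pow_right (by norm_num) (by omega)).trans hB) hT
    fun A hA => hQ A fun i hi => hA i (by omega)
  cases i with
  | zero => simp
  | succ i => simp [hA i (by omega), pow_succ, mul_comm]

theorem onesS_spec (hb : σ.v .b = b) (hS : σ.v .S = 3 ^ b) (hB : b ≤ B)
    (hpw : ∀ i ≤ b, σ.a .pw i = 3 ^ i) (hT : 1 + 3 ^ b * (3 + b) ≤ T)
    (hQ : ∀ A : ℕ → ℕ, (∀ s < 3 ^ b, A s = ones b s) → Q (σ.seta .ones A)) :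
    Tri B N onesS σ T Q := by
  refine fill0_spec (ones b) (1 + b) _ hS (fun s hs A hA => ⟨?_, by simp [hb]⟩)
    (fun i hi => (ones_le _ _).trans hB) (le_trans (by apply le_of_eq; ring) hT) hQ
  simp only [Ex.eval_sum, St.setv_v, St.seta_v, ne_eq, reduceCtorEq, not_false_eq_true,
    Function.update_of_ne, hb, Ex.eval_eqI, Ex.eval_mod, Ex.eval_div, Ex.eval_var, Ex.eval_get,
    Function.update_self, St.setv_a, St.seta_a, Ex.eval_lit, ones, dg]
  refine Finset.sum_congr rfl fun c hc => ?_
  rw [hpw c (Finset.mem_range.1 hc).le]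
  by_cases h : s / 3 ^ c % 3 = 1 <;> simp [h]

include hup in
theorem piS_spec (hn : σ.v .n = n) (hB : n ≤ B) (hT : 5 * (n + 1) ^ 3 ≤ T)
    (hQ : ∀ A : ℕ → ℕ, (∀ i < n, A i = least (U i) n) → Q (σ.seta .pi A)) :
    Tri B N piS σ T Q := by
  refine fill0_spec (fun i => least (U i) n) (1 + n * (2 + n * (1 + 0))) _ hn
    (fun i hi A hA => ⟨?_, ?_⟩) (fun i hi => (least_le _ _).trans hB) (le_trans ?_ hT) hQ
  · rw [Ex.eval_mu (by simp) (by simp) (p := U i)]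
    · simp [hn]
    · intro x hx y hy
      simp only [St.setv_v, St.seta_v, ne_eq, reduceCtorEq, not_false_eq_true,
        Function.update_of_ne, hn] at hx hy
      simp [hn, hup i hi y hy]
  · refine (Ex.cost_mu (T := 0) (by simp) ?_).trans (by simp [hn])
    intro x _ y _
    simp
  · have h2 := Nat.zero_le (n ^ 2)
    have h3 := Nat.zero_le (n ^ 3)
    ring_nf
    omega

end

end VCP

/-! ### The dynamic program -/

namespace VCP

open RAM ElimOrder

set_option linter.unusedSectionVars false
set_option linter.constructorNameAsVariable false

/-- The first `j` rounds of a transform over the digits one. -/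
def trL (o : Op) (f : ℕ → ℕ) : ℕ → ℕ → ℕ
  | 0, s => f s
  | j + 1, s => o.eval (trL o f j s) (if dg s j = 1 then trL o f j (s - 3 ^ j) else 0)

theorem trL_add (f : ℕ → ℕ) (j s : ℕ) : trL .add f j s = zetaL f j s := by
  induction j generalizing s with
  | zero => rfl
  | succ j ih => simp only [trL, zetaL, ih, Op.eval]

theorem trL_sub (f : ℕ → ℕ) (j s : ℕ) : trL .sub f j s = moebL f j s := by
  induction j generalizing s with
  | zero => rfl
  | succ j ih => simp only [trL, moebL, ih, Op.eval]

/-- Digit `c` of `s`. -/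
def dgE (s c : E) : E := s / gt .pw c % nt 3

/-- Fill all layers of a transform. -/
def layers (o : Op) (a : Ar) (base : E) : Pr := fill0 a .z .BSL
  (.isz (vr .z / vr .SL) * base + .isz (.isz (vr .z / vr .SL)) *
    .op o (gt a (vr .z - vr .SL))
      (.eqI (dgE (vr .z % vr .SL / vr .L) (vr .z / vr .SL - nt 1)) (nt 1) *
        gt a (vr .z - vr .SL - gt .pw (vr .z / vr .SL - nt 1) * vr .L)))

/-- The truth value of: `j` is a later neighbour of `i` that the code does not delete. -/
def laterE : E := gt .up (vr .i * vr .n + vr .j) * gt .padj (vr .i * vr .n + vr .j) *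
  .isz (.eqI (dgE (vr .z / vr .L) (gt .col (vr .j))) (nt 2))

/-- The entry of the table of `v`. -/
def tabE (v s k : E) : E := gt .tab ((v * vr .S + s) * vr .n1 + k)

/-- The code with the digit of `i` turned into `0`. -/
def s0E : E := vr .z / vr .L - dgE (vr .z / vr .L) (gt .col (vr .i)) * gt .pw (gt .col (vr .i))

def kE : E := vr .z % vr .L / vr .R

/-- The elimination of `i`. -/
def elimE : E := .isz (gt .fs (vr .i + nt 1)) * .leI (nt 1) kE *
    tabE (vr .i) (s0E + nt 2 * gt .pw (gt .col (vr .i))) (kE - nt 1) +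
  (.isz (.sum .j .n laterE) *
    (tabE (vr .i) s0E kE + tabE (vr .i) (s0E + nt 1 * gt .pw (gt .col (vr .i))) kE) +
  .eqI (.sum .j .n laterE) (nt 1) *
    .eqI (.sum .j .n (laterE * dgE (vr .z / vr .L) (gt .col (vr .j)))) (nt 1) *
    tabE (vr .i) (s0E - .sum .j .n (laterE * gt .pw (gt .col (vr .j)))) kE)

def elimBase : E := .eqI (vr .z % vr .L % vr .R) (gt .ones (vr .z / vr .L)) *
  (.isz (.eqI (dgE (vr .z / vr .L) (gt .col (vr .i))) (nt 1)) * .isz (.isz elimE))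

def parBase : E := .eqI (vr .z % vr .L % vr .R) (gt .ones (vr .z / vr .L)) *
  tabE (gt .pi (vr .i)) (vr .z / vr .L) kE

def prodBase : E := .sum .u .L (.leI (vr .u) (vr .z % vr .L) *
  gt .za (vr .b * vr .SL + (vr .z / vr .L * vr .L + vr .u)) *
  gt .zb (vr .b * vr .SL + (vr .z / vr .L * vr .L + (vr .z % vr .L - vr .u))))

/-- Eliminate `i` and merge its table into the table of `pi i`. -/
def elimS : Pr :=
  .seq (layers .add .zb elimBase) <| .seq (layers .add .za parBase) <|
  .seq (layers .sub .prod prodBase) <|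
  Hl.fill .tab .z .ST (gt .pi (vr .i) * vr .ST) (.isz (.isz (gt .prod (vr .b * vr .SL +
    (vr .z / vr .n1 * vr .L + (vr .z % vr .n1 * vr .R + gt .ones (vr .z / vr .n1)))))))

/-- Compute the optimum subject to the forced vertices. -/
def sweep : Pr :=
  .seq (fill0 .tab .z .TT (.isz (vr .z % vr .n1) * .isz (gt .ones (vr .z / vr .n1 % vr .S)))) <|
  .seq (.rep .i .n elimS) <|
  .set .K (.mu .x .y .n1 (gt .tab (vr .n * vr .ST + vr .y)))

/-- Compute the optimum, and then force each vertex in turn if this preserves the optimum. -/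
def search : Pr := .rep .q .n1 <|
  .seq (.put .fs (vr .q) (nt 1)) <| .seq sweep <|
  .seq (.set .K0 (.isz (vr .q) * vr .K + .isz (.isz (vr .q)) * vr .K0)) <|
  .put .fs (vr .q) (.isz (.isz (vr .q)) * .eqI (vr .K) (vr .K0))

open Classical in
/-- The state holds the preprocessed instance. -/
structure Env (n b : ℕ) (adj U : ℕ → ℕ → Prop) (col : ℕ → ℕ) (σ : St Nm Ar) : Prop where
  n_eq : σ.v .n = n
  n1_eq : σ.v .n1 = n + 1
  b_eq : σ.v .b = b
  S_eq : σ.v .S = 3 ^ b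
  R_eq : σ.v .R = 2 * b + 1
  L_eq : σ.v .L = (n + 1) * (2 * b + 1)
  SL_eq : σ.v .SL = 3 ^ b * ((n + 1) * (2 * b + 1))
  BSL_eq : σ.v .BSL = (b + 1) * (3 ^ b * ((n + 1) * (2 * b + 1)))
  ST_eq : σ.v .ST = 3 ^ b * (n + 1)
  TT_eq : σ.v .TT = (n + 1) * (3 ^ b * (n + 1))
  padj_eq : ∀ i < n, ∀ j < n, σ.a .padj (i * n + j) = if adj i j then 1 else 0
  up_eq : ∀ i < n, ∀ j < n, σ.a .up (i * n + j) = if U i j then 1 else 0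
  col_eq : ∀ i < n, σ.a .col i = col i
  pw_eq : ∀ i ≤ b, σ.a .pw i = 3 ^ i
  ones_eq : ∀ s < 3 ^ b, σ.a .ones s = ones b s
  pi_eq : ∀ i < n, σ.a .pi i = least (U i) n

section
open Classical

variable {B N n b : ℕ} {adj U : ℕ → ℕ → Prop} {col : ℕ → ℕ} {σ τ : St Nm Ar} {T : ℕ}
  {Q : St Nm Ar → Prop}

theorem Env.congr (h : Env n b adj U col σ)
    (hv : ∀ r ∈ [Nm.n, .n1, .b, .S, .R, .L, .SL, .BSL, .ST, .TT], τ.v r = σ.v r)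
    (ha : ∀ a ∈ [Ar.padj, .up, .col, .pw, .ones, .pi], τ.a a = σ.a a) :
    Env n b adj U col τ := by
  simp only [List.forall_mem_cons] at hv ha
  obtain ⟨v1, v2, v3, v4, v5, v6, v7, v8, v9, v10, -⟩ := hv
  obtain ⟨a1, a2, a3, a4, a5, a6, -⟩ := ha
  constructor
  · rw [v1, h.n_eq]
  · rw [v2, h.n1_eq]
  · rw [v3, h.b_eq]
  · rw [v4, h.S_eq]
  · rw [v5, h.R_eq]
  · rw [v6, h.L_eq]
  · rw [v7, h.SL_eq]
  · rw [v8, h.BSL_eq]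
  · rw [v9, h.ST_eq]
  · rw [v10, h.TT_eq]
  · rw [a1]; exact h.padj_eq
  · rw [a2]; exact h.up_eq
  · rw [a3]; exact h.col_eq
  · rw [a4]; exact h.pw_eq
  · rw [a5]; exact h.ones_eq
  · rw [a6]; exact h.pi_eq

theorem Env.seta (h : Env n b adj U col σ) {a : Ar} (A : ℕ → ℕ)
    (ha : a ∉ [Ar.padj, .up, .col, .pw, .ones, .pi]) : Env n b adj U col (σ.seta a A) :=
  h.congr (fun _ _ => rfl) fun c hc => by
    have : c ≠ a := fun hca => ha (hca ▸ hc)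
    simp [this]

theorem Env.setv (h : Env n b adj U col σ) {r : Nm} (k : ℕ)
    (hr : r ∉ [Nm.n, .n1, .b, .S, .R, .L, .SL, .BSL, .ST, .TT]) :
    Env n b adj U col (σ.setv r k) :=
  h.congr (fun c hc => by
    have : c ≠ r := fun hcr => hr (hcr ▸ hc)
    simp [this]) fun _ _ => rfl

theorem Env.eqOff (h : Env n b adj U col σ) {V : List Nm} {A : List Ar} (hf : EqOff V A τ σ)
    (hV : ∀ r ∈ [Nm.n, .n1, .b, .S, .R, .L, .SL, .BSL, .ST, .TT], r ∉ V)
    (hA : ∀ a ∈ [Ar.padj, .up, .col, .pw, .ones, .pi], a ∉ A) : Env n b adj U col τ :=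
  h.congr (fun r hr => hf.v r (hV r hr)) fun a ha => hf.a a (hA a ha)

theorem eval_dgE (h : Env n b adj U col σ) {s c : E} (hc : c.eval σ ≤ b) :
    (dgE s c).eval σ = dg (s.eval σ) (c.eval σ) := by
  simp [dgE, h.pw_eq _ hc, dg]

theorem triple_div {x s L k : ℕ} (hs : s < x) (hk : k < L) (j : ℕ) :
    (j * (x * L) + (s * L + k)) / (x * L) = j ∧ (j * (x * L) + (s * L + k)) % (x * L) = s * L + k :=
  ⟨div_pair (pair_lt hs hk), mod_pair (pair_lt hs hk)⟩

/-- Stage `j` of the transform is stored in layer `j` and reads only layer `j - 1`, so one filling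
loop performs all rounds. The base expression is evaluated in every cell and masked outside of layer
zero; its cost `t` is therefore paid in all `b + 1` layers. -/
theorem layers_spec (h : Env n b adj U col σ) {o : Op} {a : Ar} {base : E}
    (ha : a ∉ [Ar.padj, .up, .col, .pw, .ones, .pi]) (f : ℕ → ℕ → ℕ) (t : ℕ)
    (hbase : ∀ s < 3 ^ b, ∀ k < (n + 1) * (2 * b + 1), ∀ A,
      base.eval ((σ.seta a A).setv .z (s * ((n + 1) * (2 * b + 1)) + k)) = f s k)
    (hcost : ∀ z A, base.cost ((σ.seta a A).setv .z z) ≤ t)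
    (hB : ∀ j ≤ b, ∀ s k, trL o (fun s => f s k) j s ≤ B)
    (hT : 1 + (b + 1) * (3 ^ b * ((n + 1) * (2 * b + 1))) * (2 + t) ≤ T)
    (hQ : ∀ A : ℕ → ℕ, (∀ j ≤ b, ∀ s < 3 ^ b, ∀ k < (n + 1) * (2 * b + 1),
      A (j * (3 ^ b * ((n + 1) * (2 * b + 1))) + (s * ((n + 1) * (2 * b + 1)) + k)) =
        trL o (fun s => f s k) j s) → Q (σ.seta a A)) : Tri B N (layers o a base) σ T Q := by
  set L := (n + 1) * (2 * b + 1) with hL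
  refine fill0_spec (fun z => trL o (fun s => f s (z % (3 ^ b * L) % L)) (z / (3 ^ b * L))
    (z % (3 ^ b * L) / L)) t _ h.BSL_eq (fun z hz A hA => ?_) (fun z hz => hB _ (Nat.lt_succ_iff.1 (div_lt_of_lt_mul' hz)) _ _) hT
    fun A hA => hQ A fun j hj s hs k hk => ?_
  · have h' := (h.seta A ha).setv (r := .z) z (by decide)
    have h1 := div_lt_of_lt_mul' hz
    have h2 := Nat.mod_lt z (pos_of_lt_mul hz)
    have hz' := Nat.div_add_mod z (3 ^ b * L)
    refine ⟨?_, ?_⟩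
    · set j := z / (3 ^ b * L) with hj
      set x := z % (3 ^ b * L) with hx
      have h3 := div_lt_of_lt_mul' h2
      have h4 := Nat.mod_lt x (pos_of_lt_mul h2)
      have hx' := Nat.div_add_mod x L
      set s := x / L
      set k := x % L
      have hzz : z = j * (3 ^ b * L) + (s * L + k) := by
        rw [mul_comm s L, hx', mul_comm j]; exact hz'.symm
      simp only [Ex.eval_add, Ex.eval_mul, Ex.eval_isz, Ex.eval_div, Ex.eval_var, St.setv_v,
        Function.update_self, ne_eq, reduceCtorEq, not_false_eq_true, Function.update_of_ne,
        St.seta_v, h.SL_eq, ← hL, ← hj]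
      cases hj1 : j with
      | zero =>
        simp only [hj1, zero_mul, zero_add] at hzz
        simp only [if_true, one_mul, one_ne_zero, if_false, zero_mul, add_zero, trL]
        rw [hzz]
        exact hbase s h3 k h4 A
      | succ i =>
        have hSL : j * (3 ^ b * L) = i * (3 ^ b * L) + 3 ^ b * L := by rw [hj1, add_mul, one_mul]
        have hlt : s * L + k < 3 ^ b * L := pair_lt h3 h4
        have hi : i < b + 1 := by omega
        have e1 : z - 3 ^ b * L = i * (3 ^ b * L) + (s * L + k) := by omega
        have hA1 : A (i * (3 ^ b * L) + (s * L + k)) = trL o (fun s => f s k) i s := by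
          have := hA (i * (3 ^ b * L) + (s * L + k)) (by omega)
          obtain ⟨d1, d2⟩ := triple_div h3 h4 i
          rwa [d1, d2, div_pair h4, mod_pair h4] at this
        have hdg : (dgE (vr .z % vr .SL / vr .L) (vr .z / vr .SL - nt 1)).eval
            ((σ.seta a A).setv .z z) = dg s i := by
          rw [eval_dgE h' (by simp [h.SL_eq, ← hL, ← hj]; omega)]
          simp [h.SL_eq, h.L_eq, ← hL, ← hj, hj1, s, x]
        have hne : a ≠ .pw := fun hh => ha (by simp [hh])
        simp only [Nat.add_eq_zero_iff, one_ne_zero, and_false, if_false, zero_mul, if_true,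
          one_mul, zero_add, trL]
        show o.eval _ _ = _
        simp only [Ex.eval_get, Ex.eval_sub, Ex.eval_mul, Ex.eval_eqI, hdg, Ex.eval_var,
          Ex.eval_lit, Ex.eval_div, St.setv_v, Function.update_self, ne_eq, reduceCtorEq,
          not_false_eq_true, Function.update_of_ne, St.seta_v, h.SL_eq, h.L_eq, ← hL, St.setv_a,
          St.seta_a, ← hj, hj1, Nat.add_sub_cancel, hne.symm, h.pw_eq i (by omega), e1, hA1]
        congr 1
        by_cases hd : dg s i = 1
        · rw [if_pos hd, if_pos hd, one_mul]
          have hle : 3 ^ i ≤ s := by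
            have := dg_mul_le s i
            rwa [hd, one_mul] at this
          have e2 : i * (3 ^ b * L) + (s * L + k) - 3 ^ i * L =
              i * (3 ^ b * L) + ((s - 3 ^ i) * L + k) := by
            have := Nat.mul_le_mul_right L hle
            rw [Nat.sub_mul]; omega
          rw [e2]
          have hs' : s - 3 ^ i < 3 ^ b := (Nat.sub_le _ _).trans_lt h3
          have hlt' : (s - 3 ^ i) * L + k < 3 ^ b * L := pair_lt hs' h4
          have := hA (i * (3 ^ b * L) + ((s - 3 ^ i) * L + k)) (by omega)
          obtain ⟨d1, d2⟩ := triple_div hs' h4 i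
          rwa [d1, d2, div_pair h4, mod_pair h4] at this
        · rw [if_neg hd, if_neg hd, zero_mul]
    · have := hcost z A
      simpa [dgE, Ex.cost] using this
  · rw [hA _ (pair_lt (by omega) (pair_lt hs hk))]
    obtain ⟨d1, d2⟩ := triple_div hs hk j
    rw [d1, d2, div_pair hk, mod_pair hk]

end

end VCP

/-! ### Evaluation of the expressions for one elimination step -/

namespace VCP

open RAM ElimOrder

set_option linter.unusedSectionVars false
set_option linter.constructorNameAsVariable false

section
open Classical

variable {B N n b : ℕ} {adj U : ℕ → ℕ → Prop} {col : ℕ → ℕ} {σ τ : St Nm Ar} {T : ℕ}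
  {Q : St Nm Ar → Prop} {Φ : ℕ → Prop} {i s k z : ℕ}

/-- The tables of all vertices not yet eliminated after `i` steps are correct. -/
def TabOK (n b : ℕ) (adj U : ℕ → ℕ → Prop) (col : ℕ → ℕ) (Φ : ℕ → Prop) (i : ℕ)
    (A : ℕ → ℕ) : Prop :=
  ∀ v, i ≤ v → v ≤ n → ∀ s < 3 ^ b, ∀ k ≤ n,
    A ((v * 3 ^ b + s) * (n + 1) + k) = if Val n adj col b Φ (desc n U i v) s k then 1 else 0

theorem eval_later (ho : ElimOrder n b adj U col) (h : Env n b adj U col σ) (hi : i < n)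
    (hvi : σ.v .i = i) (hs : σ.v .z / ((n + 1) * (2 * b + 1)) = s) {j : ℕ} (hj : j < n) :
    laterE.eval (σ.setv .j j) = if j ∈ later n adj U col i s then 1 else 0 := by
  have h' := h.setv (r := .j) j (by decide)
  have hcol := ho.col_lt hj
  rw [laterE, Ex.eval_mul, Ex.eval_mul, Ex.eval_isz, Ex.eval_eqI,
    eval_dgE h' (by simpa [h.col_eq j hj] using hcol.le)]
  simp only [Ex.eval_get, Ex.eval_add, Ex.eval_mul, Ex.eval_var, St.setv_v, ne_eq, reduceCtorEq,
    not_false_eq_true, Function.update_of_ne, hvi, h.n_eq, Function.update_self, St.setv_a,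
    h.up_eq i hi j hj, h.padj_eq i hi j hj, Ex.eval_div, h.L_eq, hs, h.col_eq j hj, Ex.eval_lit,
    later, Finset.mem_filter, Finset.mem_range, hj, true_and]
  by_cases h1 : U i j <;> by_cases h2 : adj i j <;> by_cases h3 : dg s (col j) = 2 <;>
    simp [h1, h2, h3]

theorem eval_sum_later (ho : ElimOrder n b adj U col) (h : Env n b adj U col σ) (hi : i < n)
    (hvi : σ.v .i = i) (hs : σ.v .z / ((n + 1) * (2 * b + 1)) = s) {e : E} (f : ℕ → ℕ)
    (he : ∀ j < n, e.eval (σ.setv .j j) = f j) :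
    (Ex.sum .j .n (laterE * e) : E).eval σ = ∑ j ∈ later n adj U col i s, f j := by
  have hsub : later n adj U col i s ⊆ Finset.range n := Finset.filter_subset _ _
  rw [Ex.eval_sum, h.n_eq, Finset.sum_congr rfl (g := fun j =>
      if j ∈ later n adj U col i s then f j else 0) fun j hj => ?_,
    Finset.sum_ite_mem, Finset.inter_eq_right.2 hsub]
  rw [Finset.mem_range] at hj
  rw [Ex.eval_mul, eval_later ho h hi hvi hs hj, he j hj]
  split_ifs <;> simp

theorem eval_card_later (ho : ElimOrder n b adj U col) (h : Env n b adj U col σ) (hi : i < n)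
    (hvi : σ.v .i = i) (hs : σ.v .z / ((n + 1) * (2 * b + 1)) = s) :
    (Ex.sum .j .n laterE : E).eval σ = (later n adj U col i s).card := by
  have hsub : later n adj U col i s ⊆ Finset.range n := Finset.filter_subset _ _
  rw [Ex.eval_sum, h.n_eq, Finset.sum_congr rfl fun j hj =>
    eval_later ho h hi hvi hs (Finset.mem_range.1 hj), Finset.sum_ite_mem,
    Finset.inter_eq_right.2 hsub, Finset.card_eq_sum_ones]

theorem eval_tabE (h : Env n b adj U col σ) (hA : TabOK n b adj U col Φ i (σ.a .tab)) {v s k : E}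
    (hv : i ≤ v.eval σ) (hvn : v.eval σ ≤ n) (hs : s.eval σ < 3 ^ b) (hk : k.eval σ ≤ n) :
    (tabE v s k).eval σ =
      if Val n adj col b Φ (desc n U i (v.eval σ)) (s.eval σ) (k.eval σ) then 1 else 0 := by
  simp only [tabE, Ex.eval_get, Ex.eval_add, Ex.eval_mul, Ex.eval_var, h.S_eq, h.n1_eq]
  exact hA _ hv hvn _ hs _ hk

/-- The propositional core of `eval_elimE`, separated so that only atoms are left for `tauto`. -/
theorem elim_ne_zero (Φ p₁ p₂ p₃ p₄ : Prop) (c d k : ℕ) :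
    (if Φ then 0 else 1) * (if 1 ≤ k then 1 else 0) * (if p₁ then 1 else 0) +
      ((if c = 0 then 1 else 0) * ((if p₂ then 1 else 0) + if p₃ then 1 else 0) +
      (if c = 1 then 1 else 0) * (if d = 1 then 1 else 0) * if p₄ then 1 else 0) ≠ 0 ↔
    (¬ Φ ∧ 1 ≤ k ∧ p₁) ∨ (c = 0 ∧ (p₂ ∨ p₃)) ∨ (c = 1 ∧ d = 1 ∧ p₄) := by
  simp only [ne_eq, Nat.add_eq_zero_iff, mul_eq_zero, ite_eq_right_iff, ite_eq_left_iff,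
    one_ne_zero, imp_false]
  tauto

/-- A sum of products of truth values, one for each alternative of `val_insert_desc`. It may exceed
one; `elimBase` reduces it to a truth value and adds the condition on the digit of `i`. -/
theorem eval_elimE (ho : ElimOrder n b adj U col) (h : Env n b adj U col σ) (hi : i < n)
    (hvi : σ.v .i = i) (hs : σ.v .z / ((n + 1) * (2 * b + 1)) = s) (hs3 : s < 3 ^ b)
    (hk : σ.v .z % ((n + 1) * (2 * b + 1)) / (2 * b + 1) = k) (hkn : k ≤ n)
    (hA : TabOK n b adj U col Φ i (σ.a .tab))
    (hΦ : σ.a .fs (i + 1) ≠ 0 ↔ Φ i) (hdg : dg s (col i) ≠ 1) :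
    elimE.eval σ ≠ 0 ↔ Val n adj col b Φ (insert i (desc n U i i)) s k := by
  have hc := ho.col_lt hi
  rw [val_insert_desc ho hi hs3]
  have hkE : kE.eval σ = k := by simp [kE, h.L_eq, h.R_eq, hk]
  have hpw : σ.a .pw (col i) = 3 ^ col i := h.pw_eq _ hc.le
  have hs0 : s0E.eval σ = setDg s (col i) 0 := by
    simp only [s0E, Ex.eval_sub, Ex.eval_mul]
    rw [eval_dgE h (by simpa [hvi, h.col_eq i hi] using hc.le)]
    simp [hvi, h.col_eq i hi, h.L_eq, hs, hpw, setDg]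
  have hadd : ∀ d, setDg s (col i) 0 + d * 3 ^ col i = setDg s (col i) d := fun d => by
    simp [setDg]
  have hlt : ∀ d < 3, setDg s (col i) d < 3 ^ b := fun d hd => setDg_lt hs3 hc hd
  have hcard := eval_card_later ho h hi hvi hs
  have hdsum := eval_sum_later ho h hi hvi hs
    (e := dgE (vr .z / vr .L) (gt .col (vr .j))) (fun j => dg s (col j)) fun j hj => by
      rw [eval_dgE (h.setv (r := .j) j (by decide))
        (by simpa [h.col_eq j hj] using (ho.col_lt hj).le)]
      simp [h.L_eq, hs, h.col_eq j hj]
  have hpsum := eval_sum_later ho h hi hvi hs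
    (e := gt .pw (gt .col (vr .j))) (fun j => 3 ^ col j) fun j hj => by
      simp [h.col_eq j hj, h.pw_eq _ (ho.col_lt hj).le]
  have hv : (vr .i).eval σ = i := hvi
  have e2 : (s0E + nt 2 * gt .pw (gt .col (vr .i))).eval σ = setDg s (col i) 2 := by
    simp [hs0, hvi, h.col_eq i hi, hpw, hadd]
  have e1 : (s0E + nt 1 * gt .pw (gt .col (vr .i))).eval σ = setDg s (col i) 1 := by
    simp only [Ex.eval_add, Ex.eval_mul, hs0, Ex.eval_lit, Ex.eval_get, Ex.eval_var, hvi,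
      h.col_eq i hi, hpw, hadd]
  have e3 : (s0E - .sum .j .n (laterE * gt .pw (gt .col (vr .j))) : E).eval σ =
      setDg s (col i) 0 - ∑ j ∈ later n adj U col i s, 3 ^ col j := by
    rw [Ex.eval_sub, hs0, hpsum]
  have ek : (kE - nt 1).eval σ = k - 1 := by simp [hkE]
  have t1 := eval_tabE h hA (v := vr .i) (s := s0E + nt 2 * gt .pw (gt .col (vr .i)))
    (k := kE - nt 1) hv.ge (hv.trans_le hi.le) (by rw [e2]; exact hlt 2 (by omega))
    (by rw [ek]; omega)
  have t2 := eval_tabE h hA (v := vr .i) (s := s0E)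
    (k := kE) hv.ge (hv.trans_le hi.le) (by rw [hs0]; exact hlt 0 (by omega))
    (by rw [hkE]; omega)
  have t3 := eval_tabE h hA (v := vr .i) (s := s0E + nt 1 * gt .pw (gt .col (vr .i)))
    (k := kE) hv.ge (hv.trans_le hi.le) (by rw [e1]; exact hlt 1 (by omega))
    (by rw [hkE]; omega)
  have t4 := eval_tabE h hA (v := vr .i)
    (s := s0E - .sum .j .n (laterE * gt .pw (gt .col (vr .j)))) (k := kE) hv.ge
    (hv.trans_le hi.le) (by rw [e3]; exact (Nat.sub_le _ _).trans_lt (hlt 0 (by omega)))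
    (by rw [hkE]; omega)
  rw [hv, e2, ek] at t1
  rw [hv, hs0, hkE] at t2
  rw [hv, e1, hkE] at t3
  rw [hv, e3, hkE] at t4
  have hfs : (Ex.isz (gt .fs (vr .i + nt 1)) : E).eval σ = if Φ i then 0 else 1 := by
    simp only [Ex.eval_isz, Ex.eval_get, Ex.eval_add, Ex.eval_var, hvi, Ex.eval_lit]
    by_cases hp : Φ i
    · simp [hp, hΦ.2 hp]
    · have := not_not.1 (mt hΦ.1 hp)
      simp [hp, this]
  simp only [elimE, Ex.eval_add, Ex.eval_mul, hfs, t1, t2, t3, t4, Ex.eval_isz, Ex.eval_leI,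
    Ex.eval_eqI, hcard, hdsum, hkE, Ex.eval_lit]
  rw [and_iff_right hdg]
  exact elim_ne_zero _ _ _ _ _ _ _ _

theorem eval_elimBase (ho : ElimOrder n b adj U col) (h : Env n b adj U col σ) (hi : i < n)
    (hvi : σ.v .i = i) (hs3 : s < 3 ^ b) (hk : k < (n + 1) * (2 * b + 1))
    (hz : σ.v .z = s * ((n + 1) * (2 * b + 1)) + k)
    (hA : TabOK n b adj U col Φ i (σ.a .tab)) (hΦ : σ.a .fs (i + 1) ≠ 0 ↔ Φ i) :
    elimBase.eval σ = ranked b (2 * b + 1) (Val n adj col b Φ (insert i (desc n U i i))) s k := by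
  have hs : σ.v .z / ((n + 1) * (2 * b + 1)) = s := by rw [hz, div_pair hk]
  have hk' : σ.v .z % ((n + 1) * (2 * b + 1)) = k := by rw [hz, mod_pair hk]
  have hkn : k / (2 * b + 1) ≤ n := Nat.lt_succ_iff.1 (div_lt_of_lt_mul' hk)
  have hc := ho.col_lt hi
  have hdgv : (dgE (vr .z / vr .L) (gt .col (vr .i))).eval σ = dg s (col i) := by
    rw [eval_dgE h (by simpa [hvi, h.col_eq i hi] using hc.le)]
    simp [hvi, h.col_eq i hi, h.L_eq, hs]
  simp only [elimBase, Ex.eval_mul, Ex.eval_isz, Ex.eval_eqI, hdgv, Ex.eval_lit, Ex.eval_mod,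
    Ex.eval_var, Ex.eval_get, Ex.eval_div, h.L_eq, h.R_eq, hs, hk', h.ones_eq s hs3, ranked]
  by_cases hd : dg s (col i) = 1
  · have : ¬ Val n adj col b Φ (insert i (desc n U i i)) s (k / (2 * b + 1)) := by
      rw [val_insert_desc ho hi hs3]; exact fun hh => hh.1 hd
    simp [hd, this]
  · have := eval_elimE ho h hi hvi hs hs3 (k := k / (2 * b + 1)) (by rw [hk']) hkn hA hΦ hd
    by_cases h1 : elimE.eval σ = 0
    · have h2 : ¬ Val n adj col b Φ (insert i (desc n U i i)) s (k / (2 * b + 1)) := by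
        rw [← this]; simp [h1]
      simp [h1, h2]
    · simp [h1, this.1 h1, hd]

theorem eval_parBase (ho : ElimOrder n b adj U col) (h : Env n b adj U col σ) (hi : i < n)
    (hvi : σ.v .i = i) (hs3 : s < 3 ^ b) (hk : k < (n + 1) * (2 * b + 1))
    (hz : σ.v .z = s * ((n + 1) * (2 * b + 1)) + k)
    (hA : TabOK n b adj U col Φ i (σ.a .tab)) :
    parBase.eval σ = ranked b (2 * b + 1) (Val n adj col b Φ (desc n U i (least (U i) n))) s k := by
  have hs : σ.v .z / ((n + 1) * (2 * b + 1)) = s := by rw [hz, div_pair hk]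
  have hk' : σ.v .z % ((n + 1) * (2 * b + 1)) = k := by rw [hz, mod_pair hk]
  have hkn : k / (2 * b + 1) ≤ n := Nat.lt_succ_iff.1 (div_lt_of_lt_mul' hk)
  have hkE : kE.eval σ = k / (2 * b + 1) := by simp [kE, h.L_eq, h.R_eq, hk']
  have hv : (gt .pi (vr .i)).eval σ = least (U i) n := by simp [hvi, h.pi_eq i hi]
  have hse : (vr .z / vr .L).eval σ = s := by simp [h.L_eq, hs]
  have t := eval_tabE h hA (v := gt .pi (vr .i)) (s := vr .z / vr .L) (k := kE)
    (by rw [hv]; exact (least_gt ho hi).le) (by rw [hv]; exact least_le _ _)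
    (by rw [hse]; exact hs3) (by rw [hkE]; exact hkn)
  rw [hv, hse, hkE] at t
  simp only [parBase, Ex.eval_mul, t, Ex.eval_eqI, Ex.eval_mod, Ex.eval_var, Ex.eval_get,
    Ex.eval_div, h.L_eq, h.R_eq, hs, hk', h.ones_eq s hs3, ranked]
  by_cases h1 : k % (2 * b + 1) = ones b s <;> simp [h1]

theorem eval_prodBase (h : Env n b adj U col σ) (hs3 : s < 3 ^ b)
    (hk : k < (n + 1) * (2 * b + 1)) (hz : σ.v .z = s * ((n + 1) * (2 * b + 1)) + k)
    (f g : ℕ → ℕ → ℕ)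
    (hf : ∀ s < 3 ^ b, ∀ k < (n + 1) * (2 * b + 1),
      σ.a .za (b * (3 ^ b * ((n + 1) * (2 * b + 1))) + (s * ((n + 1) * (2 * b + 1)) + k)) = f s k)
    (hg : ∀ s < 3 ^ b, ∀ k < (n + 1) * (2 * b + 1),
      σ.a .zb (b * (3 ^ b * ((n + 1) * (2 * b + 1))) + (s * ((n + 1) * (2 * b + 1)) + k)) = g s k) :
    prodBase.eval σ = conv ((n + 1) * (2 * b + 1)) k (f s) (g s) := by
  have hs : σ.v .z / ((n + 1) * (2 * b + 1)) = s := by rw [hz, div_pair hk]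
  have hk' : σ.v .z % ((n + 1) * (2 * b + 1)) = k := by rw [hz, mod_pair hk]
  rw [prodBase, Ex.eval_sum, h.L_eq, conv]
  refine Finset.sum_congr rfl fun u hu => ?_
  rw [Finset.mem_range] at hu
  simp only [Ex.eval_mul, Ex.eval_leI, Ex.eval_var, St.setv_v, Function.update_self, Ex.eval_mod,
    ne_eq, reduceCtorEq, not_false_eq_true, Function.update_of_ne, h.L_eq, hk', Ex.eval_get,
    Ex.eval_add, h.b_eq, h.SL_eq, Ex.eval_div, hs, St.setv_a, hf s hs3 u hu, Ex.eval_sub,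
    hg s hs3 (k - u) (by omega)]

end

end VCP

/-! ### One elimination, one sweep, and the search for an optimal set -/

namespace VCP

open RAM ElimOrder

set_option linter.unusedSectionVars false
set_option linter.constructorNameAsVariable false

section
open Classical

variable {B N n b : ℕ} {adj U : ℕ → ℕ → Prop} {col : ℕ → ℕ} {σ τ : St Nm Ar} {T : ℕ}
  {Q : St Nm Ar → Prop} {Φ : ℕ → Prop} {i s k z : ℕ}

/-- A time bound for eliminating one vertex. -/
def elimT (n b : ℕ) : ℕ :=
  4 + (b + 1) * (3 ^ b * ((n + 1) * (2 * b + 1))) * (13 + 6 * n + (n + 1) * (2 * b + 1)) +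
    2 * (3 ^ b * (n + 1))

/-- Table entries are at most one, so transforms are at most `2 ^ b` and convolutions at most `L *
(2 ^ b * 2 ^ b)`; the inverse transform only decreases values. This explains `hB`. -/
theorem elimS_spec (ho : ElimOrder n b adj U col) (h : Env n b adj U col σ) (hi : i < n)
    (hvi : σ.v .i = i) (hA : TabOK n b adj U col Φ i (σ.a .tab))
    (hΦ : σ.a .fs (i + 1) ≠ 0 ↔ Φ i) (hB : (n + 1) * (2 * b + 1) * (2 ^ b * 2 ^ b) ≤ B) :
    Tri B N elimS σ (elimT n b) fun τ => TabOK n b adj U col Φ (i + 1) (τ.a .tab) := by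
  set L := (n + 1) * (2 * b + 1) with hL
  set p := Val n adj col b Φ (desc n U i (least (U i) n)) with hp
  set q := Val n adj col b Φ (insert i (desc n U i i)) with hq
  have hLpos : 1 ≤ L := Nat.succ_le_of_lt (by positivity)
  have h2 : 1 ≤ 2 ^ b := Nat.one_le_two_pow
  have hzB : ∀ r : ℕ → ℕ → Prop, ∀ j ≤ b, ∀ s k,
      trL .add (fun s => ranked b (2 * b + 1) r s k) j s ≤ B := by
    intro r j hj s k
    rw [trL_add]
    have h3 := zetaL_le (f := fun s => ranked b (2 * b + 1) r s k) (M := 1)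
      (fun s => ranked_le _ _ _ _ _) j s
    have h4 : 2 ^ j ≤ 2 ^ b := Nat.pow_le_pow_right (by norm_num) hj
    have h5 : 2 ^ b ≤ L * (2 ^ b * 2 ^ b) :=
      calc 2 ^ b = 1 * (2 ^ b * 1) := by ring
        _ ≤ L * (2 ^ b * 2 ^ b) := Nat.mul_le_mul hLpos (Nat.mul_le_mul_left _ h2)
    omega
  refine Tri.seq (T₁ := 1 + (b + 1) * (3 ^ b * L) * (2 + (6 + 6 * n)))
    (T₂ := 3 + (b + 1) * (3 ^ b * L) * (5 + L) + 2 * (3 ^ b * (n + 1))) ?_ ?_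
  swap
  · rw [elimT, ← hL]
    apply le_of_eq; ring
  refine layers_spec h (by decide) (ranked b (2 * b + 1) q) (6 + 6 * n) (fun s hs k hk A => ?_)
    (fun z A => ?_) (hzB q) le_rfl fun A₁ hA₁ => ?_
  · exact eval_elimBase ho ((h.seta A (by decide)).setv (r := .z) _ (by decide)) hi
      (by simpa using hvi) hs hk (by simp) (by simpa using hA) (by simpa using hΦ)
  · simp [elimBase, elimE, laterE, dgE, tabE, s0E, kE, h.n_eq]
    ring_nf
    omega
  have h1 := h.seta A₁ (a := .zb) (by decide)
  refine Tri.seq (T₁ := 1 + (b + 1) * (3 ^ b * L) * (2 + 0))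
    (T₂ := 2 + (b + 1) * (3 ^ b * L) * (3 + L) + 2 * (3 ^ b * (n + 1))) ?_ (by apply le_of_eq; ring)
  refine layers_spec h1 (by decide) (ranked b (2 * b + 1) p) 0 (fun s hs k hk A => ?_)
    (fun z A => ?_) (hzB p) le_rfl fun A₂ hA₂ => ?_
  · exact eval_parBase ho ((h1.seta A (by decide)).setv (r := .z) _ (by decide)) hi
      (by simpa using hvi) hs hk (by simp) (by simpa using hA)
  · simp [parBase, tabE, kE]
  have h3 := h1.seta A₂ (a := .za) (by decide)
  refine Tri.seq (T₁ := 1 + (b + 1) * (3 ^ b * L) * (2 + (1 + L)))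
    (T₂ := 1 + 2 * (3 ^ b * (n + 1))) ?_ (by apply le_of_eq; ring)
  have hun : ∀ j s k, trL .sub (fun s => conv L k (fun i => zetaL (fun a => ranked b (2 * b + 1) p a i) b s)
      (fun i => zetaL (fun a => ranked b (2 * b + 1) q a i) b s)) j s =
      unionProd b L (ranked b (2 * b + 1) p) (ranked b (2 * b + 1) q) j s k :=
    fun j s k => trL_sub _ _ _
  refine layers_spec h3 (by decide) (fun s k => conv L k
      (fun i => zetaL (fun a => ranked b (2 * b + 1) p a i) b s)
      (fun i => zetaL (fun a => ranked b (2 * b + 1) q a i) b s)) (1 + L) (fun s hs k hk A => ?_)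
    (fun z A => ?_) (fun j _ s k => ?_) le_rfl fun A₃ hA₃ => ?_
  · refine eval_prodBase ((h3.seta A (by decide)).setv (r := .z) _ (by decide)) hs hk
      (by simp) (fun s i => zetaL (fun a => ranked b (2 * b + 1) p a i) b s)
      (fun s i => zetaL (fun a => ranked b (2 * b + 1) q a i) b s) (fun s hs k hk => ?_)
      fun s hs k hk => ?_
    · rw [← trL_add]
      simpa using hA₂ b le_rfl s hs k hk
    · rw [← trL_add]
      simpa using hA₁ b le_rfl s hs k hk
  · simp [prodBase, h.L_eq, hL.ge]
  · rw [hun]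
    have := unionProd_le (b := b) (L := L) (f := ranked b (2 * b + 1) p)
      (g := ranked b (2 * b + 1) q) (M := 1) (fun _ _ => ranked_le _ _ _ _ _)
      (fun _ _ => ranked_le _ _ _ _ _) j s k
    simp only [mul_one] at this
    exact this.trans hB
  have h4 := h3.seta A₃ (a := .prod) (by decide)
  have hgt := least_gt ho hi
  have hle := least_le (U i) n
  -- Only the block of the parent is rewritten. The entry for code `s` and cost `k` is read from the
  -- product at the key `k * R + ones b s`, the only rank at which the union is disjoint.
  refine Tri.fill (fun y => if Val n adj col b Φ (desc n U (i + 1) (least (U i) n)) (y / (n + 1))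
      (y % (n + 1)) then 1 else 0) 0 (least (U i) n * (3 ^ b * (n + 1))) _ h4.ST_eq
    (fun k A => ?_) (fun y hy A _ => ⟨?_, ?_⟩) (fun y _ => ?_) (by apply le_of_eq; ring) ?_
  · simp [hvi, h.pi_eq i hi, h.ST_eq]
  · have hs := div_lt_of_lt_mul' hy
    have hk := Nat.mod_lt y (show 0 < n + 1 by omega)
    have ho1 := ones_le b (y / (n + 1))
    have hkey : y % (n + 1) * (2 * b + 1) + ones b (y / (n + 1)) < L := pair_lt hk (by omega)
    have hA3 := hA₃ b le_rfl _ hs _ hkey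
    rw [hun] at hA3
    have h5 := (h4.seta A (a := .tab) (by decide)).setv (r := .z) y (by decide)
    have hr := unionProd_ranked (b := b) (R := 2 * b + 1) (n := n + 1) (by omega) (p := p) (q := q)
      hs hk
    rw [← hL, ← val_desc_succ ho hi] at hr
    simp only [Ex.eval_isz, Ex.eval_get, Ex.eval_add, Ex.eval_mul, Ex.eval_div, Ex.eval_mod,
      Ex.eval_var, h5.b_eq, h5.SL_eq, h5.n1_eq, h5.L_eq, h5.R_eq]
    simp only [St.setv_v, Function.update_self, St.setv_a, h5.ones_eq _ hs]
    have h6 : ((((σ.seta .zb A₁).seta .za A₂).seta .prod A₃).seta .tab A).a .prod = A₃ := by simp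
    rw [h6, hA3]
    by_cases hV : Val n adj col b Φ (desc n U (i + 1) (least (U i) n)) (y / (n + 1)) (y % (n + 1))
    · simp [hV, hr.2 hV]
    · have := not_not.1 (mt hr.1 hV)
      simp [hV, this]
  · simp
  · have : 1 ≤ B := le_trans (Nat.succ_le_of_lt (by positivity)) hB
    split_ifs <;> omega
  · intro A hA1 hA2 v hv hvn s hs k hk
    have e : (v * 3 ^ b + s) * (n + 1) + k = v * (3 ^ b * (n + 1)) + (s * (n + 1) + k) := by ring
    have hsk : s * (n + 1) + k < 3 ^ b * (n + 1) := pair_lt hs (by omega)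
    rw [e]
    simp only [St.seta_a, Function.update_self]
    by_cases hvl : v = least (U i) n
    · rw [hvl, hA1 _ hsk, div_pair (by omega), mod_pair (by omega)]
    · rw [desc_succ_of_ne ho hvl, hA2]
      · have := hA v (by omega) hvn s hs k hk
        rw [e] at this
        simpa using this
      · rcases lt_or_gt_of_ne hvl with h8 | h8
        · left
          have := Nat.mul_le_mul_right (3 ^ b * (n + 1)) (show v + 1 ≤ least (U i) n from h8)
          rw [add_mul] at this; omega
        · right
          have := Nat.mul_le_mul_right (3 ^ b * (n + 1)) (show least (U i) n + 1 ≤ v from h8)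
          rw [add_mul] at this; omega

/-- `k` is the cost of a solution that keeps the forced vertices. -/
def Sol (n : ℕ) (adj : ℕ → ℕ → Prop) (Φ : ℕ → Prop) (k : ℕ) (S : Finset ℕ) : Prop :=
  S ⊆ Finset.range n ∧ (Finset.range n \ S).card = k ∧ (∀ x < n, Φ x → x ∈ S) ∧
    ∀ w ∈ S, degIn adj S w ≤ 1

noncomputable def opt (n : ℕ) (adj : ℕ → ℕ → Prop) (Φ : ℕ → Prop) : ℕ :=
  least (fun k => ∃ S, Sol n adj Φ k S) (n + 1)

def sweepT (n b : ℕ) : ℕ :=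
  1 + (n + 1) * (3 ^ b * (n + 1)) * 2 + (1 + n * (1 + elimT n b)) +
    (2 + (n + 1) * (2 + (n + 1)))

/-- Every table starts as that of the empty set. After `n` eliminations everything has been merged
into the artificial root `n`, and the optimum is the least cost there at code zero. -/
theorem sweep_spec (ho : ElimOrder n b adj U col) (h : Env n b adj U col σ)
    (hΦ : ∀ i < n, σ.a .fs (i + 1) ≠ 0 ↔ Φ i)
    (hB : (n + 1) * (2 * b + 1) * (2 ^ b * 2 ^ b) ≤ B) (hnB : n + 1 ≤ B) :
    Tri B N sweep σ (sweepT n b) fun τ => τ.v .K = opt n adj Φ := by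
  refine Tri.seq (T₁ := 1 + (n + 1) * (3 ^ b * (n + 1)) * 2)
    (T₂ := (1 + n * (1 + elimT n b)) + (2 + (n + 1) * (2 + (n + 1)))) ?_ (by rw [sweepT]; omega)
  refine fill0_spec (fun z => if z % (n + 1) = 0 ∧ ones b (z / (n + 1) % 3 ^ b) = 0 then 1 else 0)
    0 _ h.TT_eq (fun z hz A _ => ⟨?_, by simp⟩) (fun z _ => ?_) le_rfl fun A hA => ?_
  · have h' := (h.seta A (a := .tab) (by decide)).setv (r := .z) z (by decide)
    have := h'.ones_eq (z / (n + 1) % 3 ^ b) (Nat.mod_lt _ (by positivity))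
    simp only [Ex.eval_mul, Ex.eval_isz, Ex.eval_mod, Ex.eval_var, h'.n1_eq, Ex.eval_get,
      Ex.eval_div, h'.S_eq]
    rw [St.setv_v, Function.update_self, this]
    by_cases h1 : z % (n + 1) = 0 <;> by_cases h2 : ones b (z / (n + 1) % 3 ^ b) = 0 <;>
      simp [h1, h2]
  · split_ifs <;> omega
  have h1 := h.seta A (a := .tab) (by decide)
  refine Tri.seq (T₁ := 1 + n * (1 + elimT n b)) (T₂ := 2 + (n + 1) * (2 + (n + 1))) ?_ (by omega)
  refine Tri.rep (fun i τ => TabOK n b adj U col Φ i (τ.a .tab)) (fun _ => elimT n b)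
    (fun v _ hvn s hs k hk => ?_) (fun i hi τ hf hA => ?_) ?_ fun τ hf hA => ?_
  · have e : (v * 3 ^ b + s) * (n + 1) + k < (n + 1) * (3 ^ b * (n + 1)) := by
      rw [← mul_assoc]
      exact pair_lt (pair_lt (by omega) hs) (by omega)
    simp only [St.seta_a, Function.update_self, hA _ e, mod_pair (show k < n + 1 by omega),
      div_pair (show k < n + 1 by omega), mod_pair hs, desc, val_empty]
  · rw [h1.n_eq] at hi
    have h2 := h1.eqOff hf (by decide) (by decide)
    refine elimS_spec ho (h2.setv (r := .i) i (by decide)) hi (by simp) (by simpa using hA) ?_ hB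
    rw [← hΦ i hi]
    have := hf.a .fs (by decide)
    simp [this]
  · simp [h1.n_eq]
  have h2 := (h1.eqOff hf (by decide) (by decide)).setv (r := .i)
    ((σ.seta .tab A).v .i) (by decide)
  rw [h1.n_eq] at hA
  have hev : (Ex.mu .x .y .n1 (gt .tab (vr .n * vr .ST + vr .y)) : E).eval
      (τ.setv .i ((σ.seta .tab A).v .i)) = opt n adj Φ := by
    rw [Ex.eval_mu (by simp) (by simp) (p := fun k => ∃ S, Sol n adj Φ k S), h2.n1_eq, opt]
    intro x hx k hk
    rw [h2.n1_eq] at hx hk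
    have h3 := (h2.setv (r := .x) x (by decide)).setv (r := .y) k (by decide)
    simp only [Ex.eval_get, Ex.eval_add, Ex.eval_mul, Ex.eval_var, h3.n_eq, h3.ST_eq]
    have h4 := hA n le_rfl le_rfl 0 (by positivity) k (by omega)
    rw [add_zero, mul_assoc, desc_last ho, val_range] at h4
    simp only [St.setv_v, Function.update_self, St.setv_a, h4, Sol, ne_eq, ite_eq_right_iff,
      one_ne_zero, imp_false, not_not]
  refine Tri.set ?_ ?_ ?_
  · rw [hev]; exact (least_le _ _).trans hnB
  · refine (Nat.add_le_add_left (Ex.cost_mu (T := 0) (by simp) fun x _ y _ => by simp) 1).trans ?_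
    rw [h2.n1_eq]
    apply le_of_eq; ring
  · rw [hev]; simp

theorem sol_nonempty {k : ℕ} (h : opt n adj Φ = k) (hk : k ≤ n) : ∃ S, Sol n adj Φ k S := by
  have := least_spec (p := fun k => ∃ S, Sol n adj Φ k S) (N := n + 1)
    (show opt n adj Φ < n + 1 by omega)
  rw [← h]; exact this

theorem opt_none_le : opt n adj (fun _ => False) ≤ n :=
  Nat.lt_succ_iff.1 (least_lt (j := n) ⟨∅, by simp, by simp, by simp, by simp⟩ (by omega))

/-- Forcing vertices can only raise the optimum, so the optimum is preserved exactly when a solution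
respecting the forcing attains the unrestricted value. -/
theorem opt_eq_iff : opt n adj Φ = opt n adj (fun _ => False) ↔
    ∃ S, Sol n adj Φ (opt n adj fun _ => False) S := by
  refine ⟨fun h => sol_nonempty h opt_none_le, fun h => ?_⟩
  refine le_antisymm (least_le_of h) ?_
  by_cases hle : opt n adj Φ ≤ n
  · obtain ⟨S, h1, h2, h3, h4⟩ := sol_nonempty rfl hle
    exact least_le_of ⟨S, h1, h2, fun _ _ => False.elim, h4⟩
  · exact opt_none_le.trans (by omega)

def searchT (n b : ℕ) : ℕ := 1 + (n + 1) * (1 + (3 + sweepT n b))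

/-- Self-reduction: a vertex is forced to be kept if this preserves the optimum. If it does not, no
optimal solution respecting the flags set so far contains the vertex. After all rounds an optimal
solution exists and consists of the forced vertices. The flag of vertex `x` is cell `x + 1`; round
zero sets a cell that no vertex reads and so computes the unrestricted optimum. -/
theorem search_spec (ho : ElimOrder n b adj U col) (h : Env n b adj U col σ)
    (h0 : ∀ i, σ.a .fs i = 0)
    (hB : (n + 1) * (2 * b + 1) * (2 ^ b * 2 ^ b) ≤ B) (hnB : n + 1 ≤ B) :
    Tri B N search σ (searchT n b) fun τ => (∀ x, τ.a .fs x ≤ 1) ∧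
      Sol n adj (fun _ => False) (opt n adj fun _ => False)
        ((Finset.range n).filter fun x => τ.a .fs (x + 1) ≠ 0) := by
  set k₀ := opt n adj (fun _ => False) with hk₀
  have hk₀n : k₀ ≤ n := opt_none_le
  refine Tri.rep (fun q τ => (∀ x, τ.a .fs x ≤ 1) ∧ (∀ x, q ≤ x → τ.a .fs x = 0) ∧
      (q ≠ 0 → τ.v .K0 = k₀) ∧ (∃ S, Sol n adj (fun x => τ.a .fs (x + 1) ≠ 0) k₀ S) ∧
      ∀ S, Sol n adj (fun x => τ.a .fs (x + 1) ≠ 0) k₀ S → ∀ x ∈ S, x + 1 < q →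
        τ.a .fs (x + 1) ≠ 0) (fun _ => 3 + sweepT n b)
    ⟨by simp [h0], by simp [h0], by simp, ?_, by simp⟩ (fun q hq τ hf hI => ?_) ?_
    fun τ hf hI => ?_
  · simpa [h0] using sol_nonempty (Φ := fun _ => False) (adj := adj) hk₀.symm hk₀n
  · obtain ⟨I1, I2, I3, I4, I5⟩ := hI
    rw [h.n1_eq] at hq
    have h1 := (h.eqOff hf (by decide) (by decide)).setv (r := .q) q (by decide)
    refine Tri.seq (T₁ := 1) (T₂ := 2 + sweepT n b) (Tri.put (by simp; omega) (by simp) ?_)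
      (by omega)
    simp only [Ex.eval_var, St.setv_v, Function.update_self, St.setv_a, Ex.eval_lit]
    set A := Function.update (τ.a .fs) q 1 with hA
    have hAsucc : ∀ x, A (x + 1) = if x + 1 = q then 1 else τ.a .fs (x + 1) := fun x => by
      rw [hA, Function.update_apply]
    have h2 := h1.seta A (a := .fs) (by decide)
    refine Tri.seq (T₁ := sweepT n b) (T₂ := 2) (Tri.mono (Tri.frame (sweep_spec
      (Φ := fun x => A (x + 1) ≠ 0) ho h2 (fun i hi => by simp) hB hnB)) le_rfl ?_) (by omega)
    rintro ρ ⟨hK, hf'⟩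
    have hρfs : ρ.a .fs = A := (hf'.a .fs (by decide)).trans (by simp)
    have hρq : ρ.v .q = q := (hf'.v .q (by decide)).trans (by simp)
    have hρK : ρ.v .K0 = τ.v .K0 := (hf'.v .K0 (by decide)).trans (by simp)
    have hev : (Ex.isz (vr .q) * vr .K + .isz (.isz (vr .q)) * vr .K0 : E).eval ρ = k₀ := by
      simp only [Ex.eval_add, Ex.eval_mul, Ex.eval_isz, Ex.eval_var, hρq, hρK, hK]
      by_cases hq0 : q = 0
      · subst hq0
        have : (fun x => A (x + 1) ≠ 0) = fun _ => False := by
          funext x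
          simp [hAsucc, I2 (x + 1) (by omega)]
        simp [this, hk₀]
      · simp [hq0, I3 hq0]
    refine Tri.seq (T₁ := 1) (T₂ := 1) (Tri.set (by rw [hev]; omega) (by simp) ?_) (by omega)
    rw [hev]
    have hev2 : (Ex.isz (.isz (vr .q)) * .eqI (vr .K) (vr .K0) : E).eval (ρ.setv .K0 k₀) =
        if q ≠ 0 ∧ opt n adj (fun x => A (x + 1) ≠ 0) = k₀ then 1 else 0 := by
      simp only [Ex.eval_mul, Ex.eval_isz, Ex.eval_var, Ex.eval_eqI, St.setv_v,
        Function.update_self, ne_eq, reduceCtorEq, not_false_eq_true, Function.update_of_ne, hρq,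
        hK]
      by_cases hq0 : q = 0 <;> simp [hq0]
    refine Tri.put ?_ (by simp) ?_
    · rw [hev2]; split_ifs <;> omega
    rw [hev2]
    simp only [Ex.eval_var, St.setv_v, ne_eq, reduceCtorEq, not_false_eq_true,
      Function.update_of_ne, hρq, St.setv_a, hρfs, St.seta_a, Function.update_self, St.seta_v]
    have hup : ∀ d, Function.update A q d = Function.update (τ.a .fs) q d := fun d => by
      rw [hA, Function.update_idem]
    rw [hup]
    have hτq := I2 q le_rfl
    by_cases hc : ¬ q = 0 ∧ opt n adj (fun x => ¬ A (x + 1) = 0) = k₀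
    · rw [if_pos hc, ← hA]
      refine ⟨fun x => ?_, fun x hx => ?_, fun _ => trivial, ?_, fun S hS x hx hxq => ?_⟩
      · rw [hA, Function.update_apply]; split_ifs
        · exact le_rfl
        · exact I1 x
      · rw [hA, Function.update_of_ne (by omega)]; exact I2 x (by omega)
      · exact opt_eq_iff.1 hc.2
      · rw [hAsucc]
        split_ifs with hx1
        · exact not_false
        · refine I5 S ⟨hS.1, hS.2.1, fun y hy hy1 => hS.2.2.1 y hy ?_, hS.2.2.2⟩ x hx (by omega)
          show ¬ A (y + 1) = 0
          rw [hAsucc]; split_ifs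
          · exact not_false
          · exact hy1
    · have e : Function.update (τ.a .fs) q 0 = τ.a .fs := by
        rw [← hτq, Function.update_eq_self]
      rw [if_neg hc, e]
      refine ⟨I1, fun x hx => I2 x (by omega), fun _ => trivial, I4, fun S hS x hx hxq => ?_⟩
      -- A solution containing the rejected vertex would also respect the tentative forcing,
      -- contrary to the rejection.
      by_cases hx1 : x + 1 = q
      · refine absurd ⟨by omega, opt_eq_iff.2 ⟨S, hS.1, hS.2.1, fun y hy hy1 => ?_, hS.2.2.2⟩⟩ hc
        have hy2 : ¬ A (y + 1) = 0 := hy1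
        rw [hAsucc] at hy2
        by_cases hyq : y + 1 = q
        · obtain rfl : y = x := by omega
          exact hx
        · rw [if_neg hyq] at hy2
          exact hS.2.2.1 y hy hy2
      · exact I5 S hS x hx (by omega)
  · simp [h.n1_eq, searchT]
  · obtain ⟨I1, -, -, ⟨S, hS⟩, I5⟩ := hI
    refine ⟨I1, ?_⟩
    convert (show Sol n adj (fun _ => False) k₀ S from
      ⟨hS.1, hS.2.1, fun _ _ => False.elim, hS.2.2.2⟩) using 1
    ext x
    rw [Finset.mem_filter, Finset.mem_range]
    refine ⟨fun hx => hS.2.2.1 x hx.1 hx.2, fun hx => ?_⟩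
    have hxn := Finset.mem_range.1 (hS.1 hx)
    exact ⟨hxn, I5 S hS x hx (by rw [h.n1_eq]; omega)⟩

end

end VCP

/-! ### The whole program -/

namespace VCP

open RAM ElimOrder

set_option linter.unusedSectionVars false
set_option linter.constructorNameAsVariable false

/-- Everything between reading the input and the dynamic program. -/
def prep : Pr :=
  .seq relS <| .seq ordS <| .seq padjS <| .seq upS <| .seq colrS <| .seq colS <| .seq colorsS <|
  .seq (.set .b1 (vr .b + nt 1)) <| .seq pwS <| .seq sizes <| .seq onesS piS

/-- Positions in the elimination order are translated back to vertices. The answer overwrites the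
input, which is not read again. -/
def output : Pr := .rep .i .n (.out (gt .ord (vr .i)) (.isz (gt .fs (vr .i + nt 1))))

/-- Mark a minimum vertex cover `P₃` set in the first cells of the memory. -/
def solve : Pr :=
  .seq header <| .seq copyAdj <| .seq scan <| .seq scanTop <| .seq prep <| .seq search output

section
open Classical

variable {B N n m root b : ℕ} {σ : St Nm Ar} {T : ℕ} {Rel adj : ℕ → ℕ → Prop}

def prepT (n b : ℕ) : ℕ :=
  (1 + n * n * 2) + (20 * (n + 1) ^ 5 + ((1 + n * n * 2) + ((1 + n * n * 2) +
    (10 * (n + 1) ^ 4 + ((1 + n * 2) + (5 * (n + 1) ^ 3 + (1 + ((1 + (b + 1) * 2) +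
    (7 + ((1 + 3 ^ b * (3 + b)) + 5 * (n + 1) ^ 3))))))))))

theorem sizes_spec {Q : St Nm Ar → Prop} (hb : σ.v .b = b) (hb1 : σ.v .b1 = b + 1)
    (hn1 : σ.v .n1 = n + 1) (hpw : σ.a .pw b = 3 ^ b)
    (hB1 : (b + 1) * (3 ^ b * ((n + 1) * (2 * b + 1))) ≤ B)
    (hB2 : (n + 1) * (3 ^ b * (n + 1)) ≤ B)
    (hQ : Q (((((((σ.setv .S (3 ^ b)).setv .R (2 * b + 1)).setv .L ((n + 1) * (2 * b + 1))).setv .SL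
      (3 ^ b * ((n + 1) * (2 * b + 1)))).setv .BSL ((b + 1) * (3 ^ b * ((n + 1) * (2 * b + 1))))).setv
      .ST (3 ^ b * (n + 1))).setv .TT ((n + 1) * (3 ^ b * (n + 1))))) :
    Tri B N sizes σ 7 Q := by
  have h3 : 1 ≤ 3 ^ b := Nat.one_le_pow _ _ (by norm_num)
  have hSL : 3 ^ b * ((n + 1) * (2 * b + 1)) ≤ B :=
    le_trans (Nat.le_mul_of_pos_left _ (by omega)) hB1
  have hL : (n + 1) * (2 * b + 1) ≤ B := le_trans (Nat.le_mul_of_pos_left _ (by omega)) hSL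
  have hR : 2 * b + 1 ≤ B := le_trans (Nat.le_mul_of_pos_left _ (by omega)) hL
  have hST : 3 ^ b * (n + 1) ≤ B := le_trans (Nat.le_mul_of_pos_left _ (by omega)) hB2
  have hS : 3 ^ b ≤ B := le_trans (Nat.le_mul_of_pos_right _ (by omega)) hST
  refine Tri.seq (T₁ := 1) (T₂ := 6) (Tri.set (by simpa [hb, hpw] using hS) (by simp) ?_) le_rfl
  refine Tri.seq (T₁ := 1) (T₂ := 5) (Tri.set (by simpa [hb] using hR) (by simp) ?_) le_rfl
  refine Tri.seq (T₁ := 1) (T₂ := 4) (Tri.set (by simpa [hb, hn1] using hL) (by simp) ?_) le_rfl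
  refine Tri.seq (T₁ := 1) (T₂ := 3) (Tri.set (by simpa [hb, hn1, hpw] using hSL) (by simp) ?_)
    le_rfl
  refine Tri.seq (T₁ := 1) (T₂ := 2) (Tri.set (by simpa [hb, hn1, hpw, hb1] using hB1) (by simp) ?_)
    le_rfl
  refine Tri.seq (T₁ := 1) (T₂ := 1) (Tri.set (by simpa [hb, hn1, hpw] using hST) (by simp) ?_)
    le_rfl
  refine Tri.set (by simpa [hb, hn1, hpw] using hB2) (by simp) ?_
  simpa [hb, hn1, hpw, hb1] using hQ

theorem prep_spec (hn : σ.v .n = n) (hn1 : σ.v .n1 = n + 1) (hn2 : σ.v .n2 = n * n)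
    (hnB : n + 1 ≤ B)
    (hmem : ∀ v < n, ∀ u < n, σ.a .mem (σ.a .top v * n + u) = if Rel v u then 1 else 0)
    (hadj : ∀ v < n, ∀ u < n, σ.a .adj (v * n + u) = if adj v u then 1 else 0)
    (hord : ∀ i < n, ord Rel n i < n) (hbe : colors (upRel Rel n) n = b)
    (hB1 : (b + 1) * (3 ^ b * ((n + 1) * (2 * b + 1))) ≤ B)
    (hB2 : (n + 1) * (3 ^ b * (n + 1)) ≤ B) :
    Tri B N prep σ (prepT n b) fun τ =>
      Env n b (fun i j => i < n ∧ j < n ∧ adj (ord Rel n i) (ord Rel n j)) (upRel Rel n)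
        (color (upRel Rel n) n) τ ∧ ∀ i < n, τ.a .ord i = ord Rel n i := by
  have h3 : 3 ^ b ≤ B := by
    refine le_trans ?_ hB2
    calc 3 ^ b = 1 * (3 ^ b * 1) := by ring
      _ ≤ _ := Nat.mul_le_mul (by omega) (Nat.mul_le_mul_left _ (by omega))
  have hbn : b ≤ n := hbe ▸ least_le _ _
  refine Tri.seq (relS_spec hn hn2 (by omega) hmem le_rfl fun A₁ hA₁ => ?_) le_rfl
  refine Tri.seq (ordS_spec (Rel := Rel) (by simpa using hn) (by omega) (by simpa using hA₁) le_rfl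
    fun A₂ hA₂ => ?_) le_rfl
  refine Tri.seq (padjS_spec (by simpa using hn) (by simpa using hn2) (by omega)
    (by simpa using hadj) (o := ord Rel n) (by simpa using hA₂) hord le_rfl fun A₃ hA₃ => ?_) le_rfl
  refine Tri.seq (upS_spec (Rel := Rel) (by simpa using hn) (by simpa using hn2) (by omega)
    (by simpa using hA₁) (by simpa using hA₂) hord le_rfl fun A₄ hA₄ => ?_) le_rfl
  refine Tri.seq (colrS_spec (U := upRel Rel n) (by simpa using hA₄) (by simpa using hn) (by omega)
    le_rfl fun A₅ hA₅ => ?_) le_rfl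
  refine Tri.seq (colS_spec (U := upRel Rel n) (by simpa using hn) (by omega) (by simpa using hA₅)
    le_rfl fun A₆ hA₆ => ?_) le_rfl
  refine Tri.seq (colorsS_spec (U := upRel Rel n) (by simpa using hn) (by omega)
    (by simpa using hA₆) le_rfl ?_) le_rfl
  rw [hbe]
  refine Tri.seq (Tri.set (by simp; omega) (by simp) ?_) le_rfl
  refine Tri.seq (pwS_spec (b := b) (by simp) h3 le_rfl fun A₇ hA₇ => ?_) le_rfl
  refine Tri.seq (sizes_spec (n := n) (b := b) (by simp) (by simp) (by simpa using hn1)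
    (by simpa using hA₇ b le_rfl) hB1 hB2 ?_) le_rfl
  refine Tri.seq (onesS_spec (b := b) (by simp) (by simp) (by omega) (by simpa using hA₇) le_rfl
    fun A₈ hA₈ => ?_) le_rfl
  refine piS_spec (U := upRel Rel n) (by simpa using hA₄) (by simpa using hn) (by omega)
    le_rfl fun A₉ hA₉ => ⟨⟨?_, ?_, ?_, ?_, ?_, ?_, ?_, ?_, ?_, ?_, ?_, ?_, ?_, ?_, ?_, ?_⟩, ?_⟩
  · simpa using hn
  · simpa using hn1
  iterate 8 simp
  · intro i hi j hj
    refine (congrFun (show _ = A₃ by simp) _).trans ((hA₃ i hi j hj).trans ?_)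
    congr
  · simpa using hA₄
  · simpa using hA₆
  · simpa using hA₇
  · simpa using hA₈
  · simpa using hA₉
  · simpa using hA₂

theorem output_spec {o : ℕ → ℕ} {S : Finset ℕ} (hn : σ.v .n = n) (ho : ∀ i < n, σ.a .ord i = o i)
    (hinj : ∀ i < n, ∀ j < n, o i = o j → i = j) (hN : ∀ i < n, o i < N) (hB : 1 ≤ B)
    (hS : ∀ i < n, σ.a .fs (i + 1) ≠ 0 ↔ i ∈ S) :
    Tri B N output σ (1 + n * 2) fun τ => ∀ i < n, τ.io (o i) = if i ∈ S then 0 else 1 := by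
  refine Tri.rep (fun i τ => ∀ j < i, τ.io (o j) = if j ∈ S then 0 else 1) (fun _ => 1)
    (by simp) (fun i hi τ hf hI => ?_) (by simp [hn]) fun τ _ hI => by simpa [hn] using hI
  rw [hn] at hi
  have e1 : (gt .ord (vr .i)).eval (τ.setv .i i) = o i := by
    simp [hf.a .ord (by decide), ho i hi]
  have e2 : (Ex.isz (gt .fs (vr .i + nt 1)) : E).eval (τ.setv .i i) =
      if i ∈ S then 0 else 1 := by
    simp only [Ex.eval_isz, Ex.eval_get, Ex.eval_add, Ex.eval_var, St.setv_v, Function.update_self,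
      Ex.eval_lit, St.setv_a, hf.a .fs (by decide)]
    by_cases h : i ∈ S
    · simp [h, (hS i hi).2 h]
    · have := not_not.1 (mt (hS i hi).1 h)
      simp [h, this]
  refine Tri.out (by rw [e1]; exact hN i hi) (by rw [e2]; split_ifs <;> omega) (by simp)
    fun j hj => ?_
  rw [e1, e2]
  by_cases hji : j = i
  · subst hji; simp
  · have hne : o j ≠ o i := fun h => hji (hinj j (by omega) i hi h)
    simp only [St.setio_io, St.setv_io, Function.update_of_ne hne]
    exact hI j (by omega)

/-- The state in which the program starts. -/
def start (io : ℕ → ℕ) : St Nm Ar := ⟨fun _ => 0, fun _ _ => 0, io⟩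

def solveT (n b l : ℕ) : ℕ :=
  5 + ((1 + n * n * 3) + ((5 + 5 * l) + ((5 + 9 * l) + (prepT n b + (searchT n b + (1 + n * 2))))))

/-- All data are functions on natural numbers, and the facts about tops and bags are hypotheses.
This separates the verification of the program from the combinatorics of the tree. -/
theorem solve_spec {io A par card top : ℕ → ℕ} {el : ℕ → ℕ → ℕ} {inBag : ℕ → ℕ → Prop}
    (hl : Layout io n m A par card el) (h0 : io 0 = n) (h1 : io 1 = m) (h2 : io 2 = root)
    (hA : ∀ u < n, ∀ v < n, A (u * n + v) = if adj u v then 1 else 0)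
    (hbag : ∀ i < m, ∀ v, inBag i v ↔ ∃ j < card i, el i j = v)
    (htop : ∀ v < n, top v < m ∧ inBag (top v) v ∧ (top v = root ∨ ¬ inBag (par (top v)) v))
    (huniq : ∀ v < n, ∀ i < m, inBag i v → (i = root ∨ ¬ inBag (par i) v) → i = top v)
    (hRel : ∀ v < n, ∀ u < n, Rel v u ↔ inBag (top v) u)
    (hsel : ∀ W ⊆ Finset.range n, W.Nonempty → ∃ v ∈ W, ∀ w ∈ W, Rel w v → Rel v w)
    (hsymm : ∀ {x y}, adj x y → adj y x) (hirr : ∀ x, ¬ adj x x)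
    (hadj : ∀ {x y}, adj x y → Rel x y ∨ Rel y x)
    (hrel : ∀ {x y z}, y < n → z < n → Rel x y → Rel x z → Rel y z ∨ Rel z y)
    (hbe : colors (upRel Rel n) n = b)
    (hN : 3 + n * n + m + off card m ≤ N) (hB : 3 + n * n + m + off card m ≤ B)
    (hB1 : (b + 1) * (3 ^ b * ((n + 1) * (2 * b + 1))) ≤ B)
    (hB2 : (n + 1) * (3 ^ b * (n + 1)) ≤ B)
    (hB3 : (n + 1) * (2 * b + 1) * (2 ^ b * 2 ^ b) ≤ B) :
    Tri B N solve (start io) (solveT n b (off card m)) fun τ => ∃ S,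
      Sol n (fun i j => i < n ∧ j < n ∧ adj (ord Rel n i) (ord Rel n j)) (fun _ => False)
        (opt n (fun i j => i < n ∧ j < n ∧ adj (ord Rel n i) (ord Rel n j)) fun _ => False) S ∧
      ∀ i < n, τ.io (ord Rel n i) = if i ∈ S then 0 else 1 := by
  have hnn : n ≤ n * n := Nat.le_mul_self n
  have ho := elimOrder_ord (adj := adj) hsel hsymm hirr hadj hrel
  rw [hbe] at ho
  have hord : ∀ i < n, ord Rel n i < n := fun i hi => (ord_spec hsel hi).1
  set σ₁ : St Nm Ar := (((((start io).setv .n n).setv .m m).setv .root root).setv .n1 (n + 1)).setv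
    .n2 (n * n) with hσ₁
  refine Tri.seq (Q := _) (T₁ := 5) ?_ le_rfl
  have hh : Tri B N header (start io) 5 fun τ => τ = σ₁ := by
    refine Tri.seq (T₁ := 1) (T₂ := 4) (Tri.inp (by simp; omega) (by simp) ?_) le_rfl
    refine Tri.seq (T₁ := 1) (T₂ := 3) (Tri.inp (by simp; omega) (by simp) ?_) le_rfl
    refine Tri.seq (T₁ := 1) (T₂ := 2) (Tri.inp (by simp; omega) (by simp) ?_) le_rfl
    refine Tri.seq (T₁ := 1) (T₂ := 1) (Tri.set (by simp [start, h0]; omega) (by simp) ?_) le_rfl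
    refine Tri.set (by simp [start, h0]; omega) (by simp) ?_
    simp [hσ₁, start, h0, h1, h2]
  refine hh.mono le_rfl ?_
  rintro _ rfl
  have e1 : σ₁.v .n = n := by simp [hσ₁]
  have e2 : σ₁.v .m = m := by simp [hσ₁]
  have e3 : σ₁.v .root = root := by simp [hσ₁]
  have e4 : σ₁.v .n1 = n + 1 := by simp [hσ₁]
  have e5 : σ₁.v .n2 = n * n := by simp [hσ₁]
  have e6 : σ₁.io = io := rfl
  have e7 : ∀ a i, σ₁.a a i = 0 := fun _ _ => rfl
  refine Tri.seq ?_ le_rfl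
  refine ((copyAdj_spec e5 (e6 ▸ hl) (by omega) (by omega)).frame_input
    (show copyAdj.Pure from ⟨trivial, trivial⟩)).frame.mono le_rfl ?_
  rintro σ₂ ⟨⟨hadj₂, io₂⟩, f₂⟩
  rw [e6] at io₂
  refine Tri.seq ?_ le_rfl
  refine ((scan_spec (card := card) (el := el) (A := A) (par := par)
    ((f₂.v .n (by decide)).trans e1) ((f₂.v .m (by decide)).trans e2)
    ((f₂.v .n2 (by decide)).trans e5) (io₂ ▸ hl) hN hB
    (fun i => by rw [f₂.a .mem (by decide), e7])).frame_input
    (show scan.Pure from ⟨trivial, trivial, ⟨trivial, trivial⟩, trivial⟩)).frame.mono le_rfl ?_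
  rintro σ₃ ⟨⟨hmem₃, io₃⟩, f₃'⟩
  rw [io₂] at io₃
  have f₃ := (f₃'.mono (V' := copyAdj.vars ++ scan.vars) (A' := copyAdj.arrs ++ scan.arrs)
    (by simp) (by simp)).trans (f₂.mono (by simp) (by simp))
  refine Tri.seq ?_ le_rfl
  have htop' : ∀ v < n, ∀ i < m, (∃ j < card i, el i j = v) →
      (i = root ∨ ¬ ∃ j < card (par i), el (par i) j = v) → i = top v := by
    intro v hv i hi h3 h4
    rw [← hbag i hi] at h3
    rw [← hbag _ (hl.par_lt i hi)] at h4
    exact huniq v hv i hi h3 h4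
  refine ((scanTop_spec (card := card) (el := el) (A := A) (par := par) (root := root)
    ((f₃.v .n (by decide)).trans e1) ((f₃.v .m (by decide)).trans e2)
    ((f₃.v .n2 (by decide)).trans e5) (io₃ ▸ hl) hN hB ((f₃.v .root (by decide)).trans e3) hmem₃
    (fun v hv i hi i' hi' h3 h4 h5 h6 =>
      (htop' v hv i hi h3 h4).trans (htop' v hv i' hi' h5 h6).symm)
    (fun i => by rw [f₃.a .top (by decide), e7]; omega)).frame_input
    (show scanTop.Pure from ⟨trivial, trivial, trivial, ⟨trivial, trivial, trivial⟩, trivial⟩)).frame.mono le_rfl ?_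
  rintro σ₄ ⟨⟨htop₄, io₄⟩, f₄'⟩
  rw [io₃] at io₄
  have f₄ := (f₄'.mono (V' := copyAdj.vars ++ scan.vars ++ scanTop.vars)
    (A' := copyAdj.arrs ++ scan.arrs ++ scanTop.arrs) (by simp) (by simp)).trans
    (f₃.mono (by simp) (by simp))
  refine Tri.seq ?_ le_rfl
  refine ((prep_spec (Rel := Rel) (adj := adj) (b := b) ((f₄.v .n (by decide)).trans e1)
    ((f₄.v .n1 (by decide)).trans e4) ((f₄.v .n2 (by decide)).trans e5) (by omega)
    (fun v hv u hu => ?_) (fun v hv u hu => ?_) hord hbe hB1 hB2).frame).mono le_rfl ?_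
  · obtain ⟨t1, t2, t3⟩ := htop v hv
    rw [htop₄ v hv (top v) t1 ((hbag _ t1 v).1 t2)
      (by rwa [← hbag _ (hl.par_lt _ t1)]), f₄'.a .mem (by decide), hmem₃ _ t1 u hu, hRel v hv u hu,
      hbag _ t1]
    congr
  · rw [f₄'.a .adj (by decide), f₃'.a .adj (by decide), hadj₂ _ (pair_lt hv hu), hA v hv u hu]
  rintro σ₅ ⟨⟨henv, hord₅⟩, f₅⟩
  refine Tri.seq ?_ le_rfl
  refine (search_spec ho henv (fun i => ?_) hB3 (by omega)).frame.mono le_rfl ?_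
  · rw [f₅.a .fs (by decide), f₄.a .fs (by decide), e7]
  rintro σ₆ ⟨⟨-, hSol⟩, f₆⟩
  refine (output_spec (o := ord Rel n)
    (S := (Finset.range n).filter fun x => σ₆.a .fs (x + 1) ≠ 0)
    ((f₆.v .n (by decide)).trans henv.n_eq)
    (fun i hi => (congrFun (f₆.a .ord (by decide)) i).trans (hord₅ i hi))
    (fun i hi j hj h => ord_inj hsel hi hj h) (fun i hi => (hord i hi).trans_le (by omega))
    (by omega) (fun i hi => by simp [hi])).mono le_rfl fun τ hτ => ⟨_, hSol, hτ⟩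

end

end VCP

/-! ### Vertex cover `P₃` sets and the kept vertices -/

namespace VCP

open RAM ElimOrder

set_option linter.unusedSectionVars false

section
open Classical

/-- A path on three vertices is a centre with two distinct neighbours, so a path avoiding `F` is a
vertex outside `F` with two neighbours outside `F`. -/
theorem isVCP_three_iff {V : Type*} [Fintype V] {G : SimpleGraph V} {F : Finset V} :
    IsVCP 3 G F ↔ ∀ w ∉ F, (Finset.univ.filter fun y => y ∉ F ∧ G.Adj w y).card ≤ 1 := by
  constructor
  · intro h w hw
    rw [Finset.card_le_one]
    intro a ha c hc
    simp only [Finset.mem_filter, Finset.mem_univ, true_and] at ha hc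
    by_contra hac
    obtain ⟨x, hx, hxF⟩ := h a c (.cons ha.2.symm (.cons hc.2 .nil))
      (by simp [SimpleGraph.Walk.cons_isPath_iff, ha.2.ne', hc.2.ne, hac]) (by simp)
    simp only [SimpleGraph.Walk.support_cons, SimpleGraph.Walk.support_nil, List.mem_cons,
      List.not_mem_nil, or_false] at hx
    rcases hx with rfl | rfl | rfl
    · exact ha.1 hxF
    · exact hw hxF
    · exact hc.1 hxF
  · intro h u v q hq hlen
    by_contra! hF
    match q, hq, hlen, hF with
    | .cons (v := w) h1 (.cons h2 .nil), hq, _, hF =>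
      simp only [SimpleGraph.Walk.support_cons, SimpleGraph.Walk.support_nil, List.mem_cons,
        List.not_mem_nil, or_false, forall_eq_or_imp, forall_eq] at hF
      have h3 := Finset.card_le_one.1 (h w hF.2.1) u (by simp [hF.1, h1.symm]) v
        (by simp [hF.2.2, h2])
      subst h3
      simp at hq
    | .cons _ (.cons _ (.cons _ q)), _, hlen, _ =>
      simp only [SimpleGraph.Walk.length_support, SimpleGraph.Walk.length_cons] at hlen
      omega

variable {n : ℕ} (e : Fin n ≃ Fin n)

/-- The vertices whose position is not in `S`. -/
noncomputable def removed (S : Finset ℕ) : Finset (Fin n) :=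
  Finset.univ.filter fun v => (e.symm v : ℕ) ∉ S

theorem mem_removed {S : Finset ℕ} {v : Fin n} : v ∈ removed e S ↔ (e.symm v : ℕ) ∉ S := by
  simp [removed]

theorem card_removed {S : Finset ℕ} : (removed e S).card = (Finset.range n \ S).card := by
  refine Finset.card_bij (fun v _ => (e.symm v : ℕ)) (fun v hv => ?_) (fun v _ w _ h => ?_)
    fun i hi => ?_
  · simpa [mem_removed] using hv
  · exact e.symm.injective (Fin.ext h)
  · rw [Finset.mem_sdiff, Finset.mem_range] at hi
    exact ⟨e ⟨i, hi.1⟩, by simpa [mem_removed] using hi.2, by simp⟩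

theorem exists_removed_eq (F : Finset (Fin n)) : ∃ S ⊆ Finset.range n, removed e S = F := by
  refine ⟨(Finset.univ.filter fun i => e i ∉ F).map Fin.valEmbedding, fun i hi => ?_, ?_⟩
  · simp only [Finset.mem_map, Fin.valEmbedding_apply] at hi
    obtain ⟨j, -, rfl⟩ := hi
    simp
  · ext v
    simp only [mem_removed, Finset.mem_map, Finset.mem_filter, Finset.mem_univ, true_and,
      Fin.valEmbedding_apply, Fin.val_inj]
    constructor
    · intro h
      by_contra hv
      exact h ⟨e.symm v, by simpa using hv, rfl⟩
    · rintro hv ⟨a, ha, rfl⟩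
      exact ha (by simpa using hv)

variable {G : SimpleGraph (Fin n)} {adj : ℕ → ℕ → Prop}

theorem isVCP_removed (hadj : ∀ i j : Fin n, adj i j ↔ G.Adj (e i) (e j)) {S : Finset ℕ}
    (hS : S ⊆ Finset.range n) :
    IsVCP 3 G (removed e S) ↔ ∀ w ∈ S, degIn adj S w ≤ 1 := by
  have key : ∀ w : Fin n, degIn adj S w =
      (Finset.univ.filter fun y => y ∉ removed e S ∧ G.Adj (e w) y).card := by
    intro w
    unfold degIn
    symm
    refine Finset.card_bij (fun y _ => (e.symm y : ℕ)) (fun y hy => ?_) (fun v _ w _ h => ?_)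
      fun i hi => ?_
    · simp only [Finset.mem_filter, Finset.mem_univ, true_and, mem_removed, not_not] at hy ⊢
      exact ⟨hy.1, (hadj _ _).2 (by simpa using hy.2)⟩
    · exact e.symm.injective (Fin.ext h)
    · rw [Finset.mem_filter] at hi
      have hin := Finset.mem_range.1 (hS hi.1)
      have := (hadj w ⟨i, hin⟩).1 hi.2
      exact ⟨e ⟨i, hin⟩, by simpa [mem_removed] using ⟨hi.1, this⟩, by simp⟩
  rw [isVCP_three_iff]
  constructor
  · intro h w hw
    have hwn := Finset.mem_range.1 (hS hw)
    rw [key ⟨w, hwn⟩]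
    convert h (e ⟨w, hwn⟩) (by simpa [mem_removed] using hw)
  · intro h w hw
    rw [mem_removed, not_not] at hw
    have := h _ hw
    rw [key, e.apply_symm_apply] at this
    convert this

theorem isMinimumVCP_removed (hadj : ∀ i j : Fin n, adj i j ↔ G.Adj (e i) (e j)) {S : Finset ℕ}
    (hS : Sol n adj (fun _ => False) (opt n adj fun _ => False) S) :
    IsMinimumVCP 3 G (removed e S) := by
  refine ⟨(isVCP_removed e hadj hS.1).2 hS.2.2.2, fun F' hF' => ?_⟩
  obtain ⟨S', hS', rfl⟩ := exists_removed_eq e F'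
  rw [card_removed, hS.2.1]
  refine least_le_of ⟨S', hS', ?_, fun _ _ => False.elim, (isVCP_removed e hadj hS').1 hF'⟩
  rw [card_removed]

end

/-! ### The input word -/

/-- The lengths are given on all natural numbers, so that the offset is a sum over a range and the
induction can shift `len`. -/
theorem getD_flatten_ofFn {k : ℕ} (f : Fin k → List ℕ) (len : ℕ → ℕ)
    (hlen : ∀ i, (f i).length = len i) (i : Fin k) {j : ℕ} (hj : j < len i) :
    (List.ofFn f).flatten.getD (∑ l ∈ Finset.range i, len l + j) 0 = (f i).getD j 0 := by
  induction k generalizing len with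
  | zero => exact i.elim0
  | succ k ih =>
    rw [List.ofFn_succ, List.flatten_cons]
    cases i using Fin.cases with
    | zero =>
      have h0 : j < len 0 := hj
      rw [Fin.val_zero, Finset.range_zero, Finset.sum_empty, zero_add,
        List.getD_append _ _ _ _ (by rw [hlen]; simpa using h0)]
    | succ i =>
      have hj : j < len (i + 1) := by simpa using hj
      have h1 := hlen 0
      rw [Fin.val_zero] at h1
      rw [Fin.val_succ, Finset.sum_range_succ', List.getD_append_right _ _ _ _ (by omega), h1,
        show ∑ l ∈ Finset.range i, len (l + 1) + len 0 + j - len 0 =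
          ∑ l ∈ Finset.range i, len (l + 1) + j by omega]
      exact ih (fun i => f i.succ) (fun l => len (l + 1)) (fun i => by simpa using hlen i.succ) i hj

theorem length_flatten_ofFn {k : ℕ} (f : Fin k → List ℕ) (len : ℕ → ℕ)
    (hlen : ∀ i, (f i).length = len i) :
    (List.ofFn f).flatten.length = ∑ l ∈ Finset.range k, len l := by
  rw [List.length_flatten, List.map_ofFn, List.sum_ofFn, ← Fin.sum_univ_eq_sum_range]
  exact Finset.sum_congr rfl fun i _ => hlen i

section
open Classical

variable {n m : ℕ} (G : SimpleGraph (Fin n)) (D : TreeDecomposition G (Fin m))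

noncomputable def adjN (u v : ℕ) : Prop := ∃ (hu : u < n) (hv : v < n), G.Adj ⟨u, hu⟩ ⟨v, hv⟩

variable {G}

noncomputable def bagList (i : ℕ) : List ℕ :=
  if hi : i < m then ((D.bag ⟨i, hi⟩).sort (· ≤ ·)).map (fun v : Fin n => (v : ℕ)) else []

noncomputable def parN (i : ℕ) : ℕ := if hi : i < m then D.parent ⟨i, hi⟩ else 0

def inBag (i v : ℕ) : Prop := ∃ (hi : i < m) (hv : v < n), (⟨v, hv⟩ : Fin n) ∈ D.bag ⟨i, hi⟩

noncomputable def topN (v : ℕ) : ℕ := if hv : v < n then D.top ⟨v, hv⟩ else 0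

def relN (v u : ℕ) : Prop :=
  ∃ (hv : v < n) (hu : u < n), (⟨u, hu⟩ : Fin n) ∈ D.bag (D.top ⟨v, hv⟩)

theorem bagList_fin (i : Fin m) :
    bagList D i = ((D.bag i).sort (· ≤ ·)).map (fun v : Fin n => (v : ℕ)) := by
  simp [bagList]

theorem length_bagList_fin (i : Fin m) : (bagList D i).length = (D.bag i).card := by
  simp [bagList_fin]

theorem mem_bagList {i v : ℕ} : v ∈ bagList D i ↔ inBag D i v := by
  unfold bagList inBag
  split_ifs with hi
  · simp only [List.mem_map, Finset.mem_sort, hi, exists_true_left]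
    constructor
    · rintro ⟨a, ha, rfl⟩; exact ⟨a.2, ha⟩
    · rintro ⟨hv, h⟩; exact ⟨_, h, rfl⟩
  · simp [hi]

theorem encodeInput_eq : encodeInput G D = [n, m, (D.root : ℕ)] ++
    ((List.ofFn fun u : Fin n => List.ofFn fun v : Fin n => if G.Adj u v then 1 else 0).flatten ++
    ((List.ofFn fun i : Fin m => (D.parent i : ℕ)) ++
      (List.ofFn fun i : Fin m => (bagList D i).length :: bagList D i).flatten)) := by
  simp only [encodeInput, bagList_fin, List.append_assoc, List.length_map, Finset.length_sort]

theorem length_adj : (List.ofFn fun u : Fin n => List.ofFn fun v : Fin n =>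
    if G.Adj u v then 1 else 0).flatten.length = n * n := by
  rw [length_flatten_ofFn _ (fun _ => n) (fun _ => by simp)]; simp

theorem length_encodeInput :
    (encodeInput G D).length = 3 + n * n + m + off (fun i => (bagList D i).length) m := by
  rw [encodeInput_eq, List.length_append, List.length_append, List.length_append, length_adj,
    length_flatten_ofFn _ (fun i => (bagList D i).length + 1) (fun _ => by simp)]
  simp only [List.length_cons, List.length_nil, List.length_ofFn, off]
  omega

theorem layout_encodeInput : Layout (fun i => (encodeInput G D).getD i 0) n m
    (fun z => if adjN G (z / n) (z % n) then 1 else 0) (parN D) (fun i => (bagList D i).length)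
    (fun i j => (bagList D i).getD j 0) := by
  have hadj : ∀ z < n * n, (encodeInput G D).getD (3 + z) 0 =
      (List.ofFn fun u : Fin n => List.ofFn fun v : Fin n =>
        if G.Adj u v then 1 else 0).flatten.getD z 0 := by
    intro z hz
    rw [encodeInput_eq, List.getD_append_right _ _ _ _ (by simp),
      List.getD_append _ _ _ _ (by rw [length_adj]; simpa using hz)]
    simp
  have hpar : ∀ i < m, (encodeInput G D).getD (3 + n * n + i) 0 =
      (List.ofFn fun i : Fin m => (D.parent i : ℕ)).getD i 0 := by
    intro i hi
    rw [encodeInput_eq, List.getD_append_right _ _ _ _ (by simp; omega),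
      List.getD_append_right _ _ _ _ (by rw [length_adj]; simp; omega),
      List.getD_append _ _ _ _ (by rw [length_adj]; simp; omega), length_adj]
    congr 1
    simp; omega
  have hbag : ∀ k, (encodeInput G D).getD (3 + n * n + m + k) 0 =
      (List.ofFn fun i : Fin m => (bagList D i).length :: bagList D i).flatten.getD k 0 := by
    intro k
    rw [encodeInput_eq, List.getD_append_right _ _ _ _ (by simp; omega),
      List.getD_append_right _ _ _ _ (by rw [length_adj]; simp; omega),
      List.getD_append_right _ _ _ _ (by rw [length_adj]; simp; omega), length_adj]
    congr 1
    simp; omega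
  have hget : ∀ i < m, ∀ j < (bagList D i).length + 1,
      (encodeInput G D).getD (3 + n * n + m + (off (fun i => (bagList D i).length) i + j)) 0 =
        ((bagList D i).length :: bagList D i).getD j 0 := by
    intro i hi j hj
    rw [hbag]
    exact getD_flatten_ofFn (fun i : Fin m => (bagList D i).length :: bagList D i)
      (fun i => (bagList D i).length + 1) (fun _ => by simp) ⟨i, hi⟩ hj
  refine ⟨fun z hz => ?_, fun i hi => ?_, fun i hi => ?_, fun i hi j hj => ?_, fun i hi => ?_,
    fun i hi j hj => ?_, fun z _ => ?_⟩
  · have h1 := div_lt_of_lt_mul' hz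
    have h2 := Nat.mod_lt z (pos_of_lt_mul hz)
    show (encodeInput G D).getD (3 + z) 0 = _
    have h3 := getD_flatten_ofFn (fun u : Fin n => List.ofFn fun v : Fin n =>
      if G.Adj u v then 1 else 0) (fun _ => n) (fun _ => by simp) ⟨z / n, h1⟩ h2
    simp only [Finset.sum_const, Finset.card_range, smul_eq_mul] at h3
    rw [mul_comm, Nat.div_add_mod] at h3
    rw [hadj z hz, h3, List.getD_eq_getElem _ _ (by simpa using h2), List.getElem_ofFn]
    simp [adjN, h1, h2]
  · show (encodeInput G D).getD (3 + n * n + i) 0 = _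
    rw [hpar i hi, List.getD_eq_getElem _ _ (by simpa using hi), List.getElem_ofFn]
    simp [parN, hi]
  · have := hget i hi 0 (by omega)
    simpa using this
  · have := hget i hi (j + 1) (by omega)
    rw [List.getD_cons_succ] at this
    show (encodeInput G D).getD _ 0 = _
    rw [← this]
    congr 1
    omega
  · simp [parN, hi]
  · have h1 : (bagList D i).getD j 0 ∈ bagList D i := by
      rw [List.getD_eq_getElem _ _ hj]; exact List.getElem_mem hj
    obtain ⟨-, hv, -⟩ := (mem_bagList D).1 h1
    exact hv
  · show (if _ then 1 else 0) ≤ 1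
    split_ifs <;> omega

theorem getD_encodeInput_le (i : ℕ) : (encodeInput G D).getD i 0 ≤ n + m + 1 := by
  by_cases hi : i < (encodeInput G D).length
  · rw [List.getD_eq_getElem _ _ hi]
    have hmem := List.getElem_mem hi
    generalize (encodeInput G D)[i] = x at hmem
    rw [encodeInput_eq] at hmem
    simp only [List.mem_append, List.mem_cons, List.not_mem_nil, or_false, List.mem_flatten,
      List.mem_ofFn] at hmem
    rcases hmem with (rfl | rfl | rfl) | ⟨l, ⟨u, rfl⟩, h⟩ | ⟨j, rfl⟩ | ⟨l, ⟨j, rfl⟩, h⟩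
    · omega
    · omega
    · have := D.root.2; omega
    · rw [List.mem_ofFn] at h
      obtain ⟨v, rfl⟩ := h
      split_ifs <;> omega
    · have := (D.parent j).2; omega
    · rw [List.mem_cons] at h
      rcases h with rfl | h
      · have := card_finset_fin_le (D.bag j)
        rw [length_bagList_fin]; omega
      · obtain ⟨-, hv, -⟩ := (mem_bagList D).1 h
        omega
  · rw [List.getD_eq_default _ _ (by omega)]; omega

theorem off_eq_size : off (fun i => (bagList D i).length) m = D.size := by
  rw [off, TreeDecomposition.size, ← Fin.sum_univ_eq_sum_range
    (fun i => (bagList D i).length + 1)]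
  exact Finset.sum_congr rfl fun i _ => by rw [length_bagList_fin]

end

end VCP

/-! ### From the tree decomposition to the hypotheses on the program -/

namespace VCP

open RAM ElimOrder

set_option linter.unusedSectionVars false
set_option linter.constructorNameAsVariable false

section
open Classical

variable {n m p : ℕ} {G : SimpleGraph (Fin n)} (D : TreeDecomposition G (Fin m))

theorem relN_or {i : Fin m} {u v : ℕ} (hu : u < n) (hv : v < n) (h : (⟨u, hu⟩ : Fin n) ∈ D.bag i)
    (h' : (⟨v, hv⟩ : Fin n) ∈ D.bag i) : relN D u v ∨ relN D v u := by
  rcases D.mem_bag_top_or h h' with h1 | h1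
  · exact Or.inr ⟨hv, hu, h1⟩
  · exact Or.inl ⟨hu, hv, h1⟩

theorem relN_sel (W : Finset ℕ) (hW : W ⊆ Finset.range n) (hne : W.Nonempty) :
    ∃ v ∈ W, ∀ w ∈ W, relN D w v → relN D v w := by
  obtain ⟨w, hw⟩ := hne
  have hwn := Finset.mem_range.1 (hW hw)
  obtain ⟨v, hv, h⟩ := D.exists_simplicial (W := Finset.univ.filter fun v : Fin n => (v : ℕ) ∈ W)
    ⟨⟨w, hwn⟩, by simpa using hw⟩
  refine ⟨v, by simpa using hv, fun w hw hr => ?_⟩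
  obtain ⟨h1, _, h3⟩ := hr
  exact ⟨v.2, h1, h ⟨w, h1⟩ (by simpa using hw) h3⟩

theorem card_bag_le (hD : D.width ≤ (p : ℤ)) (i : Fin m) : (D.bag i).card ≤ p + 1 := by
  have h1 : (D.bag i).card ≤ Finset.univ.sup fun i => (D.bag i).card :=
    Finset.le_sup (f := fun i => (D.bag i).card) (Finset.mem_univ i)
  unfold TreeDecomposition.width at hD
  omega

/-- The later relatives of a vertex lie in the bag of its top, which also contains the vertex
itself. This leaves at most `p` of them, and the greedy bound gives colours `0, ..., p`. -/
theorem colors_le (hD : D.width ≤ (p : ℤ)) : colors (upRel (relN D) n) n ≤ p + 1 := by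
  have hU : ∀ {i j}, upRel (relN D) n i j → i < j ∧ j < n := fun h => ⟨h.1, h.2.1⟩
  refine least_le_of fun i hi => Nat.lt_succ_of_le (color_spec hU hi ?_).1
  have hi' := (ord_spec (relN_sel D) hi).1
  set x : Fin n := ⟨ord (relN D) n i, hi'⟩
  have h1 : (((D.bag (D.top x)).map Fin.valEmbedding).erase (ord (relN D) n i)).card ≤ p := by
    have h2 := card_bag_le D hD (D.top x)
    rw [Finset.card_erase_of_mem, Finset.card_map]
    · omega
    · exact Finset.mem_map.2 ⟨x, D.mem_bag_top x, rfl⟩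
  refine (Finset.card_le_card_of_injOn (ord (relN D) n) (fun j hj => ?_)
    fun j hj k hk h => ?_).trans h1
  · simp only [Finset.coe_filter, Finset.mem_range, Set.mem_ofPred_eq] at hj
    obtain ⟨hjn, hij, -, h3, h4, h5⟩ := hj
    refine Finset.mem_coe.2 (Finset.mem_erase.2 ⟨fun h => ?_, Finset.mem_map.2 ⟨_, h5, rfl⟩⟩)
    have := ord_inj (relN_sel D) hjn hi h
    omega
  · simp only [Finset.coe_filter, Finset.mem_range, Set.mem_ofPred_eq] at hj hk
    exact ord_inj (relN_sel D) hj.1 hk.1 h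

/-- The vertex at each position of the elimination order. -/
noncomputable def position : Fin n ≃ Fin n :=
  Equiv.ofBijective (fun i => ⟨ord (relN D) n i, (ord_spec (relN_sel D) i.2).1⟩)
    (Finite.injective_iff_bijective.1 fun i j h =>
      Fin.ext (ord_inj (relN_sel D) i.2 j.2 (congrArg Fin.val h)))

theorem position_val (i : Fin n) : (position D i : ℕ) = ord (relN D) n i := rfl

theorem adjN_iff (u v : Fin n) : adjN G u v ↔ G.Adj u v := by simp [adjN]

theorem top_spec {v : ℕ} (hv : v < n) : topN D v < m ∧ inBag D (topN D v) v ∧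
    (topN D v = D.root ∨ ¬ inBag D (parN D (topN D v)) v) := by
  have h := D.isTop_top ⟨v, hv⟩
  simp only [topN, hv, dif_pos, parN, Fin.is_lt, Fin.eta]
  refine ⟨trivial, ⟨Fin.is_lt _, hv, h.1⟩, h.2.imp (congrArg Fin.val) ?_⟩
  rintro h1 ⟨_, _, h2⟩
  exact h1 h2

theorem top_unique {v i : ℕ} (hv : v < n) (hi : i < m) (h : inBag D i v)
    (h' : i = D.root ∨ ¬ inBag D (parN D i) v) : i = topN D v := by
  obtain ⟨_, _, h1⟩ := h
  simp only [topN, hv, dif_pos]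
  refine congrArg Fin.val (D.isTop_unique (v := ⟨v, hv⟩) (i := ⟨i, hi⟩) ⟨h1, ?_⟩ (D.isTop_top _))
  refine h'.imp Fin.ext fun h2 h3 => h2 ?_
  simp only [parN, hi, dif_pos]
  exact ⟨Fin.is_lt _, hv, h3⟩

theorem solve_encodeInput {B N b : ℕ} (hbe : colors (upRel (relN D) n) n = b)
    (hN : 3 + n * n + m + D.size ≤ N) (hB : 3 + n * n + m + D.size ≤ B)
    (hB1 : (b + 1) * (3 ^ b * ((n + 1) * (2 * b + 1))) ≤ B)
    (hB2 : (n + 1) * (3 ^ b * (n + 1)) ≤ B)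
    (hB3 : (n + 1) * (2 * b + 1) * (2 ^ b * 2 ^ b) ≤ B) :
    Tri B N solve (start fun i => (encodeInput G D).getD i 0) (solveT n b D.size) fun τ =>
      ∃ F : Finset (Fin n), IsMinimumVCP 3 G F ∧ ∀ v : Fin n, τ.io v = if v ∈ F then 1 else 0 := by
  rw [← off_eq_size] at hN hB ⊢
  refine (solve_spec (adj := adjN G) (Rel := relN D) (root := D.root) (top := topN D)
    (inBag := inBag D) (b := b)
    (layout_encodeInput D) (by rw [encodeInput_eq]; rfl) (by rw [encodeInput_eq]; rfl)
    (by rw [encodeInput_eq]; rfl) (fun u hu v hv => ?_) (fun i hi v => ?_)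
    (fun v hv => top_spec D hv) (fun v hv i hi => top_unique D hv hi) (fun v hv u hu => ?_)
    (relN_sel D) ?_ ?_ ?_ ?_ hbe hN hB hB1 hB2 hB3).mono le_rfl ?_
  · simp only [div_pair hv, mod_pair hv]
  · rw [← mem_bagList, List.mem_iff_getElem]
    refine exists_congr fun j => ⟨?_, ?_⟩
    · rintro ⟨hj, h⟩; exact ⟨hj, by rw [List.getD_eq_getElem _ _ hj, h]⟩
    · rintro ⟨hj, h⟩; exact ⟨hj, by rw [← h, List.getD_eq_getElem _ _ hj]⟩
  · simp [relN, inBag, topN, hv, hu]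
  · rintro x y ⟨hx, hy, h⟩; exact ⟨hy, hx, h.symm⟩
  · rintro x ⟨hx, _, h⟩; exact G.loopless.irrefl _ h
  · rintro x y ⟨hx, hy, h⟩
    obtain ⟨i, h1, h2⟩ := D.exists_edge_bag _ _ h
    exact relN_or D hx hy h1 h2
  · rintro x y z hy hz ⟨_, _, h1⟩ ⟨_, _, h2⟩
    exact relN_or D hy hz h1 h2
  · rintro τ ⟨S, hS, hτ⟩
    refine ⟨removed (position D) S, isMinimumVCP_removed _ (fun i j => ?_) hS, fun v => ?_⟩
    · rw [← adjN_iff, position_val, position_val]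
      simp
    · have h1 := hτ _ ((position D).symm v).2
      rw [← position_val, Equiv.apply_symm_apply] at h1
      rw [h1]
      by_cases h2 : ((position D).symm v : ℕ) ∈ S <;> simp [mem_removed, h2]

end

/-! ### Resource bounds -/

section
variable {n b l X Y : ℕ}

theorem one_le_three_pow_mul (hY : Y = 3 ^ b * (b + 1)) : 3 ^ b ≤ Y ∧ 1 ≤ Y := by
  have h3 : 1 ≤ 3 ^ b := Nat.one_le_pow _ _ (by norm_num)
  have h : 3 ^ b ≤ Y := hY ▸ Nat.le_mul_of_pos_right _ (by omega)
  exact ⟨h, h3.trans h⟩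

theorem mul_pow_mono (hX : X = n + 1) {i j : ℕ} (h : i ≤ j) : Y * X ^ i ≤ Y * X ^ j :=
  Nat.mul_le_mul_left _ (Nat.pow_le_pow_right (by omega) h)

/-- The number of keys enters twice, as a factor of the number of cells and as the length of a
convolution. Bounding it by `2 * X ^ 2` through `b ≤ n` leaves a single factor `b + 1` beside `3 ^
b`. -/
theorem elimT_le (hX : X = n + 1) (hY : Y = 3 ^ b * (b + 1)) (hb : b ≤ n) :
    elimT n b ≤ 36 * (Y * X ^ 4) := by
  obtain ⟨hSY, h1Y⟩ := one_le_three_pow_mul hY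
  have hXp : ∀ {i j}, i ≤ j → X ^ i ≤ X ^ j := fun h => Nat.pow_le_pow_right (by omega) h
  have hL : X * (2 * b + 1) ≤ 2 * X ^ 2 := by
    rw [pow_two, mul_left_comm]; exact Nat.mul_le_mul_left _ (by omega)
  have h12 := hXp (show 1 ≤ 2 by omega)
  rw [pow_one] at h12
  have e1 : (b + 1) * (3 ^ b * (X * (2 * b + 1))) ≤ 2 * (Y * X ^ 2) :=
    calc (b + 1) * (3 ^ b * (X * (2 * b + 1))) = Y * (X * (2 * b + 1)) := by rw [hY]; ring
      _ ≤ Y * (2 * X ^ 2) := Nat.mul_le_mul_left _ hL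
      _ = _ := by ring
  have e2 : 13 + 6 * n + X * (2 * b + 1) ≤ 15 * X ^ 2 := by omega
  have e3 := Nat.mul_le_mul e1 e2
  have e4 : 2 * (Y * X ^ 2) * (15 * X ^ 2) = 30 * (Y * X ^ 4) := by ring
  have e5 : 3 ^ b * X ≤ Y * X ^ 4 :=
    Nat.mul_le_mul hSY (by simpa using hXp (show 1 ≤ 4 by omega))
  have e6 : 1 * X ^ 0 ≤ Y * X ^ 4 := Nat.mul_le_mul h1Y (hXp (by omega))
  rw [elimT, ← hX]
  rw [pow_zero] at e6
  omega

theorem prepT_le (hX : X = n + 1) (hY : Y = 3 ^ b * (b + 1)) (hb : b ≤ n) :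
    prepT n b ≤ 70 * (Y * X ^ 6) := by
  obtain ⟨hSY, h1Y⟩ := one_le_three_pow_mul hY
  have hle : ∀ i ≤ 6, X ^ i ≤ Y * X ^ 6 := fun i hi =>
    (Nat.le_mul_of_pos_left _ h1Y).trans (mul_pow_mono hX hi)
  have h0 := hle 0 (by omega)
  have h1 := hle 1 (by omega)
  have h2 := hle 2 (by omega)
  have h3 := hle 3 (by omega)
  have h4 := hle 4 (by omega)
  have h5 := hle 5 (by omega)
  have hY6 := mul_pow_mono (Y := Y) hX (show 0 ≤ 6 by omega)
  rw [pow_zero] at h0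
  rw [pow_one] at h1
  rw [pow_zero, mul_one] at hY6
  have hnn : n * n ≤ X ^ 2 := by rw [pow_two]; exact Nat.mul_le_mul (by omega) (by omega)
  have hones : 3 ^ b * (3 + b) ≤ 3 * Y := by
    rw [hY, mul_left_comm]; exact Nat.mul_le_mul_left _ (by omega)
  rw [prepT, ← hX]
  generalize Y * X ^ 6 = M at *
  generalize X ^ 5 = X5 at *
  generalize X ^ 4 = X4 at *
  generalize X ^ 3 = X3 at *
  generalize X ^ 2 = X2 at *
  generalize n * n = N at *
  generalize 3 ^ b * (3 + b) = K at *
  omega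

theorem sweepT_le (hX : X = n + 1) (hY : Y = 3 ^ b * (b + 1)) (hb : b ≤ n) :
    sweepT n b ≤ 46 * (Y * X ^ 5) := by
  obtain ⟨hSY, h1Y⟩ := one_le_three_pow_mul hY
  have hle : ∀ i ≤ 5, X ^ i ≤ Y * X ^ 5 := fun i hi =>
    (Nat.le_mul_of_pos_left _ h1Y).trans (mul_pow_mono hX hi)
  have h0 := hle 0 (by omega)
  have h2 := hle 2 (by omega)
  rw [pow_zero] at h0
  have hel := elimT_le hX hY hb
  have h4 := mul_pow_mono (Y := Y) hX (show 0 ≤ 4 by omega)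
  have e1 : X * (3 ^ b * X) ≤ Y * X ^ 5 :=
    calc X * (3 ^ b * X) = 3 ^ b * X ^ 2 := by ring
      _ ≤ Y * X ^ 2 := Nat.mul_le_mul_right _ hSY
      _ ≤ _ := mul_pow_mono hX (by omega)
  have e2 : n * (1 + elimT n b) ≤ 37 * (Y * X ^ 5) :=
    calc n * (1 + elimT n b) ≤ X * (37 * (Y * X ^ 4)) :=
          Nat.mul_le_mul (by omega) (by rw [pow_zero] at h4; omega)
      _ = _ := by ring
  have e3 : X * (2 + X) ≤ 3 * X ^ 2 :=
    calc X * (2 + X) ≤ X * (3 * X) := Nat.mul_le_mul_left _ (by omega)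
      _ = _ := by ring
  rw [sweepT, ← hX]
  omega

theorem solveT_le (hX : X = n + 1) (hY : Y = 3 ^ b * (b + 1)) (hb : b ≤ n) :
    solveT n b l ≤ 250 * (Y * X ^ 6) + 14 * l := by
  obtain ⟨hSY, h1Y⟩ := one_le_three_pow_mul hY
  have hle : ∀ i ≤ 6, X ^ i ≤ Y * X ^ 6 := fun i hi =>
    (Nat.le_mul_of_pos_left _ h1Y).trans (mul_pow_mono hX hi)
  have h0 := hle 0 (by omega)
  have h1 := hle 1 (by omega)
  have h2 := hle 2 (by omega)
  rw [pow_zero] at h0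
  rw [pow_one] at h1
  have hnn : n * n ≤ X ^ 2 := by rw [pow_two]; exact Nat.mul_le_mul (by omega) (by omega)
  have hprep := prepT_le hX hY hb
  have hsweep := sweepT_le hX hY hb
  have h5 := mul_pow_mono (Y := Y) hX (show 0 ≤ 5 by omega)
  rw [pow_zero, mul_one] at h5
  have e4 : X * (1 + (3 + sweepT n b)) ≤ 50 * (Y * X ^ 6) :=
    calc X * (1 + (3 + sweepT n b)) ≤ X * (50 * (Y * X ^ 5)) :=
          Nat.mul_le_mul_left _ (by omega)
      _ = _ := by ring
  rw [solveT, searchT, ← hX]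
  omega

end

/-- Set register `0` to the start of the array area. -/
def setup : Cmd :=
  .seq (.load (tmp 0) 0) <| .seq (.const (tmp 1) 1) <| .seq (.load (tmp 1) (tmp 1)) <|
  .seq (.const (tmp 2) 1) <| .seq (.op .add (tmp 2) (tmp 0) (tmp 2)) <|
  .seq (.op .mul (tmp 2) (tmp 1) (tmp 2)) <| .seq (.op .add (tmp 2) (tmp 2) (tmp 1)) <|
  .seq (.op .mul (tmp 0) (tmp 0) (tmp 0)) <| .seq (.op .add (tmp 2) (tmp 2) (tmp 0)) <|
  .seq (.const (tmp 0) 3) <| .op .add 0 (tmp 2) (tmp 0)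

/-- The base address bounds the length of the input in terms of `n` and `m` alone, because a bag has
at most `n` elements. It is thus known before the bags are read, and the cells from there on are
still zero. The first load takes its address from register `0`, which is initially zero. -/
theorem setup_spec {s : State} {n m w : ℕ} (hr : ∀ r, s.reg r = 0) (h0 : s.mem 0 = n)
    (h1 : s.mem 1 = m) (hw : m * (n + 1) + m + n * n + n + 3 < 2 ^ w)
    (hz : ∀ a, m * (n + 1) + m + n * n + 3 ≤ a → s.mem a = 0) :
    W w setup s fun t s' => t = 11 ∧
      Sim (m * (n + 1) + m + n * n + 3) s' (start s.mem) := by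
  have ht : ∀ k, tmp k ≠ 0 := fun k => (zero_ne_tmp k).symm
  have hmn : m ≤ m * (n + 1) := Nat.le_mul_of_pos_right _ (by omega)
  refine W.seq (W.load (by simp [hr, h0]; omega) ?_)
  refine W.seq (W.const (by omega) (W.seq (W.load (by simp [h1]; omega) ?_)))
  refine W.seq (W.const (by omega) (W.seq (W.op (by simp [hr, h0, Op.eval]; omega) ?_)))
  refine W.seq (W.op (by simp [hr, h0, h1, Op.eval]; omega) ?_)
  refine W.seq (W.op (by simp [hr, h0, h1, Op.eval]; omega) ?_)
  refine W.seq (W.op (by simp [hr, h0, h1, Op.eval]; omega) ?_)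
  refine W.seq (W.op (by simp [hr, h0, h1, Op.eval]; omega) ?_)
  refine W.seq (W.const (by omega) (W.op (by simp [hr, h0, h1, Op.eval]; omega) ⟨rfl, ?_⟩))
  refine ⟨by simp [hr, h0, h1, Op.eval], fun r => ?_, fun i _ => rfl, fun a i => ?_⟩
  · simp [hr, start, (zero_ne_rg r).symm]
  · exact hz _ (by omega)

end VCP

/-! ### Bounds in terms of the width, and the theorem -/

namespace VCP

open RAM

theorem size_le {n m : ℕ} {G : SimpleGraph (Fin n)} (D : TreeDecomposition G (Fin m)) :
    D.size ≤ m * (n + 1) := by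
  refine (Finset.sum_le_card_nsmul _ _ (n + 1) fun i _ => ?_).trans (by simp)
  exact Nat.add_le_add_right (card_finset_fin_le _) 1

theorem one_le_size {n m : ℕ} {G : SimpleGraph (Fin n)} (D : TreeDecomposition G (Fin m)) :
    1 ≤ D.size :=
  (Nat.le_add_left 1 _).trans (Finset.single_le_sum (f := fun i => (D.bag i).card + 1)
    (fun _ _ => Nat.zero_le _) (Finset.mem_univ D.root))

/-- All numbers that occur are polynomial in `U`. -/
theorem bounds_of_pow {n m b U : ℕ} (hm : 1 ≤ m) (hbn : b ≤ n) (hU4 : 4 ≤ U) (hnm : n + m ≤ U)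
    (hbU : 2 ^ b * 2 ^ b ≤ U ^ 2) :
    m * (n + 1) + m + n * n + n + 3 ≤ U ^ 6 ∧
    (b + 1) * (3 ^ b * ((n + 1) * (2 * b + 1))) ≤ U ^ 6 ∧
    (n + 1) * (3 ^ b * (n + 1)) ≤ U ^ 6 ∧ (n + 1) * (2 * b + 1) * (2 ^ b * 2 ^ b) ≤ U ^ 6 := by
  have h3 : 3 ^ b ≤ U ^ 2 := by
    refine le_trans ?_ hbU
    rw [← mul_pow]
    exact Nat.pow_le_pow_left (by norm_num) b
  have hUp : ∀ {i j}, i ≤ j → U ^ i ≤ U ^ j := fun h => Nat.pow_le_pow_right (by omega) h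
  have h2b : 2 * b + 1 ≤ U ^ 2 := by rw [pow_two]; nlinarith
  have hn1 : n + 1 ≤ U := by omega
  have hL : (n + 1) * (2 * b + 1) ≤ U * U ^ 2 := Nat.mul_le_mul hn1 h2b
  refine ⟨?_, ?_, ?_, ?_⟩
  · have e1 : m * (n + 1) ≤ U * U := Nat.mul_le_mul (by omega) hn1
    have e2 : n * n ≤ U * U := Nat.mul_le_mul (by omega) (by omega)
    have e3 : 4 * U ≤ U * U := Nat.mul_le_mul_right _ hU4
    have e4 : 4 * (U * U) ≤ U * (U * U) := Nat.mul_le_mul_right _ hU4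
    have e5 : U * (U * U) = U ^ 3 := by ring
    have e6 := hUp (show 3 ≤ 6 by omega)
    omega
  · calc (b + 1) * (3 ^ b * ((n + 1) * (2 * b + 1))) ≤ U * (U ^ 2 * (U * U ^ 2)) :=
          Nat.mul_le_mul (by omega) (Nat.mul_le_mul h3 hL)
      _ = U ^ 6 := by ring
  · calc (n + 1) * (3 ^ b * (n + 1)) ≤ U * (U ^ 2 * U) :=
          Nat.mul_le_mul hn1 (Nat.mul_le_mul h3 hn1)
      _ = U ^ 4 := by ring
      _ ≤ U ^ 6 := hUp (by omega)
  · calc (n + 1) * (2 * b + 1) * (2 ^ b * 2 ^ b) ≤ U * U ^ 2 * U ^ 2 := Nat.mul_le_mul hL hbU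
      _ = U ^ 5 := by ring
      _ ≤ U ^ 6 := hUp (by omega)

theorem solveT_le_of_width {n p b l : ℕ} (hp : 1 ≤ p) (hbn : b ≤ n) (hbp : b ≤ p + 1)
    (hl : 1 ≤ l) : solveT n b l ≤ 150000 * (3 ^ p * p * n ^ 6 + l) := by
  have h := solveT_le (l := l) rfl rfl hbn
  -- For `n = 0` the main term vanishes and the constant work is charged to `l`. Otherwise `(n + 1)
  -- ^ 6 ≤ 64 * n ^ 6` and `b + 1 ≤ p + 2 ≤ 3 * p` give the constant 250 * 576 = 144000.
  rcases n.eq_zero_or_pos with rfl | hn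
  · obtain rfl : b = 0 := by omega
    simp only [pow_zero, zero_add, one_pow, mul_one] at h
    omega
  · have e1 : (n + 1) ^ 6 ≤ 64 * n ^ 6 :=
      calc (n + 1) ^ 6 ≤ (2 * n) ^ 6 := Nat.pow_le_pow_left (by omega) 6
        _ = _ := by ring
    have e2 : 3 ^ b * (b + 1) ≤ 9 * (3 ^ p * p) :=
      calc 3 ^ b * (b + 1) ≤ 3 ^ (p + 1) * (3 * p) :=
            Nat.mul_le_mul (Nat.pow_le_pow_right (by norm_num) hbp) (by omega)
        _ = _ := by ring
    have e3 := Nat.mul_le_mul e2 e1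
    have e4 : 9 * (3 ^ p * p) * (64 * n ^ 6) = 576 * (3 ^ p * p * n ^ 6) := by ring
    omega

end VCP

theorem theorem2 :
    ∃ (prog : RAM.Cmd) (c C : ℕ),
      ∀ (n m p : ℕ) (G : SimpleGraph (Fin n)) (D : TreeDecomposition G (Fin m)),
        1 ≤ p → D.width ≤ (p : ℤ) →
        ∃ (t : ℕ) (s : RAM.State) (F : Finset (Fin n)),
          RAM.Exec (c * (p + Nat.log 2 (n + m) + 1)) prog (RAM.init (encodeInput G D)) t s ∧
          t ≤ C * (3 ^ p * p * n ^ 6 + D.size) ∧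
          IsMinimumVCP 3 G F ∧
          ∀ v : Fin n, s.mem (v : ℕ) = if v ∈ F then 1 else 0 := by
  set d := VCP.solve.deg (Fintype.card VCP.Ar) with hd
  have hd1 : 1 ≤ d := VCP.solve.deg_pos _
  -- With `ℓ` the unit of word length, values are at most `B = (2 ^ ℓ) ^ 6` and intermediate results
  -- at most `B ^ d = 2 ^ (6 * d * ℓ)`; one more `ℓ` makes this strict. The setup takes 11 steps,
  -- charged to the size of the decomposition, which is at least one.
  refine ⟨.seq VCP.setup (VCP.solve.compile 0), 6 * d + 1, 11 + VCP.solve.factor * 150000,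
    fun n m p G D hp hD => ?_⟩
  have hm : 1 ≤ m := Nat.succ_le_of_lt (Fin.pos D.root)
  set ℓ := p + Nat.log 2 (n + m) + 1 with hℓ
  set b := VCP.colors (VCP.upRel (VCP.relN D) n) n with hb
  have hbn : b ≤ n := least_le _ _
  have hbp : b ≤ p + 1 := VCP.colors_le D hD
  have hU4 : 4 ≤ 2 ^ ℓ :=
    calc 4 = 2 ^ 2 := by norm_num
      _ ≤ 2 ^ ℓ := Nat.pow_le_pow_right (by norm_num) (by omega)
  have hnm : n + m ≤ 2 ^ ℓ :=
    (Nat.lt_pow_succ_log_self (by norm_num) (n + m)).le.trans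
      (Nat.pow_le_pow_right (by norm_num) (by omega))
  have hbU : 2 ^ b * 2 ^ b ≤ (2 ^ ℓ) ^ 2 := by
    rw [pow_two]
    have : 2 ^ b ≤ 2 ^ ℓ := Nat.pow_le_pow_right (by norm_num) (by omega)
    exact Nat.mul_le_mul this this
  obtain ⟨hB0, hB1, hB2, hB3⟩ := VCP.bounds_of_pow hm hbn hU4 hnm hbU
  set B := (2 ^ ℓ) ^ 6 with hB
  have hUB : (2 ^ ℓ) ≤ B := Nat.le_self_pow (by norm_num) _
  have hw : B ^ d < 2 ^ ((6 * d + 1) * ℓ) := by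
    rw [hB, ← pow_mul, ← pow_mul]
    exact Nat.pow_lt_pow_right (by norm_num) (by nlinarith)
  have hBw : B < 2 ^ ((6 * d + 1) * ℓ) := (Nat.le_self_pow (by omega) B).trans_lt hw
  have hsize := VCP.size_le D
  have hlen := VCP.length_encodeInput D
  rw [VCP.off_eq_size] at hlen
  obtain ⟨hsafe, hcost, F, hF, hout⟩ := VCP.solve_encodeInput D (B := B)
    (N := m * (n + 1) + m + n * n + 3) hb.symm (by omega) (by omega) hB1 hB2 hB3
  obtain ⟨t₁, s₁, hx₁, rfl, hs₁⟩ := VCP.setup_spec (s := RAM.init (encodeInput G D)) (n := n) (m := m)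
    (w := (6 * d + 1) * ℓ) (fun _ => rfl) (by rw [VCP.encodeInput_eq]; rfl)
    (by rw [VCP.encodeInput_eq]; rfl) (by omega)
    (fun a ha => List.getD_eq_default _ _ (by omega))
  replace hs₁ : RAM.Sim (m * (n + 1) + m + n * n + 3) s₁
    (VCP.start fun i => (encodeInput G D).getD i 0) := hs₁
  obtain ⟨t₂, s₂, hx₂, ht₂, hs₂, -⟩ := VCP.solve.compile_spec (by omega) (by omega) hw 0 s₁ _ hs₁
    ⟨fun _ => Nat.zero_le _, fun _ _ => Nat.zero_le _, fun i =>
      (VCP.getD_encodeInput_le D i).trans (by omega)⟩ hsafe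
  have hT := VCP.solveT_le_of_width hp hbn hbp (VCP.one_le_size D)
  refine ⟨_, s₂, F, .seq hx₁ hx₂, ?_, hF, fun v => ?_⟩
  · have h1 := VCP.one_le_size D
    have h2 := ht₂.trans (Nat.mul_le_mul_left VCP.solve.factor (hcost.trans hT))
    rw [← mul_assoc] at h2
    rw [add_mul]
    omega
  · have := v.2
    have hnn : n ≤ n * n := Nat.le_mul_self n
    exact (hs₂.io v (by omega)).trans (hout v)
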